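/- **Conventions.** Let $\mathbb F$ be a field. A polynomial $A\in\mathbb F[x_1,\dots,x_n]$ has *individual degree* $d$ if every variable occurs in it with degree at most $d$. It is *computed by an ROABP of width $w$* if, for some permutation $\pi$ of $[n]$, it is the sum, over all paths from the start vertex to the end vertex, of the products of the edge weights in a layered graph with layers $V_0,\dots,V_n$, where $V_0$ and $V_n$ consist of the start and the end vertex, $|V_i|\le w$ for $0<i<n$, and the edges from $V_{i-1}$ to $V_i$ carry univariate polynomials in $x_{\pi(i)}$. A *sum of $c$ ROABPs* is a sum of $c$ such polynomials, each with its own variable order. A set $H\subseteq\mathbb F^n$ is a *hitting set* for a class of $n$-variate polynomials if every nonzero $A$ in the class has a point $a\in H$ with $A(a)\ne0$. A polynomial over a field is *$\ell$-concentrated* if each of its coefficients lies in the span of the coefficients of the monomials with fewer than $\ell$ distinct variables. Algorithms are programs for a random access machine with registers for natural numbers (constants, addition, truncated subtraction, zero test, indirect addressing) and registers for elements of $\mathbb F$ (constants $0,1$, field operations, zero test, indirect addressing), each step at unit cost, with a write-only output; the $i$-th element of a supply $\alpha_0,\alpha_1,\dots$ of elements of $\mathbb F$ can be fetched in one step. Programs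 do not depend on $\mathbb F$. For $n,d,w,c\ge1$ put $s=\max(ndw,2)$, $W=(d+1)(2w)^{2^{c-1}}$ and $\ell=c\,\lceil\log_2(W^2+1)\rceil$. **Theorem.** There are a single program and a constant $K\in\mathbb N$ such that the following holds for every field $\mathbb F$, all $n,d,w,c\ge1$, and every supply $\alpha_0,\alpha_1,\dots$ of elements of $\mathbb F$ whose first $M:=s^{K 2^c\lfloor\log_2 s\rfloor}$ terms are pairwise distinct (so that $\mathbb F$ is large enough). On input $n,d,w,c$ the program halts after at most $$ s^{K c\,2^c\lfloor \log_2 s\rfloor}=(ndw)^{O(c\cdot 2^c\log (ndw))} $$ steps (the right-hand expression being read for $ndw\ge 2$) and outputs a list of the points of a hitting set $H\subseteq\mathbb F^n$ for all $n$-variate polynomials of individual degree $d$ that are computed by a sum of $c$ ROABPs of width $w$. (For constant $c$ this is quasi-polynomial in $n,d,w$.) Moreover, there are a tuple $f(t)\in\mathbb F[t]^n$ of polynomials of degree at most $M$, a set $T\subseteq\mathbb F$ with $|T|\le M$, and distinct nonzero $\beta_1,\dots,\beta_d\in\mathbb F$ such that $A(x+f(t))\in\mathbb F(t)[x]$ is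 $\ell$-concentrated for every such polynomial $A$, and $$ H=\bigcup_{\tau\in T}\bigl\{\,h+f(\tau)\;:\;h\in\{0,\beta_1,\dots,\beta_d\}^n,\ h\text{ has fewer than }\ell\text{ nonzero coordinates}\,\bigr\}. $$ -/

import Mathlib

namespace SumROABP

open Polynomial

/-! ### Polynomials computed by ROABPs, and hitting sets -/

section Polynomials

variable {F : Type*} [Field F] {n : ℕ}

/-- `A` is computed by a read-once oblivious arithmetic branching program of width `w`.
The program has vertex layers `V₀, …, Vₙ`. For some variable order `π` on `[n]`, the edges from
the `i`-th layer to the next one carry univariate polynomials `D i` in the variable `x_{π i}`.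
Layers are padded to exactly `w` vertices and absent edges have weight `0`; the polynomial computed,
the sum over all paths from the start vertex `u` (in `V₀`) to the end vertex `v` (in `Vₙ`) of the
products of the edge weights, is then the `(u, v)` entry of the ordered product of the matrices.
The remaining (padding) vertices of `V₀` and `Vₙ` do not contribute to that entry. -/
def ComputedByROABP (w : ℕ) (A : MvPolynomial (Fin n) F) : Prop :=
  ∃ (π : Equiv.Perm (Fin n)) (D : Fin n → Matrix (Fin w) (Fin w) F[X]) (u v : Fin w),
    A = (List.ofFn fun i : Fin n =>
      (D i).map fun p => aeval (MvPolynomial.X (π i) : MvPolynomial (Fin n) F) p).prod u v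

/-- `A` is a sum of `c` polynomials, each computed by an ROABP of width `w` (the variable orders of
the `c` programs are independent of each other). -/
def SumOfROABPs (c w : ℕ) (A : MvPolynomial (Fin n) F) : Prop :=
  ∃ B : Fin c → MvPolynomial (Fin n) F, (∀ j, ComputedByROABP w (B j)) ∧ A = ∑ j, B j

/-- Every variable occurs with degree at most `d`. -/
def HasIndividualDegree (d : ℕ) (A : MvPolynomial (Fin n) F) : Prop :=
  ∀ i, A.degreeOf i ≤ d

/-- `H` is a hitting set for the `n`-variate polynomials of individual degree `d` that are computed
by a sum of `c` ROABPs of width `w`. -/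
def IsHittingSet (d w c : ℕ) (H : Set (Fin n → F)) : Prop :=
  ∀ A : MvPolynomial (Fin n) F, HasIndividualDegree d A → SumOfROABPs c w A → A ≠ 0 →
    ∃ a ∈ H, MvPolynomial.eval a A ≠ 0

/-- `ℓ`-support concentration: the coefficients of the monomials of support size `< ℓ` span
all coefficients. -/
def IsConcentrated (ℓ : ℕ) (P : MvPolynomial (Fin n) F) : Prop :=
  ∀ a : Fin n →₀ ℕ, P.coeff a ∈
    Submodule.span F {y : F | ∃ b : Fin n →₀ ℕ, b.support.card < ℓ ∧ y = P.coeff b}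

/-- The shifted polynomial `A(x + f(t))`, as a polynomial in `x` over the field `F(t)`. -/
noncomputable def shift (A : MvPolynomial (Fin n) F) (f : Fin n → F[X]) :
    MvPolynomial (Fin n) (RatFunc F) :=
  MvPolynomial.aeval
    (fun i => MvPolynomial.X i + MvPolynomial.C (algebraMap F[X] (RatFunc F) (f i))) A

/-- The union over `τ ∈ T` of the points `h + f(τ)`, where `h` ranges over the points of
`{0, β₁, …, β_d}ⁿ` with fewer than `ℓ` nonzero coordinates. -/
def shiftedLowSupport {d : ℕ} (ℓ : ℕ) (β : Fin d → F) (f : Fin n → F[X]) (T : Finset F) :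
    Set (Fin n → F) :=
  {a | ∃ τ ∈ T, ∃ h : Fin n → F, (∀ i, h i = 0 ∨ ∃ j, h i = β j) ∧
    {i | h i ≠ 0}.ncard < ℓ ∧ ∀ i, a i = h i + (f i).eval τ}

end Polynomials

/-- The width `(d+1) (2w)^(2^(c-1))`, for `c ≥ 1`. -/
def bigWidth (d w c : ℕ) : ℕ := (d + 1) * (2 * w) ^ 2 ^ (c - 1)

/-- The support bound `c ⌈log₂ (W² + 1)⌉`, where `W = (d+1) (2w)^(2^(c-1))`. -/
def supportBound (d w c : ℕ) : ℕ := c * Nat.clog 2 (bigWidth d w c ^ 2 + 1)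

/-- The product `n d w`, replaced by `2` if it is `1` (so that its logarithm is positive). -/
def paramSize (n d w : ℕ) : ℕ := max 2 (n * d * w)

/-! ### Algorithms: arithmetic random access machines over a field

The memory consists of two arrays of registers, `N[0], N[1], …` for natural numbers and
`R[0], R[1], …` for field elements, together with a write-only output tape of field elements.
On natural numbers there are only additive instructions (no multiplication in one step), with
indirect addressing; on field elements there are the field operations. Every instruction and every
test takes one step. Programs are finite texts that do not mention any field; besides `0` and `1`,
a program can access a supply `α 0, α 1, …` of elements of the field. -/

/-- Elementary instructions. -/
inductive Instr : Type
  /-- `N[i] := k` -/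
  | natConst (i k : ℕ)
  /-- `N[i] := N[j] + N[k]` -/
  | natAdd (i j k : ℕ)
  /-- `N[i] := max (N[j] - N[k]) 0` -/
  | natSub (i j k : ℕ)
  /-- `N[i] := N[N[j]]` -/
  | natLoad (i j : ℕ)
  /-- `N[N[i]] := N[j]` -/
  | natStore (i j : ℕ)
  /-- `R[i] := 0` -/
  | fldZero (i : ℕ)
  /-- `R[i] := 1` -/
  | fldOne (i : ℕ)
  /-- `R[i] := α (N[j])` -/
  | fldElem (i j : ℕ)
  /-- `R[i] := R[j] + R[k]` -/
  | fldAdd (i j k : ℕ)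
  /-- `R[i] := R[j] - R[k]` -/
  | fldSub (i j k : ℕ)
  /-- `R[i] := R[j] * R[k]` -/
  | fldMul (i j k : ℕ)
  /-- `R[i] := R[j]⁻¹` (and `0` if `R[j] = 0`) -/
  | fldInv (i j : ℕ)
  /-- `R[i] := R[N[j]]` -/
  | fldLoad (i j : ℕ)
  /-- `R[N[i]] := R[j]` -/
  | fldStore (i j : ℕ)
  /-- append `R[i]` to the output -/
  | emit (i : ℕ)

/-- Programs. -/
inductive Prog : Type
  | instr (a : Instr)
  | seq (p q : Prog)
  /-- if `N[i] = 0` then `p` else `q` -/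
  | ifNatZero (i : ℕ) (p q : Prog)
  /-- if `R[i] = 0` then `p` else `q` -/
  | ifFldZero (i : ℕ) (p q : Prog)
  /-- while `N[i] ≠ 0` do `p` -/
  | loop (i : ℕ) (p : Prog)

/-- Contents of the memory and of the output tape. -/
structure State (F : Type*) where
  nat : ℕ → ℕ
  fld : ℕ → F
  out : List F

section Machine

variable {F : Type*} [Field F]

/-- `N[i] := x` -/
def State.setNat (s : State F) (i x : ℕ) : State F := { s with nat := Function.update s.nat i x }

/-- `R[i] := x` -/
def State.setFld (s : State F) (i : ℕ) (x : F) : State F :=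
  { s with fld := Function.update s.fld i x }

/-- Effect of an instruction, relative to a supply `α` of field elements. -/
def Instr.exec (α : ℕ → F) (s : State F) : Instr → State F
  | .natConst i k => s.setNat i k
  | .natAdd i j k => s.setNat i (s.nat j + s.nat k)
  | .natSub i j k => s.setNat i (s.nat j - s.nat k)
  | .natLoad i j => s.setNat i (s.nat (s.nat j))
  | .natStore i j => s.setNat (s.nat i) (s.nat j)
  | .fldZero i => s.setFld i 0
  | .fldOne i => s.setFld i 1
  | .fldElem i j => s.setFld i (α (s.nat j))
  | .fldAdd i j k => s.setFld i (s.fld j + s.fld k)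
  | .fldSub i j k => s.setFld i (s.fld j - s.fld k)
  | .fldMul i j k => s.setFld i (s.fld j * s.fld k)
  | .fldInv i j => s.setFld i (s.fld j)⁻¹
  | .fldLoad i j => s.setFld i (s.fld (s.nat j))
  | .fldStore i j => s.setFld (s.nat i) (s.fld j)
  | .emit i => { s with out := s.out ++ [s.fld i] }

/-- `Runs α p s t s'`: started in `s`, the program `p` halts after exactly `t` steps, in `s'`. -/
inductive Runs (α : ℕ → F) : Prog → State F → ℕ → State F → Prop
  | instr (a : Instr) (s : State F) : Runs α (.instr a) s 1 (a.exec α s)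
  | seq {p q : Prog} {s s' s'' : State F} {t t' : ℕ} :
      Runs α p s t s' → Runs α q s' t' s'' → Runs α (.seq p q) s (t + t') s''
  | ifNatZero_true {i : ℕ} {p q : Prog} {s s' : State F} {t : ℕ} :
      s.nat i = 0 → Runs α p s t s' → Runs α (.ifNatZero i p q) s (t + 1) s'
  | ifNatZero_false {i : ℕ} {p q : Prog} {s s' : State F} {t : ℕ} :
      s.nat i ≠ 0 → Runs α q s t s' → Runs α (.ifNatZero i p q) s (t + 1) s'
  | ifFldZero_true {i : ℕ} {p q : Prog} {s s' : State F} {t : ℕ} :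
      s.fld i = 0 → Runs α p s t s' → Runs α (.ifFldZero i p q) s (t + 1) s'
  | ifFldZero_false {i : ℕ} {p q : Prog} {s s' : State F} {t : ℕ} :
      s.fld i ≠ 0 → Runs α q s t s' → Runs α (.ifFldZero i p q) s (t + 1) s'
  | loop_done {i : ℕ} {p : Prog} {s : State F} :
      s.nat i = 0 → Runs α (.loop i p) s 1 s
  | loop_step {i : ℕ} {p : Prog} {s s' s'' : State F} {t t' : ℕ} :
      s.nat i ≠ 0 → Runs α p s t s' → Runs α (.loop i p) s' t' s'' →
      Runs α (.loop i p) s (t + t' + 1) s''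

/-- The initial state: the input `n, d, w, c` is in `N[0], …, N[3]`; everything else is `0`. -/
def initState (F : Type*) [Field F] (n d w c : ℕ) : State F where
  nat := fun i => if i = 0 then n else if i = 1 then d else if i = 2 then w
    else if i = 3 then c else 0
  fld := fun _ => 0
  out := []

/-- Started with input `n, d, w, c`, the program halts after exactly `t` steps, and its output is the
list `H` of points of `Fⁿ`, written one after the other, coordinate by coordinate. -/
def Constructs (p : Prog) (α : ℕ → F) (n d w c t : ℕ) (H : List (Fin n → F)) : Prop :=
  ∃ s : State F, Runs α p (initState F n d w c) t s ∧ s.out = H.flatMap fun a => List.ofFn a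

end Machine

end SumROABP

namespace SumROABP

open Polynomial

/-! ### Separating monomials by weights modulo small integers -/

/-! The core is a statement about one product of matrices of dimension at most W whose i-th factor
is univariate in the i-th variable. Its coefficients live in a space of dimension at most W².
Weights on the variables are isolating if there are at most W² exponent vectors such that every
other coefficient is a combination of the coefficients of strictly lighter ones among these.
Isolating weights arise in ⌈log₂ n⌉ rounds that merge adjacent blocks of variables
(`exists_isolating_weight`): glued pairs from the two isolated sets span the merged block, a
Kronecker weight reduced modulo a small integer separates them (`exists_hash_separating`), and a
greedy choice by weight cuts them down to W² again (`exists_greedy_basis`).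

The correct moduli are not known, so `shiftPoly` vanishes at the place α_Q to the orders prescribed
by the Q-th choice of moduli, for all Q at once. At the correct place the i-th coordinate is (t -
α)^(wt i) times a unit. After division by the lowest power of t - α, what is left at α is a
polynomial with at most W² monomials, shifted by a point with nonzero coordinates
(`exists_small_support_of_span`). Such a shift has a monomial with at most log₂ W² variables
(`exists_small_support_of_sparse`). The argument works for every functional of the matrix product
with values in F[t]; this is `PreservesRank`, proved in `preservesRank_shiftPoly`.

Sums are treated by induction on the number of summands (`exists_shiftCoeff_ne_zero_of_sum`). Take
the variable order of the first summand. If the sum has small coefficient spaces along all prefixes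
of this order, it is itself one ROABP. Otherwise, at the first prefix where the dimension exceeds w,
some combination of slices kills the first summand but not the sum; it is a shorter sum of wider
ROABPs in the remaining variables. Induction yields a small monomial there, and `PreservesRank`
supplies one in the prefix variables, because up to this prefix the dimension is still at most
(d+1)w.

Over a field one nonzero coefficient of small support already gives concentration, and it gives a
hitting set by substituting enough values for t and a grid on few coordinates. The points are
enumerated by integer codes. The `Comp` and `Act` combinators build a program for this together with
its correctness and a running time polynomial in a fixed budget. -/

/-- A positive integer divisible by all of `1, …, 2k` is at least the central binomial coefficient. -/
lemma centralBinom_le_of_forall_dvd {k V : ℕ} (hk : 0 < k) (hV : V ≠ 0)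
    (h : ∀ m, 1 ≤ m → m ≤ 2 * k → m ∣ V) : k.centralBinom ≤ V := by
  refine Nat.le_of_dvd (Nat.pos_of_ne_zero hV) ?_
  rw [← Nat.factorization_prime_le_iff_dvd (Nat.centralBinom_ne_zero k) hV]
  intro p hp
  rw [← hp.pow_dvd_iff_le_factorization hV]
  refine h _ (Nat.pos_of_ne_zero (pow_ne_zero _ hp.ne_zero)) ?_
  exact Nat.pow_factorization_choose_le (by omega)

/-- Otherwise V would be at least the central binomial coefficient of a + 1, which is at least
4^(a+1) / (2(a+1)) and so exceeds 2^a, because a + 1 < 2^(a+1). -/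
lemma exists_not_dvd {V a : ℕ} (hV : V ≠ 0) (ha : V ≤ 2 ^ a) :
    ∃ p < 2 * (a + 1), ¬ (p + 1) ∣ V := by
  by_contra! hcon
  have h1 : (a + 1).centralBinom ≤ V :=
    centralBinom_le_of_forall_dvd (Nat.succ_pos a) hV fun m hm hm' => by
      have := hcon (m - 1) (by omega)
      rwa [Nat.sub_add_cancel hm] at this
  have h2 := Nat.four_pow_le_two_mul_self_mul_centralBinom (a + 1) (Nat.succ_pos a)
  have h3 : (4 : ℕ) ^ (a + 1) = 2 ^ (a + 1) * (2 * 2 ^ a) := by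
    rw [show (4 : ℕ) = 2 ^ 2 by norm_num, ← pow_mul]; ring
  have h4 : a + 1 < 2 ^ (a + 1) := Nat.lt_two_pow_self
  have h5 : 2 * (a + 1) * (a + 1).centralBinom ≤ 2 * (a + 1) * 2 ^ a :=
    Nat.mul_le_mul_left _ (h1.trans ha)
  have h6 : 0 < 2 ^ a := by positivity
  rw [h3] at h2
  have : 2 ^ (a + 1) * (2 * 2 ^ a) ≤ (a + 1) * (2 * 2 ^ a) := by linarith
  exact absurd (Nat.le_of_mul_le_mul_right this (by positivity)) (by omega)

/-- The weight of the variable `i` modulo `m + 1`. -/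
def hash (d m i : ℕ) : ℕ := (d + 1) ^ i % (m + 1)

/-- The weight of the monomial with exponents `a`. -/
def weight {n d : ℕ} (w : Fin n → ℕ) (a : Fin n → Fin (d + 1)) : ℕ := ∑ i, w i * a i

/-- The Kronecker values ∑ aᵢ (d+1)^i of distinct exponent vectors differ. The product of all
differences to be kept nonzero is at most 2^(dnP), so some modulus below the stated bound does not
divide it, hence divides none of its factors. Reducing each (d+1)^i preserves the Kronecker value
modulo p + 1, and this is all that is needed. -/
lemma exists_hash_separating {n d P N : ℕ}
    (S : Finset ((Fin n → Fin (d + 1)) × (Fin n → Fin (d + 1))))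
    (hS : S.card ≤ P) (hN : 2 * (d * n * P + 1) ≤ N) :
    ∃ p < N, ∀ x ∈ S, x.1 ≠ x.2 →
      weight (fun i => hash d p i) x.1 ≠ weight (fun i => hash d p i) x.2 := by
  classical
  let val : (Fin n → Fin (d + 1)) → ℕ := fun a => finFunctionFinEquiv a
  have hval : ∀ a, val a < (d + 1) ^ n := fun a => (finFunctionFinEquiv a).2
  have hinj : ∀ a b, val a = val b → a = b := fun a b hab =>
    finFunctionFinEquiv.injective (Fin.ext hab)
  let V : ℕ := ∏ x ∈ S.filter (fun x => x.1 ≠ x.2), ((val x.1 : ℤ) - val x.2).natAbs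
  have hV : V ≠ 0 := by
    refine Finset.prod_ne_zero_iff.2 fun x hx => ?_
    rw [Int.natAbs_ne_zero, sub_ne_zero]
    exact fun h => (Finset.mem_filter.1 hx).2 (hinj _ _ (by exact_mod_cast h))
  have hle : V ≤ 2 ^ (d * n * P) := by
    calc V ≤ ∏ x ∈ S.filter (fun x => x.1 ≠ x.2), (d + 1) ^ n :=
          Finset.prod_le_prod' fun x _ => by
            have := hval x.1; have := hval x.2; omega
      _ = ((d + 1) ^ n) ^ (S.filter (fun x => x.1 ≠ x.2)).card := by rw [Finset.prod_const]
      _ ≤ ((d + 1) ^ n) ^ P :=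
          Nat.pow_le_pow_right (by positivity) ((Finset.card_filter_le _ _).trans hS)
      _ ≤ ((2 ^ d) ^ n) ^ P := by
          gcongr
          exact Nat.lt_two_pow_self
      _ = 2 ^ (d * n * P) := by rw [← pow_mul, ← pow_mul, mul_assoc]
  obtain ⟨p, hp, hdvd⟩ := exists_not_dvd hV hle
  refine ⟨p, by omega, fun x hx hne heq => hdvd ?_⟩
  refine dvd_trans ?_ (Finset.dvd_prod_of_mem _ (Finset.mem_filter.2 ⟨hx, hne⟩))
  have key : ∀ a : Fin n → Fin (d + 1), weight (fun i => hash d p i) a ≡ val a [MOD p + 1] := by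
    intro a
    simp only [weight, val, finFunctionFinEquiv_apply_val]
    have : ∀ s : Finset (Fin n), ∑ i ∈ s, hash d p i * a i ≡ ∑ i ∈ s, (a i : ℕ) * (d + 1) ^ (i : ℕ)
        [MOD p + 1] := by
      intro s
      induction s using Finset.induction_on with
      | empty => simp; rfl
      | insert i s hi ih =>
        rw [Finset.sum_insert hi, Finset.sum_insert hi]
        refine Nat.ModEq.add ?_ ih
        rw [mul_comm]
        exact (Nat.mod_modEq _ _).mul_left _
    exact this _
  have h2 : val x.1 ≡ val x.2 [MOD p + 1] := (key _).symm.trans (heq ▸ key x.2)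
  have h3 := (Nat.modEq_iff_dvd.1 h2.symm)
  exact Int.natCast_dvd.1 h3

/-! ### Iterated lexicographic weights -/

/-- The weight functions obtained in `k` rounds from the hash functions given by the `k` digits of
`Q` in base `N`; the weights of a later round break the ties left by the earlier ones. -/
def iterWeight (d N B : ℕ) : ℕ → ℕ → ℕ → ℕ
  | 0, _, _ => 0
  | k + 1, Q, i => B * iterWeight d N B k (Q / N) i + hash d (Q % N) i

lemma iterWeight_lt {d N B : ℕ} (hN : 0 < N) (hNB : N ≤ B) (k Q i : ℕ) :
    iterWeight d N B k Q i < B ^ k := by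
  induction k generalizing Q with
  | zero => simp [iterWeight]
  | succ k ih =>
    have h1 : hash d (Q % N) i < B :=
      (Nat.mod_lt _ (Nat.succ_pos _)).trans_le ((Nat.mod_lt Q hN).trans_le hNB)
    have h2 := ih (Q / N)
    calc B * iterWeight d N B k (Q / N) i + hash d (Q % N) i
        < B * iterWeight d N B k (Q / N) i + B := by omega
      _ = B * (iterWeight d N B k (Q / N) i + 1) := by ring
      _ ≤ B * B ^ k := Nat.mul_le_mul_left _ h2
      _ = B ^ (k + 1) := by ring

/-! ### Weight-greedy spanning sets -/

section Greedy

variable {F V β : Type*} [Field F] [AddCommGroup V] [Module F V]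

/-- Keep exactly the elements that are not spanned by the lighter ones. In a linear dependency among
the kept elements, the heaviest one would be spanned by lighter ones, so they are independent.
Strong induction on the weight shows that they still span. -/
lemma exists_greedy_basis [FiniteDimensional F V] [DecidableEq β] (S : Finset β) (vec : β → V)
    (wt : β → ℕ) (hinj : ∀ x ∈ S, ∀ y ∈ S, wt x = wt y → x = y) :
    ∃ M ⊆ S, M.card ≤ Module.finrank F V ∧
      ∀ b ∈ S, vec b ∈ Submodule.span F (vec '' {b' | b' ∈ M ∧ (b' = b ∨ wt b' < wt b)}) := by
  classical
  let M := S.filter fun b => vec b ∉ Submodule.span F (vec '' {b' | b' ∈ S ∧ wt b' < wt b})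
  have hMS : M ⊆ S := Finset.filter_subset _ _
  refine ⟨M, hMS, ?_, ?_⟩
  · have hli : LinearIndependent F (fun b : M => vec b) := by
      rw [linearIndependent_iff']
      intro s g hg
      by_contra! hne
      obtain ⟨i0, hi0, hgi0⟩ := hne
      obtain ⟨i, hi, hmax⟩ := Finset.exists_max_image (s.filter fun i => g i ≠ 0)
        (fun i => wt i) ⟨i0, by simp [hi0, hgi0]⟩
      rw [Finset.mem_filter] at hi
      refine (Finset.mem_filter.1 i.2).2 ?_
      rw [← Finset.add_sum_erase _ _ hi.1] at hg
      have : vec i = (g i)⁻¹ • -∑ x ∈ s.erase i, g x • vec x := by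
        rw [← eq_neg_of_add_eq_zero_left hg, inv_smul_smul₀ hi.2]
      rw [this]
      refine Submodule.smul_mem _ _ (Submodule.neg_mem _ (Submodule.sum_mem _ fun x hx => ?_))
      by_cases hgx : g x = 0
      · simp [hgx]
      refine Submodule.smul_mem _ _ (Submodule.subset_span ⟨x, ⟨hMS x.2, ?_⟩, rfl⟩)
      refine lt_of_le_of_ne
        (hmax x (Finset.mem_filter.2 ⟨Finset.mem_of_mem_erase hx, hgx⟩)) fun heq => ?_
      exact Finset.ne_of_mem_erase hx (Subtype.ext (hinj _ (hMS x.2) _ (hMS i.2) heq))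
    simpa using hli.fintype_card_le_finrank
  · have main : ∀ N, ∀ b ∈ S, wt b < N →
        vec b ∈ Submodule.span F (vec '' {b' | b' ∈ M ∧ (b' = b ∨ wt b' < wt b)}) := by
      intro N
      induction N with
      | zero => intro b _ h; omega
      | succ N ih =>
        intro b hb hN
        by_cases hM : b ∈ M
        · exact Submodule.subset_span ⟨b, ⟨hM, Or.inl rfl⟩, rfl⟩
        · have h1 : vec b ∈ Submodule.span F (vec '' {b' | b' ∈ S ∧ wt b' < wt b}) := by
            by_contra h
            exact hM (Finset.mem_filter.2 ⟨hb, h⟩)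
          refine (Submodule.span_le.2 ?_) h1
          rintro _ ⟨b', ⟨hb', hlt⟩, rfl⟩
          refine Submodule.span_mono ?_ (ih b' hb' (by omega))
          rintro _ ⟨b'', ⟨h2, h3⟩, rfl⟩
          refine ⟨b'', ⟨h2, Or.inr ?_⟩, rfl⟩
          rcases h3 with rfl | h3
          · exact hlt
          · exact h3.trans hlt
    exact fun b hb => main _ b hb (Nat.lt_succ_self _)

end Greedy

/-! ### Basis isolation for products of matrices -/

section Isolation

variable {F ι : Type*} [Field F] [Fintype ι] [DecidableEq ι] {n d : ℕ}

/-- The coefficient of the monomial with exponents `a` in the product along `l` of matrices `D i`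
of univariate polynomials in the `i`-th variable. -/
def coeffProd (D : Fin n → Fin (d + 1) → Matrix ι ι F) (l : List (Fin n))
    (a : Fin n → Fin (d + 1)) : Matrix ι ι F :=
  (l.map fun i => D i (a i)).prod

lemma coeffProd_congr (D : Fin n → Fin (d + 1) → Matrix ι ι F) {l : List (Fin n)}
    {a b : Fin n → Fin (d + 1)} (h : ∀ i ∈ l, a i = b i) : coeffProd D l a = coeffProd D l b := by
  unfold coeffProd
  congr 1
  exact List.map_congr_left fun i hi => by rw [h i hi]

lemma coeffProd_append (D : Fin n → Fin (d + 1) → Matrix ι ι F) (l₁ l₂ : List (Fin n))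
    (a : Fin n → Fin (d + 1)) :
    coeffProd D (l₁ ++ l₂) a = coeffProd D l₁ a * coeffProd D l₂ a := by
  simp [coeffProd]

/-- The exponent vectors that vanish outside `l`. -/
def SupportedIn (l : List (Fin n)) (a : Fin n → Fin (d + 1)) : Prop := ∀ i, i ∉ l → a i = 0

/-- At most `r` exponent vectors isolate, with respect to the weights `wt`, a spanning set of the
coefficients of the matrix product along `l`. -/
def Isolates (r : ℕ) (D : Fin n → Fin (d + 1) → Matrix ι ι F) (wt : Fin n → ℕ)
    (l : List (Fin n)) : Prop :=
  ∃ M : Finset (Fin n → Fin (d + 1)), M.card ≤ r ∧ (∀ b ∈ M, SupportedIn l b) ∧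
    ∀ a, SupportedIn l a → coeffProd D l a ∈
      Submodule.span F (coeffProd D l '' {b | b ∈ M ∧ (b = a ∨ weight wt b < weight wt a)})

/-- The combination of `a` on `l` and `b` elsewhere. -/
def glue (l : List (Fin n)) (a b : Fin n → Fin (d + 1)) : Fin n → Fin (d + 1) :=
  fun i => if i ∈ l then a i else b i

lemma weight_glue (wt : Fin n → ℕ) {l₁ l₂ : List (Fin n)} (hd : l₁.Disjoint l₂)
    {a b : Fin n → Fin (d + 1)} (ha : SupportedIn l₁ a) (hb : SupportedIn l₂ b) :
    weight wt (glue l₁ a b) = weight wt a + weight wt b := by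
  unfold weight glue
  rw [← Finset.sum_add_distrib]
  refine Finset.sum_congr rfl fun i _ => ?_
  by_cases hi : i ∈ l₁
  · simp [hi, hb i fun h => hd hi h]
  · simp [hi, ha i hi]

lemma weight_hash_lt {N p : ℕ} (hp : p < N) (a : Fin n → Fin (d + 1)) :
    weight (fun i => hash d p i) a < n * d * N + 1 := by
  refine Nat.lt_succ_of_le ?_
  calc weight (fun i => hash d p i) a ≤ ∑ _i : Fin n, N * d := by
        refine Finset.sum_le_sum fun i _ => Nat.mul_le_mul ?_ (Nat.le_of_lt_succ (a i).2)
        exact ((Nat.mod_lt _ (Nat.succ_pos p)).trans_le hp).le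
    _ = n * d * N := by simp; ring

lemma weight_refine (B : ℕ) (w v : Fin n → ℕ) (a : Fin n → Fin (d + 1)) :
    weight (fun i => B * w i + v i) a = B * weight w a + weight v a := by
  simp only [weight, Finset.mul_sum, ← Finset.sum_add_distrib]
  exact Finset.sum_congr rfl fun i _ => by ring

/-- The `q`-th block of length `2 ^ j`. -/
def block (l : List (Fin n)) (j q : ℕ) : List (Fin n) := (l.drop (q * 2 ^ j)).take (2 ^ j)

lemma block_succ (l : List (Fin n)) (j q : ℕ) :
    block l (j + 1) q = block l j (2 * q) ++ block l j (2 * q + 1) := by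
  unfold block
  have h1 : q * 2 ^ (j + 1) = 2 * q * 2 ^ j := by ring
  have h2 : (2 * q + 1) * 2 ^ j = 2 * q * 2 ^ j + 2 ^ j := by ring
  have h3 : 2 ^ (j + 1) = 2 ^ j + 2 ^ j := by ring
  rw [h1, h2, h3, List.take_add, List.drop_drop]

/-- With at most one variable there are at most d + 1 exponent vectors, so all of them can be taken.
-/
lemma isolates_of_length_le_one {r : ℕ} (hr : d + 1 ≤ r)
    (D : Fin n → Fin (d + 1) → Matrix ι ι F) (wt : Fin n → ℕ) {l : List (Fin n)}
    (hl : l.length ≤ 1) : Isolates r D wt l := by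
  classical
  refine ⟨Finset.univ.filter fun a => SupportedIn l a, ?_, fun b hb => (Finset.mem_filter.1 hb).2,
    fun a ha => Submodule.subset_span ⟨a, ⟨by simp [ha], Or.inl rfl⟩, rfl⟩⟩
  have hcase : l = [] ∨ ∃ i, l = [i] := by
    match l, hl with
    | [], _ => exact Or.inl rfl
    | [i], _ => exact Or.inr ⟨i, rfl⟩
  rcases hcase with rfl | ⟨i, rfl⟩
  · refine (Finset.card_le_one.2 fun a ha b hb => ?_).trans (by omega)
    have ha := (Finset.mem_filter.1 ha).2
    have hb := (Finset.mem_filter.1 hb).2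
    funext j
    rw [ha j (by simp), hb j (by simp)]
  · refine le_trans ?_ hr
    have : (Finset.univ.filter fun a : Fin n → Fin (d + 1) => SupportedIn [i] a).card
        ≤ (Finset.univ : Finset (Fin (d + 1))).card := by
      refine Finset.card_le_card_of_injOn (fun a => a i) (fun _ _ => Finset.mem_univ _) ?_
      intro a ha b hb hab
      have ha := (Finset.mem_filter.1 ha).2
      have hb := (Finset.mem_filter.1 hb).2
      funext j
      by_cases hj : j = i
      · exact hj ▸ hab
      · rw [ha j (by simpa), hb j (by simpa)]
    simpa using this

/-- Weights add up under gluing, so the glued pairs span the merged coefficients by vectors lighter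
already for `wt`. The tie-breaker `v` makes the weights of these pairs distinct, which allows the
greedy selection to reduce them to the dimension of the matrix space. -/
lemma isolates_append {r : ℕ} (hr : Fintype.card ι * Fintype.card ι ≤ r)
    (D : Fin n → Fin (d + 1) → Matrix ι ι F) (wt v : Fin n → ℕ) {B : ℕ}
    (hB : ∀ a : Fin n → Fin (d + 1), weight v a < B) {l₁ l₂ : List (Fin n)} (hd : l₁.Disjoint l₂)
    {M₁ M₂ : Finset (Fin n → Fin (d + 1))}
    (hS₁ : ∀ b ∈ M₁, SupportedIn l₁ b) (hS₂ : ∀ b ∈ M₂, SupportedIn l₂ b)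
    (h₁ : ∀ a, SupportedIn l₁ a → coeffProd D l₁ a ∈ Submodule.span F
      (coeffProd D l₁ '' {b | b ∈ M₁ ∧ (b = a ∨ weight wt b < weight wt a)}))
    (h₂ : ∀ a, SupportedIn l₂ a → coeffProd D l₂ a ∈ Submodule.span F
      (coeffProd D l₂ '' {b | b ∈ M₂ ∧ (b = a ∨ weight wt b < weight wt a)}))
    (hsep : ∀ x ∈ Finset.image₂ (glue l₁) M₁ M₂, ∀ y ∈ Finset.image₂ (glue l₁) M₁ M₂, x ≠ y →
      weight v x ≠ weight v y) :
    Isolates r D (fun i => B * wt i + v i) (l₁ ++ l₂) := by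
  set S := Finset.image₂ (glue l₁) M₁ M₂ with hSdef
  have hSS : ∀ b ∈ S, SupportedIn (l₁ ++ l₂) b := by
    intro b hb i hi
    obtain ⟨b₁, hb₁, b₂, hb₂, rfl⟩ := Finset.mem_image₂.1 hb
    simp only [List.mem_append, not_or] at hi
    simp [glue, hi.1, hS₂ b₂ hb₂ i hi.2]
  -- Since `B` exceeds every value of the tie-breaker, the refined weight compares
  -- lexicographically.
  have hmono : ∀ a b : Fin n → Fin (d + 1), weight wt a < weight wt b →
      weight (fun i => B * wt i + v i) a < weight (fun i => B * wt i + v i) b := by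
    intro a b hab
    rw [weight_refine, weight_refine]
    have := hB a
    calc B * weight wt a + weight v a < B * weight wt a + B := by omega
      _ = B * (weight wt a + 1) := by ring
      _ ≤ B * weight wt b := Nat.mul_le_mul_left _ hab
      _ ≤ _ := Nat.le_add_right _ _
  obtain ⟨M, hMS, hcard, hspan⟩ := exists_greedy_basis (F := F) S (coeffProd D (l₁ ++ l₂))
    (weight fun i => B * wt i + v i) (fun x hx y hy hxy => by
      by_contra hne
      rw [weight_refine, weight_refine] at hxy
      rcases lt_trichotomy (weight wt x) (weight wt y) with h | h | h
      · have := hmono x y h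
        rw [weight_refine, weight_refine] at this; omega
      · rw [h] at hxy
        exact hsep x hx y hy hne (by omega)
      · have := hmono y x h
        rw [weight_refine, weight_refine] at this; omega)
  refine ⟨M, hcard.trans ?_, fun b hb => hSS b (hMS hb), fun a ha => ?_⟩
  · rw [Module.finrank_matrix, Module.finrank_self]; simpa using hr
  -- A coefficient of the concatenation is a product of two coefficients, and the product of two
  -- spans is the span of the products.
  have key : coeffProd D (l₁ ++ l₂) a ∈ Submodule.span F (coeffProd D (l₁ ++ l₂) ''
      {b | b ∈ S ∧ (b = a ∨ weight wt b < weight wt a)}) := by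
    set a₁ : Fin n → Fin (d + 1) := fun i => if i ∈ l₁ then a i else 0 with ha₁
    set a₂ : Fin n → Fin (d + 1) := fun i => if i ∈ l₂ then a i else 0 with ha₂
    have hs₁ : SupportedIn l₁ a₁ := fun i hi => by simp [ha₁, hi]
    have hs₂ : SupportedIn l₂ a₂ := fun i hi => by simp [ha₂, hi]
    have hga : glue l₁ a₁ a₂ = a := by
      funext i
      by_cases h1 : i ∈ l₁
      · simp [glue, h1, ha₁]
      by_cases h2 : i ∈ l₂
      · simp [glue, h1, h2, ha₂]
      · simp [glue, h1, h2, ha₂, ha i (by simp [h1, h2])]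
    rw [coeffProd_append, coeffProd_congr D (b := a₁) (l := l₁) (fun i hi => by simp [ha₁, hi]),
      coeffProd_congr D (b := a₂) (l := l₂) (fun i hi => by simp [ha₂, hi])]
    have hm := Submodule.mul_mem_mul (h₁ a₁ hs₁) (h₂ a₂ hs₂)
    rw [Submodule.span_mul_span] at hm
    refine Submodule.span_mono ?_ hm
    rintro _ ⟨_, ⟨b₁, ⟨hb₁, hc₁⟩, rfl⟩, _, ⟨b₂, ⟨hb₂, hc₂⟩, rfl⟩, rfl⟩
    refine ⟨glue l₁ b₁ b₂, ⟨Finset.mem_image₂_of_mem hb₁ hb₂, ?_⟩, ?_⟩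
    · rw [weight_glue wt hd (hS₁ _ hb₁) (hS₂ _ hb₂)]
      have hw := weight_glue wt hd hs₁ hs₂
      rw [hga] at hw
      rw [hw]
      rcases hc₁ with rfl | hc₁ <;> rcases hc₂ with rfl | hc₂
      · exact Or.inl hga
      all_goals right; omega
    · rw [coeffProd_append]
      congr 1
      · exact coeffProd_congr D fun i hi => by simp [glue, hi]
      · exact coeffProd_congr D fun i hi => by simp [glue, show i ∉ l₁ from fun h => hd h hi]
  refine Submodule.span_le.2 ?_ key
  rintro _ ⟨b, ⟨hb, hba⟩, rfl⟩
  refine Submodule.span_mono ?_ (hspan b hb)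
  rintro _ ⟨b', ⟨hb', hb'b⟩, rfl⟩
  refine ⟨b', ⟨hb', ?_⟩, rfl⟩
  rcases hba with rfl | hba
  · exact hb'b
  · right
    rcases hb'b with rfl | h
    · exact hmono _ _ hba
    · exact h.trans (hmono _ _ hba)

/-- In each round one modulus must serve all blocks simultaneously. At most n blocks matter, each
with at most W⁴ glued vectors, hence W⁸ pairs; this is the n W⁸ in the bound for `N`. -/
theorem exists_isolating_weight {W N B : ℕ} (hW : Fintype.card ι ≤ W) (hdW : d + 1 ≤ W ^ 2)
    (hN : 2 * (d * n * (n * W ^ 8) + 1) ≤ N) (hB : n * d * N + 1 ≤ B)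
    (D : Fin n → Fin (d + 1) → Matrix ι ι F) {l : List (Fin n)} (hl : l.Nodup) (k : ℕ) :
    ∃ Q < N ^ k, ∀ q, Isolates (W ^ 2) D (fun i => iterWeight d N B k Q i) (block l k q) := by
  classical
  induction k with
  | zero =>
    exact ⟨0, by simp, fun q => isolates_of_length_le_one hdW D _ (by simp [block])⟩
  | succ k ih =>
    obtain ⟨Q, hQ, hiso⟩ := ih
    choose M hMcard hMS hMspan using hiso
    let S : ℕ → Finset (Fin n → Fin (d + 1)) := fun q =>
      Finset.image₂ (glue (block l k (2 * q))) (M (2 * q)) (M (2 * q + 1))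
    have hScard : ∀ q, (S q).card ≤ W ^ 4 := fun q =>
      (Finset.card_image₂_le _ _ _).trans
        ((Nat.mul_le_mul (hMcard _) (hMcard _)).trans_eq (by ring))
    obtain ⟨p, hp, hsep⟩ := exists_hash_separating (N := N) (P := n * W ^ 8)
      ((Finset.range n).biUnion fun q => S q ×ˢ S q) (by
        refine (Finset.card_biUnion_le_card_mul _ _ (W ^ 8) fun q _ => ?_).trans (by simp)
        rw [Finset.card_product]
        exact (Nat.mul_le_mul (hScard q) (hScard q)).trans_eq (by ring)) hN
    refine ⟨Q * N + p, ?_, fun q => ?_⟩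
    · calc Q * N + p < Q * N + N := by omega
        _ = (Q + 1) * N := by ring
        _ ≤ N ^ k * N := Nat.mul_le_mul_right _ hQ
        _ = N ^ (k + 1) := by ring
    have hNpos : 0 < N := by omega
    -- The modulus of the newest round is the least significant digit of the new index.
    have hwt : (fun i : Fin n => iterWeight d N B (k + 1) (Q * N + p) i) =
        fun i : Fin n => B * iterWeight d N B k Q i + hash d p i := by
      funext i
      rw [iterWeight, Nat.mul_comm Q N, Nat.mul_add_mod, Nat.mod_eq_of_lt hp,
        Nat.mul_add_div hNpos, Nat.div_eq_of_lt hp, Nat.add_zero]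
    rw [hwt]
    by_cases hq : q < n
    · rw [block_succ]
      have hnd : (block l (k + 1) q).Nodup :=
        hl.sublist ((List.take_sublist _ _).trans (List.drop_sublist _ _))
      rw [block_succ] at hnd
      refine isolates_append (by rw [sq]; exact Nat.mul_le_mul hW hW) D _ _
        (fun a => (weight_hash_lt hp a).trans_le hB) (List.disjoint_of_nodup_append hnd)
        (hMS _) (hMS _) (hMspan _) (hMspan _) ?_
      intro x hx y hy hxy
      refine hsep (x, y) ?_ hxy
      simp only [Finset.mem_biUnion, Finset.mem_range, Finset.mem_product]
      exact ⟨q, hq, hx, hy⟩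
    -- From the n-th block on, `l` is exhausted and the block is empty.
    · refine isolates_of_length_le_one hdW D _ ?_
      have h1 : l.length ≤ n := by simpa using hl.length_le_card
      have h2 : l.length ≤ q * 2 ^ (k + 1) :=
        h1.trans ((not_lt.1 hq).trans (Nat.le_mul_of_pos_right _ (by positivity)))
      simp [block, List.drop_eq_nil_of_le h2]

end Isolation

end SumROABP

namespace SumROABP

open Polynomial

/-! ### Coefficients of shifted polynomials -/

section Shift

variable {R : Type*} [CommRing R] {n d : ℕ}

/-- The coefficient of `x ^ e` in `(x + r) ^ a`. -/
def kern (r : R) (a e : ℕ) : R := r ^ (a - e) * (a.choose e : R)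

/-- The coefficient of the monomial with exponents `e` in `P(x + f)`, where `c` lists the
coefficients of `P`. -/
def shiftCoeff (f : Fin n → R) (c : (Fin n → Fin (d + 1)) → R) (e : Fin n → Fin (d + 1)) : R :=
  ∑ a, c a * ∏ i, kern (f i) (a i) (e i)

/-- The support of an exponent vector. -/
def expSupport (e : Fin n → Fin (d + 1)) : Finset (Fin n) := Finset.univ.filter fun i => e i ≠ 0

lemma kern_of_lt (r : R) {a e : ℕ} (h : a < e) : kern r a e = 0 := by
  simp [kern, Nat.choose_eq_zero_of_lt h]

lemma kern_self (r : R) (a : ℕ) : kern r a a = 1 := by simp [kern]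

lemma kern_zero_left (r : R) {e : ℕ} (h : e ≠ 0) : kern r 0 e = 0 :=
  kern_of_lt r (Nat.pos_of_ne_zero h)

lemma kern_zero_right (r : R) (a : ℕ) : kern r a 0 = r ^ a := by simp [kern]

lemma map_kern {S : Type*} [CommRing S] (φ : R →+* S) (r : R) (a e : ℕ) :
    φ (kern r a e) = kern (φ r) a e := by simp [kern]

lemma map_shiftCoeff {S : Type*} [CommRing S] (φ : R →+* S) (f : Fin n → R)
    (c : (Fin n → Fin (d + 1)) → R) (e : Fin n → Fin (d + 1)) :
    φ (shiftCoeff f c e) = shiftCoeff (fun i => φ (f i)) (fun a => φ (c a)) e := by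
  simp [shiftCoeff, map_sum, map_prod, map_kern]

/-- Homogeneity: giving x the same weight as the shift π^w u turns the factor π^(we) on the output
side into π^(wa) on the input side. No division by π is needed. -/
lemma kern_mul_pow (π u : R) (w a e : ℕ) :
    π ^ (w * e) * kern (π ^ w * u) a e = π ^ (w * a) * kern u a e := by
  rcases lt_or_ge a e with h | h
  · simp [kern_of_lt _ h]
  · obtain ⟨k, rfl⟩ := Nat.exists_eq_add_of_le h
    simp only [kern, Nat.add_sub_cancel_left, mul_pow, mul_add, pow_add, ← pow_mul]
    ring

lemma prod_kern_mul_pow (π : R) (u : Fin n → R) (w : Fin n → ℕ) (a e : Fin n → Fin (d + 1)) :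
    π ^ weight w e * ∏ i, kern (π ^ w i * u i) (a i) (e i) =
      π ^ weight w a * ∏ i, kern (u i) (a i) (e i) := by
  simp only [weight, ← Finset.prod_pow_eq_pow_sum, ← Finset.prod_mul_distrib, kern_mul_pow]

/-- A nonzero univariate polynomial remains nonzero after a shift. -/
lemma exists_sum_kern_ne_zero (r : R) (g : Fin (d + 1) → R) (hg : g ≠ 0) :
    ∃ e : Fin (d + 1), ∑ j, g j * kern r j e ≠ 0 := by
  classical
  obtain ⟨j, hj⟩ := Function.ne_iff.1 hg
  obtain ⟨e, he, hmax⟩ := Finset.exists_max_image (Finset.univ.filter fun j => g j ≠ 0) id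
    ⟨j, by simpa using hj⟩
  refine ⟨e, ?_⟩
  rw [Finset.sum_eq_single e]
  · simpa [kern_self] using he
  · intro b _ hb
    by_cases hgb : g b = 0
    · simp [hgb]
    · have : b ≤ e := hmax b (by simpa using hgb)
      rw [kern_of_lt r (Fin.lt_def.1 (lt_of_le_of_ne this hb)), mul_zero]
  · simp

lemma shiftCoeff_cons (f : Fin (n + 1) → R) (c : (Fin (n + 1) → Fin (d + 1)) → R)
    (e₀ : Fin (d + 1)) (e : Fin n → Fin (d + 1)) :
    shiftCoeff f c (Fin.cons e₀ e) = ∑ j : Fin (d + 1),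
      shiftCoeff (fun i => f i.succ) (fun a => c (Fin.cons j a)) e * kern (f 0) j e₀ := by
  unfold shiftCoeff
  rw [← (Fin.consEquiv fun _ => Fin (d + 1)).sum_comp, Fintype.sum_prod_type]
  refine Finset.sum_congr rfl fun j _ => ?_
  rw [Finset.sum_mul]
  refine Finset.sum_congr rfl fun a _ => ?_
  have : (Fin.consEquiv fun _ => Fin (d + 1)) (j, a) = Fin.cons j a := rfl
  simp only [this, Fin.prod_univ_succ, Fin.cons_zero, Fin.cons_succ]
  ring

lemma card_expSupport_cons_le (e₀ : Fin (d + 1)) (e : Fin n → Fin (d + 1)) :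
    (expSupport (Fin.cons e₀ e : Fin (n + 1) → Fin (d + 1))).card ≤ (expSupport e).card + 1 ∧
    (e₀ = 0 → (expSupport (Fin.cons e₀ e : Fin (n + 1) → Fin (d + 1))).card
      = (expSupport e).card) := by
  simp only [expSupport, Finset.card_filter, Fin.sum_univ_succ, Fin.cons_zero, Fin.cons_succ]
  constructor
  · split_ifs <;> omega
  · rintro rfl
    simp

/-- The shift by a point with nonzero coordinates of a nonzero polynomial with `m` monomials has a
monomial with at most `log₂ m` variables. -/
lemma exists_small_support_of_sparse [IsDomain R] (r : Fin n → R) (hr : ∀ i, r i ≠ 0)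
    (c : (Fin n → Fin (d + 1)) → R) (hc : c ≠ 0) (S : Finset (Fin n → Fin (d + 1)))
    (hS : ∀ a, c a ≠ 0 → a ∈ S) :
    ∃ e, 2 ^ (expSupport e).card ≤ S.card ∧ shiftCoeff r c e ≠ 0 := by
  classical
  induction n with
  | zero =>
    obtain ⟨a, ha⟩ := Function.ne_iff.1 hc
    refine ⟨a, ?_, ?_⟩
    · have : 0 < S.card := Finset.card_pos.2 ⟨a, hS a ha⟩
      simpa [expSupport] using this
    · have : ∀ b : Fin 0 → Fin (d + 1), b = a := fun b => Subsingleton.elim _ _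
      simp only [shiftCoeff, Finset.univ_eq_empty, Finset.prod_empty, mul_one]
      rw [Fintype.sum_subsingleton _ a]
      simpa using ha
  | succ n ih =>
    let c' : Fin (d + 1) → (Fin n → Fin (d + 1)) → R := fun j a => c (Fin.cons j a)
    let S' : Fin (d + 1) → Finset (Fin n → Fin (d + 1)) := fun j =>
      Finset.univ.filter fun a => (Fin.cons j a : Fin (n + 1) → Fin (d + 1)) ∈ S
    have hS' : ∀ j a, c' j a ≠ 0 → a ∈ S' j := fun j a h => by simpa [S'] using hS _ h
    have hcard : ∑ j, (S' j).card ≤ S.card := by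
      rw [← Finset.card_sigma]
      refine Finset.card_le_card_of_injOn
        (fun x => (Fin.cons x.1 x.2 : Fin (n + 1) → Fin (d + 1))) (fun x hx => ?_) ?_
      · have := (Finset.mem_sigma.1 hx).2
        simpa [S'] using this
      · rintro ⟨j, a⟩ _ ⟨j', a'⟩ _ h
        obtain ⟨rfl, rfl⟩ := Fin.cons_inj.1 h
        rfl
    obtain ⟨a, ha⟩ := Function.ne_iff.1 hc
    have hca : c' (a 0) ≠ 0 := by
      refine Function.ne_iff.2 ⟨Fin.tail a, ?_⟩
      simpa [c', Fin.cons_self_tail] using ha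
    by_cases hone : ∃ j, j ≠ a 0 ∧ c' j ≠ 0
    · obtain ⟨j₁, hj₁, hcj₁⟩ := hone
      -- Two nonzero slices in the first variable have disjoint sets of monomials, so one of them
      -- has at most half. Passing to that slice pays for the one additional variable in the
      -- support.
      obtain ⟨j, hcj, hhalf⟩ : ∃ j, c' j ≠ 0 ∧ 2 * (S' j).card ≤ S.card := by
        have h2 : (S' j₁).card + (S' (a 0)).card ≤ S.card := by
          rw [← Finset.sum_pair hj₁ (f := fun j => (S' j).card)]
          exact (Finset.sum_le_sum_of_subset (Finset.subset_univ _)).trans hcard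
        rcases le_total (S' j₁).card (S' (a 0)).card with h | h
        · exact ⟨j₁, hcj₁, by omega⟩
        · exact ⟨a 0, hca, by omega⟩
      obtain ⟨e, he, hne⟩ := ih (fun i => r i.succ) (fun i => hr _) (c' j) hcj (S' j) (hS' j)
      obtain ⟨e₀, he₀⟩ := exists_sum_kern_ne_zero (r 0)
        (fun j => shiftCoeff (fun i => r i.succ) (c' j) e) (Function.ne_iff.2 ⟨j, hne⟩)
      refine ⟨Fin.cons e₀ e, ?_, ?_⟩
      · calc 2 ^ _ ≤ 2 ^ ((expSupport e).card + 1) :=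
              Nat.pow_le_pow_right (by norm_num) (card_expSupport_cons_le e₀ e).1
          _ ≤ S.card := by rw [pow_succ]; omega
      · rwa [shiftCoeff_cons]
    -- Only one slice is nonzero, so the first variable occurs in a single power. The constant term
    -- of its shift is a power of `r 0` and nonzero, so the support does not grow.
    · push Not at hone
      obtain ⟨e, he, hne⟩ := ih (fun i => r i.succ) (fun i => hr _) (c' (a 0)) hca (S' (a 0))
        (hS' _)
      refine ⟨Fin.cons 0 e, ?_, ?_⟩
      · rw [(card_expSupport_cons_le 0 e).2 rfl]
        exact he.trans ((Finset.single_le_sum (f := fun j => (S' j).card)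
          (fun _ _ => Nat.zero_le _) (Finset.mem_univ (a 0))).trans hcard)
      · rw [shiftCoeff_cons, Finset.sum_eq_single (a 0)]
        · refine mul_ne_zero hne ?_
          rw [Fin.val_zero, kern_zero_right]
          exact pow_ne_zero _ (hr 0)
        · intro j _ hj
          have : ∀ a, c (Fin.cons j a) = 0 := fun a => congrFun (hone j hj) a
          simp [this, shiftCoeff]
        · simp

end Shift

/-! ### Shifts that are adic to an isolating weight -/

section Adic

variable {F : Type*} [Field F] {n d : ℕ}

lemma exists_common_pow (α : F) {β : Type*} (M : Finset β) (ψ : β → F[X]) (h : ∃ b ∈ M, ψ b ≠ 0) :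
    ∃ (v : ℕ) (ψ' : β → F[X]), (∀ b ∈ M, ψ b = (X - C α) ^ v * ψ' b) ∧
      ∃ b ∈ M, (ψ' b).eval α ≠ 0 := by
  classical
  obtain ⟨b₀, hb₀, hmin⟩ := Finset.exists_min_image (M.filter fun b => ψ b ≠ 0)
    (fun b => rootMultiplicity α (ψ b)) (by
      obtain ⟨b, hb, hb'⟩ := h
      exact ⟨b, by simp [hb, hb']⟩)
  rw [Finset.mem_filter] at hb₀
  have hdvd : ∀ b ∈ M, (X - C α) ^ rootMultiplicity α (ψ b₀) ∣ ψ b := by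
    intro b hb
    by_cases hb0 : ψ b = 0
    · simp [hb0]
    · exact (pow_dvd_pow _ (hmin b (by simp [hb, hb0]))).trans (pow_rootMultiplicity_dvd _ _)
  have : ∀ b, ∃ q, b ∈ M → ψ b = (X - C α) ^ rootMultiplicity α (ψ b₀) * q := by
    intro b
    by_cases hb : b ∈ M
    · obtain ⟨q, hq⟩ := hdvd b hb
      exact ⟨q, fun _ => hq⟩
    · exact ⟨0, fun h => absurd h hb⟩
  choose ψ' hψ' using this
  refine ⟨_, ψ', hψ', b₀, hb₀.1, fun h0 => ?_⟩
  obtain ⟨q, hq, hnd⟩ := exists_eq_pow_rootMultiplicity_mul_and_not_dvd (ψ b₀) hb₀.2 α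
  have hpow : (X - C α) ^ rootMultiplicity α (ψ b₀) ≠ 0 := pow_ne_zero _ (X_sub_C_ne_zero α)
  have heq : ψ' b₀ = q := mul_left_cancel₀ hpow ((hψ' b₀ hb₀.1).symm.trans hq)
  exact hnd (dvd_iff_isRoot.2 (heq ▸ h0))

/-- Express every Φ a through the members b of M and multiply the shifted coefficient by (X -
α)^(weight of e). By homogeneity, Φ b then appears with the power of X - α given by its own weight,
times terms that vanish at α unless a = b. Dividing by the least order v over M and evaluating at α
leaves the shift of a polynomial supported on M by the nonzero point u(α). -/
lemma exists_small_support_of_span (α : F) (wt : Fin n → ℕ) (u : Fin n → F[X])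
    (hu : ∀ i, (u i).eval α ≠ 0) (Φ : (Fin n → Fin (d + 1)) → F[X]) (hΦ : Φ ≠ 0)
    (M : Finset (Fin n → Fin (d + 1)))
    (hM : ∀ a, Φ a ∈ Submodule.span F (Φ '' {b | b ∈ M ∧ (b = a ∨ weight wt b < weight wt a)})) :
    ∃ e, 2 ^ (expSupport e).card ≤ M.card ∧
      shiftCoeff (fun i => (X - C α) ^ wt i * u i) Φ e ≠ 0 := by
  classical
  -- For a in M the trivial representation is forced, so that the diagonal coefficients are 1.
  have hγ : ∀ a, ∃ γ : (Fin n → Fin (d + 1)) → F, Φ a = ∑ b ∈ M, C (γ b) * Φ b ∧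
      (∀ b ∈ M, γ b ≠ 0 → b = a ∨ weight wt b < weight wt a) ∧ (a ∈ M → γ a = 1) := by
    intro a
    by_cases ha : a ∈ M
    · refine ⟨Pi.single a 1, ?_, fun b _ hb => Or.inl ?_, fun _ => by simp⟩
      · rw [Finset.sum_eq_single a]
        · simp
        · intro b _ hb; simp [hb]
        · exact fun h => absurd ha h
      · by_contra h
        simp [h] at hb
    · obtain ⟨γ, hγ, hsum⟩ := (Finsupp.mem_span_image_iff_linearCombination F).1 (hM a)
      rw [Finsupp.mem_supported] at hγ
      refine ⟨γ, ?_, fun b _ hb => (hγ (by simpa using hb)).2, fun h => absurd h ha⟩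
      rw [← hsum, Finsupp.linearCombination_apply, Finsupp.sum]
      rw [Finset.sum_subset (fun b hb => (hγ hb).1 : γ.support ⊆ M)]
      · exact Finset.sum_congr rfl fun b _ => by rw [smul_eq_C_mul]
      · intro b _ hb
        simp [Finsupp.notMem_support_iff.1 hb]
  choose γ hsum hlt hone using hγ
  have hex : ∃ b ∈ M, (X - C α) ^ weight wt b * Φ b ≠ 0 := by
    by_contra! hall
    refine hΦ (funext fun a => ?_)
    rw [hsum a]
    refine Finset.sum_eq_zero fun b hb => ?_
    have := (mul_eq_zero.1 (hall b hb)).resolve_left (pow_ne_zero _ (X_sub_C_ne_zero α))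
    rw [this, mul_zero]
  -- The order is taken of the weighted Φ b, so that the leading parts of different members of M
  -- become comparable.
  obtain ⟨v, ψ, hψ, b₀, hb₀, hψb₀⟩ := exists_common_pow α M
    (fun b => (X - C α) ^ weight wt b * Φ b) hex
  obtain ⟨e, he, hne⟩ := exists_small_support_of_sparse (fun i => (u i).eval α) hu
    (fun b => if b ∈ M then (ψ b).eval α else 0)
    (Function.ne_iff.2 ⟨b₀, by simpa [hb₀] using hψb₀⟩) M (fun a ha => by
      by_contra h
      simp [h] at ha)
  refine ⟨e, he, fun h0 => hne ?_⟩
  let ρ : (Fin n → Fin (d + 1)) → F[X] := fun a => ∏ i, kern (u i) (a i) (e i)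
  let G : (Fin n → Fin (d + 1)) → F[X] := fun b =>
    ∑ a, C (γ a b) * (X - C α) ^ (weight wt a - weight wt b) * ρ a
  have h1 : (X - C α) ^ weight wt e * shiftCoeff (fun i => (X - C α) ^ wt i * u i) Φ e
      = (X - C α) ^ v * ∑ b ∈ M, ψ b * G b := by
    calc _ = ∑ a, Φ a * ((X - C α) ^ weight wt a * ρ a) := by
          rw [shiftCoeff, Finset.mul_sum]
          refine Finset.sum_congr rfl fun a _ => ?_
          rw [← prod_kern_mul_pow]
          ring
      _ = ∑ a, ∑ b ∈ M, (X - C α) ^ v * (ψ b *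
            (C (γ a b) * (X - C α) ^ (weight wt a - weight wt b) * ρ a)) := by
          refine Finset.sum_congr rfl fun a _ => ?_
          rw [hsum a, Finset.sum_mul]
          refine Finset.sum_congr rfl fun b hb => ?_
          by_cases hg : γ a b = 0
          · simp [hg]
          have hle : weight wt b ≤ weight wt a := by
            rcases hlt a b hb hg with rfl | h
            · exact le_rfl
            · exact h.le
          rw [← mul_assoc ((X - C α) ^ v), ← hψ b hb]
          nth_rewrite 1 [← Nat.add_sub_cancel' hle]
          rw [pow_add]
          ring
      _ = _ := by
          rw [Finset.sum_comm, Finset.mul_sum]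
          refine Finset.sum_congr rfl fun b _ => ?_
          simp only [G, Finset.mul_sum]
  rw [h0, mul_zero] at h1
  have h2 : ∑ b ∈ M, ψ b * G b = 0 :=
    (mul_eq_zero.1 h1.symm).resolve_left (pow_ne_zero _ (X_sub_C_ne_zero α))
  have h3 := congrArg (eval α) h2
  rw [eval_finsetSum, eval_zero] at h3
  rw [shiftCoeff]
  simp only [ite_mul, zero_mul]
  rw [Finset.sum_ite_mem, Finset.univ_inter, ← h3]
  refine Finset.sum_congr rfl fun b hb => ?_
  rw [eval_mul]
  congr 1
  simp only [G, ρ]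
  -- At α only a = b survives: any other a with a nonzero coefficient is strictly heavier than b and
  -- carries a positive power of X - α.
  rw [eval_finsetSum, Finset.sum_eq_single b]
  · simp [hone b hb, eval_prod, ← coe_evalRingHom, map_kern]
  · intro a _ hab
    by_cases hg : γ a b = 0
    · simp [hg]
    · have := (hlt a b hb hg).resolve_left (Ne.symm hab)
      simp [Nat.sub_ne_zero_of_lt this]
  · simp

end Adic

end SumROABP

namespace SumROABP

open Polynomial Matrix

/-! ### Coefficient tensors of ROABPs and sums of them -/

section Tensor

variable {F : Type*} [Field F] {n d : ℕ}

/-- The exponent vectors that vanish on `l`. -/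
def VanishesOn (l : List (Fin n)) (a : Fin n → Fin (d + 1)) : Prop := ∀ i ∈ l, a i = 0

/-- `T` lists the coefficients of a polynomial computed by an ROABP of width `w`. -/
def IsProgTensor (w : ℕ) (T : (Fin n → Fin (d + 1)) → F) : Prop :=
  ∃ (ι : Type) (_ : Fintype ι) (_ : DecidableEq ι) (l : List (Fin n))
    (D : Fin n → Fin (d + 1) → Matrix ι ι F) (u v : ι → F),
    Fintype.card ι ≤ w ∧ l.Nodup ∧ (∀ i, i ∈ l) ∧ ∀ a, T a = u ⬝ᵥ (coeffProd D l a *ᵥ v)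

open Classical in
/-- The shift by `f` keeps every nonzero `F[t]`-linear functional of a matrix product of dimension
at most `W` nonzero on a monomial with few variables. -/
def PreservesRank (d W : ℕ) (f : Fin n → F[X]) : Prop :=
  ∀ (ι : Type) [Fintype ι] [DecidableEq ι], Fintype.card ι ≤ W →
    ∀ (l : List (Fin n)), l.Nodup → ∀ (D : Fin n → Fin (d + 1) → Matrix ι ι F)
      (Λ : Matrix ι ι F →ₗ[F] F[X]), (∃ a, SupportedIn l a ∧ Λ (coeffProd D l a) ≠ 0) →
      ∃ e, SupportedIn l e ∧ 2 ^ (expSupport e).card ≤ W ^ 2 ∧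
        shiftCoeff f (fun a => if SupportedIn l a then Λ (coeffProd D l a) else 0) e ≠ 0

/-! ### Splitting the variables -/

lemma glue_of_mem {l : List (Fin n)} {a b : Fin n → Fin (d + 1)} {i : Fin n} (h : i ∈ l) :
    glue l a b i = a i := by simp [glue, h]

lemma glue_of_notMem {l : List (Fin n)} {a b : Fin n → Fin (d + 1)} {i : Fin n} (h : i ∉ l) :
    glue l a b i = b i := by simp [glue, h]

lemma supportedIn_glue_zero (l : List (Fin n)) (a : Fin n → Fin (d + 1)) :
    SupportedIn l (glue l a 0) := fun _ hi => glue_of_notMem hi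

lemma vanishesOn_glue_zero (l : List (Fin n)) (a : Fin n → Fin (d + 1)) :
    VanishesOn l (glue l 0 a) := fun _ hi => glue_of_mem hi

/-- A shift does not introduce new variables. -/
lemma coeff_vanish {R : Type*} [CommRing R] {f : Fin n → R} {c : (Fin n → Fin (d + 1)) → R}
    {e : Fin n → Fin (d + 1)} (he : shiftCoeff f c e ≠ 0) {i : Fin n}
    (hc : ∀ a, c a ≠ 0 → a i = 0) : e i = 0 := by
  by_contra hi
  refine he (Finset.sum_eq_zero fun a _ => ?_)
  by_cases hca : c a = 0
  · simp [hca]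
  · rw [Finset.prod_eq_zero (Finset.mem_univ i), mul_zero]
    rw [hc a hca]
    exact kern_zero_left _ fun h => hi (Fin.ext h)

-- The kernel of the shift is a product over the variables, so the shift can be carried out first in
-- the variables outside `l` and then in those of `l`.
open Classical in
lemma shiftCoeff_glue {R : Type*} [CommRing R] (f : Fin n → R) (c : (Fin n → Fin (d + 1)) → R)
    (l : List (Fin n)) {e₁ e₂ : Fin n → Fin (d + 1)} (h₁ : SupportedIn l e₁)
    (h₂ : VanishesOn l e₂) :
    shiftCoeff f c (glue l e₁ e₂) = shiftCoeff f (fun a => if SupportedIn l a then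
      shiftCoeff f (fun b => if VanishesOn l b then c (glue l a b) else 0) e₂ else 0) e₁ := by
  simp only [shiftCoeff, ite_mul, zero_mul]
  rw [← Finset.sum_filter]
  simp only [← Finset.sum_filter, Finset.sum_mul]
  rw [← Finset.sum_product']
  refine Finset.sum_nbij' (fun x => (glue l x 0, glue l 0 x)) (fun x => glue l x.1 x.2)
    ?_ (fun _ _ => Finset.mem_univ _) ?_ ?_ ?_
  · intro x _
    simp [supportedIn_glue_zero, vanishesOn_glue_zero]
  · intro x _
    funext i
    by_cases hi : i ∈ l <;> simp [glue, hi]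
  · rintro ⟨a, b⟩ hab
    simp only [Finset.mem_product, Finset.mem_filter, Finset.mem_univ, true_and] at hab
    refine Prod.ext (funext fun i => ?_) (funext fun i => ?_)
    · by_cases hi : i ∈ l
      · simp [glue, hi]
      · simp [glue, hi, hab.1 i hi]
    · by_cases hi : i ∈ l
      · simp [glue, hi, hab.2 i hi]
      · simp [glue, hi]
  · intro x _
    have hx : glue l (glue l x 0) (glue l 0 x) = x := by
      funext i
      by_cases hi : i ∈ l <;> simp [glue, hi]
    rw [hx, mul_assoc, ← Finset.prod_mul_distrib]
    congr 1
    refine Finset.prod_congr rfl fun i _ => ?_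
    by_cases hi : i ∈ l
    · simp [glue, hi, h₂ i hi, kern]
    · simp [glue, hi, h₁ i hi, kern]

lemma card_expSupport_glue_le (l : List (Fin n)) (a b : Fin n → Fin (d + 1)) :
    (expSupport (glue l a b)).card ≤ (expSupport a).card + (expSupport b).card := by
  classical
  refine (Finset.card_le_card ?_).trans (Finset.card_union_le _ _)
  intro i hi
  simp only [expSupport, Finset.mem_filter, Finset.mem_univ, true_and, Finset.mem_union] at hi ⊢
  by_cases hl : i ∈ l
  · exact Or.inl (by rwa [glue_of_mem hl] at hi)
  · exact Or.inr (by rwa [glue_of_notMem hl] at hi)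

/-! ### Slices -/

/-- Substituting exponents for the variables in `l`. -/
def slice (l : List (Fin n)) (y : Fin n → Fin (d + 1)) (T : (Fin n → Fin (d + 1)) → F) :
    (Fin n → Fin (d + 1)) → F := fun z => T (glue l y z)

lemma slice_nil {F : Type*} (y : Fin n → Fin (d + 1)) (T : (Fin n → Fin (d + 1)) → F) :
    slice [] y T = T :=
  funext fun z => congrArg T (funext fun i => by simp [glue])

/-- The span of the coefficients with respect to the variables in `l`. -/
def sliceSpan (l : List (Fin n)) (T : (Fin n → Fin (d + 1)) → F) :
    Submodule F ((Fin n → Fin (d + 1)) → F) :=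
  Submodule.span F (Set.range fun y => slice l y T)

/-- Slices, and hence their combinations, no longer depend on the variables in `l`. -/
lemma apply_glue_of_mem_sliceSpan {l : List (Fin n)} {T h : (Fin n → Fin (d + 1)) → F}
    (hh : h ∈ sliceSpan l T) (y z : Fin n → Fin (d + 1)) : h (glue l y z) = h z := by
  induction hh using Submodule.span_induction with
  | mem x hx =>
    obtain ⟨y', rfl⟩ := hx
    simp only [slice]
    congr 1
    funext i
    by_cases hi : i ∈ l <;> simp [glue, hi]
  | zero => rfl
  | add x y _ _ hx hy => simp [hx, hy]
  | smul a x _ hx => simp [hx]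

lemma finrank_sliceSpan_nil_le (T : (Fin n → Fin (d + 1)) → F) :
    Module.finrank F (sliceSpan [] T) ≤ 1 := by
  have hle : sliceSpan [] T ≤ Submodule.span F (Set.range fun _ : Unit => T) := by
    refine Submodule.span_mono ?_
    rintro _ ⟨y, rfl⟩
    exact ⟨(), (slice_nil y T).symm⟩
  exact (Submodule.finrank_mono hle).trans (finrank_range_le_card _)

lemma slice_append_singleton {l : List (Fin n)} {i : Fin n} (hi : i ∉ l)
    (y z : Fin n → Fin (d + 1)) (e : Fin (d + 1)) :
    glue (l ++ [i]) (Function.update y i e) z = glue l y (Function.update z i e) := by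
  funext j
  by_cases hj : j = i
  · subst hj; simp [glue, hi]
  · by_cases hl : j ∈ l <;> simp [glue, hl, hj]

lemma update_mem_sliceSpan {l : List (Fin n)} {i : Fin n} (hi : i ∉ l)
    {T h : (Fin n → Fin (d + 1)) → F} (hh : h ∈ sliceSpan l T) (e : Fin (d + 1)) :
    (fun z => h (Function.update z i e)) ∈ sliceSpan (l ++ [i]) T := by
  induction hh using Submodule.span_induction with
  | mem x hx =>
    obtain ⟨y, rfl⟩ := hx
    refine Submodule.subset_span ⟨Function.update y i e, ?_⟩
    funext z
    simp only [slice, slice_append_singleton hi]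
  | zero => exact Submodule.zero_mem _
  | add x y _ _ hx hy => exact Submodule.add_mem _ hx hy
  | smul a x _ hx => exact Submodule.smul_mem _ a hx

lemma exists_spanning_family {E : Type*} [AddCommGroup E] [Module F E] [FiniteDimensional F E]
    {m : ℕ} (V : Submodule F E) (hm : Module.finrank F V ≤ m) :
    ∃ h : Fin m → E, Submodule.span F (Set.range h) = V := by
  let b := Module.finBasis F V
  refine ⟨fun q => if hq : (q : ℕ) < Module.finrank F V then (b ⟨q, hq⟩ : E) else 0, ?_⟩
  refine le_antisymm (Submodule.span_le.2 ?_) ?_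
  · rintro _ ⟨q, rfl⟩
    dsimp only
    split_ifs
    · exact Subtype.mem _
    · exact V.zero_mem
  · have hV : V = Submodule.span F (Set.range fun q => (b q : E)) := by
      have := congrArg (Submodule.map V.subtype) b.span_eq
      rw [Submodule.map_span, Submodule.map_top, Submodule.range_subtype, ← Set.range_comp] at this
      exact this.symm
    conv_lhs => rw [hV]
    refine Submodule.span_mono ?_
    rintro _ ⟨q, rfl⟩
    refine ⟨⟨q, q.2.trans_le hm⟩, ?_⟩
    simp

/-- Fixing one more variable to each of its d + 1 exponents in a spanning family of the old space
gives a spanning family of the new one. -/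
lemma finrank_sliceSpan_append_le {l : List (Fin n)} {i : Fin n} (hi : i ∉ l)
    (T : (Fin n → Fin (d + 1)) → F) :
    Module.finrank F (sliceSpan (l ++ [i]) T) ≤ (d + 1) * Module.finrank F (sliceSpan l T) := by
  obtain ⟨h, hh⟩ := exists_spanning_family (sliceSpan l T) (le_refl _)
  let g : Fin (d + 1) × Fin (Module.finrank F (sliceSpan l T)) → (Fin n → Fin (d + 1)) → F :=
    fun x z => h x.2 (Function.update z i x.1)
  have hle : sliceSpan (l ++ [i]) T ≤ Submodule.span F (Set.range g) := by
    refine Submodule.span_le.2 ?_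
    rintro _ ⟨y, rfl⟩
    have h1 : slice l y T ∈ Submodule.span F (Set.range h) := by
      rw [hh]
      exact Submodule.subset_span ⟨y, rfl⟩
    obtain ⟨γ, hγ⟩ := (Submodule.mem_span_range_iff_exists_fun F).1 h1
    have h2 : slice (l ++ [i]) y T = ∑ q, γ q • g (y i, q) := by
      funext z
      have := slice_append_singleton hi y z (y i)
      rw [Function.update_eq_self] at this
      simp only [slice, this]
      have h3 := congrFun hγ (Function.update z i (y i))
      simp only [slice, Finset.sum_apply, Pi.smul_apply] at h3
      simp only [← h3, Finset.sum_apply, Pi.smul_apply, g]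
    rw [SetLike.mem_coe]
    dsimp only
    rw [h2]
    exact Submodule.sum_mem _ fun q _ =>
      Submodule.smul_mem _ _ (Submodule.subset_span ⟨(y i, q), rfl⟩)
  refine (Submodule.finrank_mono hle).trans ((finrank_range_le_card g).trans ?_)
  simp

/-- A function whose coefficient spaces along the prefixes of `l` have dimension at most `m` is
computed along each prefix by matrices of dimension `m`. -/
lemma exists_prefix_program {m : ℕ} (hm : 0 < m) {l : List (Fin n)} (hl : l.Nodup)
    (T : (Fin n → Fin (d + 1)) → F) (k : ℕ) (hk : k ≤ l.length)
    (hrank : ∀ j ≤ k, Module.finrank F (sliceSpan (l.take j) T) ≤ m) :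
    ∃ (D : Fin n → Fin (d + 1) → Matrix (Fin m) (Fin m) F) (u : Fin m → F)
      (h : Fin m → (Fin n → Fin (d + 1)) → F),
      (∀ q, h q ∈ sliceSpan (l.take k) T) ∧
      ∀ a, T a = ∑ q, (u ᵥ* coeffProd D (l.take k) a) q * h q a := by
  induction k with
  | zero =>
    refine ⟨fun _ _ => 1, Pi.single ⟨0, hm⟩ 1, fun _ => T, fun q => ?_, fun a => ?_⟩
    · exact Submodule.subset_span ⟨0, slice_nil 0 T⟩
    · rw [← Finset.sum_mul]
      simp [coeffProd]
  | succ k ih =>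
    obtain ⟨D, u, h, hmem, hT⟩ := ih (by omega) fun j hj => hrank j (by omega)
    obtain ⟨h', hh'⟩ := exists_spanning_family _ (hrank (k + 1) le_rfl)
    set i : Fin n := l[k] with hi
    have htake : l.take (k + 1) = l.take k ++ [i] := by
      rw [List.take_succ_eq_append_getElem]
    have hnd : (l.take k ++ [i]).Nodup := htake ▸ hl.sublist (List.take_sublist _ _)
    have hil : i ∉ l.take k := fun hmem =>
      List.disjoint_of_nodup_append hnd hmem (List.mem_singleton_self _)
    -- The entries of the next matrix express the old spanning functions, with the exponent of the
    -- next variable fixed, through the new spanning functions.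
    have hD : ∀ (e : Fin (d + 1)) (q : Fin m), ∃ c : Fin m → F,
        ∑ q', c q' • h' q' = fun z => h q (Function.update z i e) := by
      intro e q
      rw [← Submodule.mem_span_range_iff_exists_fun, hh', htake]
      exact update_mem_sliceSpan hil (hmem q) e
    choose c hc using hD
    refine ⟨Function.update D i fun e => Matrix.of (c e), u, h', fun q => ?_, fun a => ?_⟩
    · rw [← hh']
      exact Submodule.subset_span ⟨q, rfl⟩
    · have h1 : coeffProd (Function.update D i fun e => Matrix.of (c e)) (l.take (k + 1)) a
          = coeffProd D (l.take k) a * Matrix.of (c (a i)) := by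
        rw [htake, coeffProd_append]
        congr 1
        · unfold coeffProd
          congr 1
          refine List.map_congr_left fun j hj => ?_
          rw [Function.update_of_ne]
          rintro rfl
          exact hil hj
        · simp [coeffProd]
      rw [hT a, h1, ← Matrix.vecMul_vecMul]
      have h2 : ∀ q, h q a = ∑ q', c (a i) q q' * h' q' a := by
        intro q
        have := congrFun (hc (a i) q) a
        simp only [Finset.sum_apply, Pi.smul_apply, smul_eq_mul, Function.update_eq_self] at this
        exact this.symm
      simp only [h2, Matrix.vecMul, dotProduct, Matrix.of_apply, Finset.sum_mul, Finset.mul_sum]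
      rw [Finset.sum_comm]
      refine Finset.sum_congr rfl fun q _ => Finset.sum_congr rfl fun q' _ =>
        Finset.sum_congr rfl fun _ _ => by ring

/-- One half of Nisan's characterization: small coefficient spaces along all prefixes of an order
give an ROABP in that order. After the last prefix the remaining functions are constant, and their
values form the final vector. -/
lemma isProgTensor_of_finrank_le {w : ℕ} (hw : 0 < w) {l : List (Fin n)} (hl : l.Nodup)
    (hall : ∀ i, i ∈ l) (T : (Fin n → Fin (d + 1)) → F)
    (hrank : ∀ j ≤ l.length, Module.finrank F (sliceSpan (l.take j) T) ≤ w) :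
    IsProgTensor w T := by
  obtain ⟨D, u, h, hmem, hT⟩ := exists_prefix_program hw hl T l.length le_rfl hrank
  rw [List.take_length] at hmem hT
  refine ⟨Fin w, inferInstance, inferInstance, l, D, u, fun q => h q 0, by simp, hl, hall,
    fun a => ?_⟩
  rw [hT a, Matrix.dotProduct_mulVec]
  refine Finset.sum_congr rfl fun q _ => ?_
  congr 1
  have : glue l a 0 = a := funext fun i => glue_of_mem (hall i)
  change h q a = h q 0
  rw [← apply_glue_of_mem_sliceSpan (hmem q) a 0, this]

/-- The other half of Nisan's characterization: every slice is a combination of the functions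
computed from the vertices of the layer reached after `l₁`. -/
lemma finrank_sliceSpan_of_program {ι : Type*} [Fintype ι] [DecidableEq ι] (l₁ l₂ : List (Fin n))
    (hd : l₁.Disjoint l₂)
    (D : Fin n → Fin (d + 1) → Matrix ι ι F) (u v : ι → F) (T : (Fin n → Fin (d + 1)) → F)
    (hT : ∀ a, T a = u ⬝ᵥ (coeffProd D (l₁ ++ l₂) a *ᵥ v)) :
    Module.finrank F (sliceSpan l₁ T) ≤ Fintype.card ι := by
  let g : ι → (Fin n → Fin (d + 1)) → F := fun q z => (coeffProd D l₂ z *ᵥ v) q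
  have hle : sliceSpan l₁ T ≤ Submodule.span F (Set.range g) := by
    refine Submodule.span_le.2 ?_
    rintro _ ⟨y, rfl⟩
    have : slice l₁ y T = ∑ q, (u ᵥ* coeffProd D l₁ y) q • g q := by
      funext z
      have h1 : coeffProd D l₁ (glue l₁ y z) = coeffProd D l₁ y :=
        coeffProd_congr D fun i hi => glue_of_mem hi
      have h2 : coeffProd D l₂ (glue l₁ y z) = coeffProd D l₂ z :=
        coeffProd_congr D fun i hi => glue_of_notMem fun h => hd h hi
      rw [slice, hT, coeffProd_append, h1, h2, ← Matrix.mulVec_mulVec, Matrix.dotProduct_mulVec]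
      simp [dotProduct, g]
    rw [SetLike.mem_coe]
    dsimp only
    rw [this]
    exact Submodule.sum_mem _ fun q _ => Submodule.smul_mem _ _ (Submodule.subset_span ⟨q, rfl⟩)
  exact (Submodule.finrank_mono hle).trans (finrank_range_le_card g)

/-- Choose w + 1 independent slices of `T`. The corresponding slices of `T₀` lie in a space of
dimension at most w and are dependent; a dependency among them does not annihilate the independent
slices. -/
lemma exists_annihilating_combination {w : ℕ} (l : List (Fin n))
    (T T₀ : (Fin n → Fin (d + 1)) → F)
    (hT : w < Module.finrank F (sliceSpan l T)) (hT₀ : Module.finrank F (sliceSpan l T₀) ≤ w) :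
    ∃ (y : Fin (w + 1) → Fin n → Fin (d + 1)) (γ : Fin (w + 1) → F),
      ∑ r, γ r • slice l (y r) T ≠ 0 ∧ ∑ r, γ r • slice l (y r) T₀ = 0 := by
  classical
  obtain ⟨b, hb, hspan, hli⟩ := exists_linearIndependent F (Set.range fun y => slice l y T)
  have hbfin : b.Finite := hli.setFinite
  have : Fintype b := hbfin.fintype
  have hcard : w + 1 ≤ Fintype.card b := by
    have h1 := finrank_span_set_eq_card hli
    rw [hspan, Set.toFinset_card] at h1
    exact h1 ▸ hT
  obtain ⟨φ⟩ : Nonempty (Fin (w + 1) ↪ b) :=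
    Function.Embedding.nonempty_of_card_le (by simpa using hcard)
  have hy : ∀ r, ∃ y, slice l y T = φ r := fun r => hb (φ r).2
  choose y hy using hy
  have hdep : ¬ LinearIndependent F fun r => (⟨slice l (y r) T₀, Submodule.subset_span ⟨y r, rfl⟩⟩ :
      sliceSpan l T₀) := by
    intro h
    have := h.fintype_card_le_finrank
    simp only [Fintype.card_fin] at this
    omega
  obtain ⟨γ, hsum, r, hr⟩ := Fintype.not_linearIndependent_iff.1 hdep
  refine ⟨y, γ, fun h0 => hr ?_, ?_⟩
  · have hli' : LinearIndependent F fun r => (φ r : (Fin n → Fin (d + 1)) → F) :=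
      hli.comp φ φ.injective
    refine Fintype.linearIndependent_iff.1 hli' γ ?_ r
    simpa only [hy] using h0
  · have := congrArg Subtype.val hsum
    simpa using this

-- The m substitutions run in parallel as diagonal blocks. A substituted variable carries the
-- constant matrix chosen by `y r`, placed at exponent 0 and replaced by 0 at all other exponents;
-- this implements the cut to vectors vanishing on `l₁` without changing the order.
open Classical in
lemma IsProgTensor.combination {w m : ℕ} {T : (Fin n → Fin (d + 1)) → F} (hT : IsProgTensor w T)
    (l₁ : List (Fin n)) (y : Fin m → Fin n → Fin (d + 1)) (γ : Fin m → F) :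
    IsProgTensor (w * m)
      (fun a => if VanishesOn l₁ a then ∑ r, γ r * slice l₁ (y r) T a else 0) := by
  obtain ⟨ι, _, _, l, D, u, v, hw, hl, hall, hT⟩ := hT
  let E : Fin m → Fin n → Fin (d + 1) → Matrix ι ι F := fun r i e =>
    if i ∈ l₁ then (if e = 0 then D i (y r i) else 0) else D i e
  refine ⟨ι × Fin m, inferInstance, inferInstance, l, fun i e => blockDiagonal fun r => E r i e,
    fun x => γ x.2 * u x.1, fun x => v x.1, by simpa using Nat.mul_le_mul_right m hw, hl, hall,
    fun a => ?_⟩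
  have hprod : coeffProd (fun i e => blockDiagonal fun r => E r i e) l a =
      blockDiagonal fun r => coeffProd (E r) l a := by
    unfold coeffProd
    clear hl hall hT
    induction l with
    | nil =>
      rw [List.map_nil, List.prod_nil, ← Matrix.blockDiagonal_one]
      rfl
    | cons i l ih =>
      simp only [List.map_cons, List.prod_cons]
      rw [ih, ← Matrix.blockDiagonal_mul]
  have hentry : (fun x : ι × Fin m => γ x.2 * u x.1) ⬝ᵥ
      ((blockDiagonal fun r => coeffProd (E r) l a) *ᵥ fun x => v x.1) =
      ∑ r, γ r * (u ⬝ᵥ (coeffProd (E r) l a *ᵥ v)) := by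
    simp only [dotProduct, mulVec, Fintype.sum_prod_type, Matrix.blockDiagonal_apply, ite_mul,
      zero_mul, Finset.sum_ite_eq, Finset.mem_univ, if_true, Finset.mul_sum]
    rw [Finset.sum_comm]
    refine Finset.sum_congr rfl fun r _ => Finset.sum_congr rfl fun q _ =>
      Finset.sum_congr rfl fun _ _ => by ring
  rw [hprod, hentry]
  dsimp only
  split_ifs with ha
  · refine Finset.sum_congr rfl fun r _ => ?_
    rw [slice, hT]
    congr 3
    unfold coeffProd
    congr 1
    refine List.map_congr_left fun i _ => ?_
    by_cases hi : i ∈ l₁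
    · simp [E, hi, glue, ha i hi]
    · simp [E, hi, glue]
  · simp only [VanishesOn, not_forall] at ha
    obtain ⟨i, hi, hai⟩ := ha
    symm
    refine Finset.sum_eq_zero fun r _ => ?_
    have h0 : coeffProd (E r) l a = 0 := by
      unfold coeffProd
      refine List.prod_eq_zero (List.mem_map.2 ⟨i, hall i, ?_⟩)
      simp [E, hi, hai]
    simp [h0]

/-! ### Sums of ROABPs -/

/-- The case of one ROABP: the functional is the passage to the entry between the boundary vectors,
with constant values in F[t]. -/
lemma IsProgTensor.exists_shiftCoeff_ne_zero {w W : ℕ} (hwW : w ≤ W) {f : Fin n → F[X]}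
    (hf : PreservesRank d W f) {T : (Fin n → Fin (d + 1)) → F} (hT : IsProgTensor w T)
    (h0 : T ≠ 0) :
    ∃ e, 2 ^ (expSupport e).card ≤ W ^ 2 ∧ shiftCoeff f (fun a => C (T a)) e ≠ 0 := by
  classical
  obtain ⟨ι, _, _, l, D, u, v, hw, hl, hall, hT⟩ := hT
  let Λ : Matrix ι ι F →ₗ[F] F[X] :=
    { toFun := fun A => C (u ⬝ᵥ (A *ᵥ v))
      map_add' := fun A B => by rw [Matrix.add_mulVec, dotProduct_add, C_add]
      map_smul' := fun c A => by
        rw [Matrix.smul_mulVec, dotProduct_smul, smul_eq_mul, C_mul, RingHom.id_apply,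
          smul_eq_C_mul] }
  have hsupp : ∀ a : Fin n → Fin (d + 1), SupportedIn l a := fun a i hi => absurd (hall i) hi
  obtain ⟨a, ha⟩ := Function.ne_iff.1 h0
  obtain ⟨e, _, he, hne⟩ := hf ι (hw.trans hwW) l hl D Λ ⟨a, hsupp a, by
    change C (u ⬝ᵥ (coeffProd D l a *ᵥ v)) ≠ 0
    rw [← hT]
    simpa using ha⟩
  refine ⟨e, he, ?_⟩
  simp only [hsupp, if_true] at hne
  convert hne using 3 with a
  rw [hT]
  rfl

open Classical in
/-- Small-support monomials survive in shifts of sums of ROABPs. -/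
theorem exists_shiftCoeff_ne_zero_of_sum {W : ℕ} {f : Fin n → F[X]} (hf : PreservesRank d W f)
    (c w : ℕ) (hw : 1 ≤ w) (hW : (d + 1) * (2 * w) ^ 2 ^ c ≤ W)
    (T : Fin (c + 1) → (Fin n → Fin (d + 1)) → F) (hT : ∀ j, IsProgTensor w (T j))
    (h0 : ∑ j, T j ≠ 0) :
    ∃ e, (expSupport e).card ≤ (c + 1) * Nat.log 2 (W ^ 2) ∧
      shiftCoeff f (fun a => C ((∑ j, T j) a)) e ≠ 0 := by
  have hlog : ∀ {k : ℕ}, 2 ^ k ≤ W ^ 2 → k ≤ Nat.log 2 (W ^ 2) := fun h =>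
    Nat.le_log_of_pow_le (by norm_num) h
  have hdw : ∀ {c w : ℕ}, (d + 1) * (2 * w) ^ 2 ^ c ≤ W → (d + 1) * w ≤ W := by
    intro c w hW
    refine le_trans (Nat.mul_le_mul_left _ ?_) hW
    calc w ≤ 2 * w := by omega
      _ ≤ (2 * w) ^ 2 ^ c := Nat.le_self_pow (by positivity) _
  have hprog : ∀ {c w : ℕ}, (d + 1) * (2 * w) ^ 2 ^ c ≤ W → ∀ S : (Fin n → Fin (d + 1)) → F,
      IsProgTensor w S → S ≠ 0 → ∃ e, (expSupport e).card ≤ (c + 1) * Nat.log 2 (W ^ 2) ∧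
        shiftCoeff f (fun a => C (S a)) e ≠ 0 := by
    intro c w hW S hS h0
    obtain ⟨e, he, hne⟩ := hS.exists_shiftCoeff_ne_zero
      ((Nat.le_mul_of_pos_left _ (Nat.succ_pos d)).trans (hdw hW)) hf h0
    exact ⟨e, (hlog he).trans (Nat.le_mul_of_pos_left _ (Nat.succ_pos c)), hne⟩
  induction c generalizing w with
  | zero =>
    refine hprog hW _ ?_ h0
    rw [Fin.sum_univ_one]
    exact hT 0
  | succ c ih =>
    obtain ⟨ι, _, _, l, D₀, u₀, v₀, hι, hl, hall, hT₀⟩ := hT 0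
    set S := ∑ j, T j with hS
    by_cases hsmall : ∀ k ≤ l.length, Module.finrank F (sliceSpan (l.take k) S) ≤ w
    · exact hprog hW _ (isProgTensor_of_finrank_le hw hl hall S hsmall) h0
    push Not at hsmall
    -- Minimality of the prefix keeps the dimension just before it at most w, so at the prefix
    -- itself it is at most (d+1)w; this bounds the matrices used for the prefix.
    obtain ⟨k, hk, hkmin⟩ : ∃ k, (k ≤ l.length ∧ w < Module.finrank F (sliceSpan (l.take k) S)) ∧
        ∀ j < k, ¬ (j ≤ l.length ∧ w < Module.finrank F (sliceSpan (l.take j) S)) :=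
      ⟨Nat.find hsmall, Nat.find_spec hsmall, fun j hj => Nat.find_min hsmall hj⟩
    have hkmin' : ∀ j < k, Module.finrank F (sliceSpan (l.take j) S) ≤ w := fun j hj => by
      by_contra h
      exact hkmin j hj ⟨by omega, by omega⟩
    -- The prefix is nonempty: for the empty one the dimension is at most 1 ≤ w.
    obtain ⟨k, rfl⟩ : ∃ k', k = k' + 1 := by
      refine ⟨k - 1, ?_⟩
      by_contra h
      have h2 : k = 0 := by omega
      subst h2
      have h3 := hk.2
      have h4 := finrank_sliceSpan_nil_le S
      rw [List.take_zero] at h3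
      omega
    have hklt : k < l.length := hk.1
    have htake : l.take (k + 1) = l.take k ++ [l[k]] := by
      rw [List.take_succ_eq_append_getElem]
    set l₁ := l.take (k + 1) with hl₁
    have hl₁nd : l₁.Nodup := hl.sublist (List.take_sublist _ _)
    have hnotin : l[k] ∉ l.take k := fun hmem =>
      List.disjoint_of_nodup_append (htake ▸ hl₁nd) hmem (List.mem_singleton_self _)
    obtain ⟨D, u, h, hmem, hprogT⟩ := exists_prefix_program (m := (d + 1) * w) (by positivity) hl S
      (k + 1) hk.1 (by
        intro j hj
        rcases Nat.lt_or_ge j (k + 1) with h | h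
        · exact (hkmin' j h).trans (Nat.le_mul_of_pos_left _ (Nat.succ_pos d))
        · obtain rfl : j = k + 1 := by omega
          rw [← hl₁, htake]
          exact (finrank_sliceSpan_append_le hnotin S).trans
            (Nat.mul_le_mul_left _ (hkmin' k (by omega))))
    rw [← hl₁] at hmem hprogT
    have hsplit : l = l₁ ++ l.drop (k + 1) := (List.take_append_drop _ _).symm
    have hrank₀ : Module.finrank F (sliceSpan l₁ (T 0)) ≤ w := by
      refine (finrank_sliceSpan_of_program l₁ (l.drop (k + 1)) ?_ D₀ u₀ v₀ (T 0) ?_).trans hι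
      · exact List.disjoint_of_nodup_append (hsplit ▸ hl)
      · rw [← hsplit]; exact hT₀
    -- This removes the first summand, whose slices along a prefix of its own order span at most w
    -- dimensions.
    obtain ⟨y, γ, hne, hzero⟩ := exists_annihilating_combination l₁ S (T 0) hk.2 hrank₀
    let cut : ((Fin n → Fin (d + 1)) → F) → (Fin n → Fin (d + 1)) → F :=
      fun g a => if VanishesOn l₁ a then g a else 0
    let T' : Fin (c + 1) → (Fin n → Fin (d + 1)) → F := fun j a =>
      if VanishesOn l₁ a then ∑ r, γ r * slice l₁ (y r) (T j.succ) a else 0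
    have hsumT' : ∑ j, T' j = cut (∑ r, γ r • slice l₁ (y r) S) := by
      funext a
      simp only [Finset.sum_apply, T', cut, Pi.smul_apply, smul_eq_mul]
      split_ifs with ha
      · have h1 : ∀ r, slice l₁ (y r) S a =
            slice l₁ (y r) (T 0) a + ∑ j : Fin (c + 1), slice l₁ (y r) (T j.succ) a := by
          intro r
          simp only [slice, hS, Fin.sum_univ_succ (n := c + 1), Pi.add_apply, Finset.sum_apply]
        have h2 := congrFun hzero a
        simp only [Finset.sum_apply, Pi.smul_apply, smul_eq_mul, Pi.zero_apply] at h2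
        simp only [h1, mul_add, Finset.sum_add_distrib, h2, zero_add, Finset.mul_sum]
        rw [Finset.sum_comm]
      · simp
    have hT'ne : ∑ j, T' j ≠ 0 := by
      obtain ⟨z, hz⟩ := Function.ne_iff.1 hne
      refine Function.ne_iff.2 ⟨glue l₁ 0 z, ?_⟩
      rw [hsumT']
      have hmem' : (∑ r, γ r • slice l₁ (y r) S) ∈ sliceSpan l₁ S :=
        Submodule.sum_mem _ fun r _ => Submodule.smul_mem _ _ (Submodule.subset_span ⟨y r, rfl⟩)
      simp only [cut, vanishesOn_glue_zero, if_true, apply_glue_of_mem_sliceSpan hmem']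
      exact hz
    -- Each remaining summand gets width w(w+1). From 2w(w+1) ≤ (2w)² one sees that 2w is at most
    -- squared in each step of the induction, whence the double exponent in W.
    have hW' : (d + 1) * (2 * (w * (w + 1))) ^ 2 ^ c ≤ W := by
      refine le_trans (Nat.mul_le_mul_left _ ?_) hW
      calc (2 * (w * (w + 1))) ^ 2 ^ c ≤ ((2 * w) ^ 2) ^ 2 ^ c := by
            refine Nat.pow_le_pow_left ?_ _
            nlinarith
        _ = (2 * w) ^ 2 ^ (c + 1) := by rw [← pow_mul]; congr 1; ring
    obtain ⟨e₂, he₂, hne₂⟩ := ih (w * (w + 1)) (by nlinarith) hW' T'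
      (fun j => (hT j.succ).combination l₁ y γ) hT'ne
    rw [hsumT'] at hne₂
    have hvan : VanishesOn l₁ e₂ := fun i hi => coeff_vanish hne₂ fun a ha => by
      by_contra hai
      refine ha ?_
      have : ¬ VanishesOn l₁ a := fun h => hai (h i hi)
      simp [cut, this]
    -- `ρ` reads off the e₂-coefficient after the shift in the variables outside the prefix. By
    -- induction it is nonzero on the combination of slices, hence on some single slice of `S`.
    let ρ : ((Fin n → Fin (d + 1)) → F) →ₗ[F] F[X] :=
      { toFun := fun g => shiftCoeff f (fun a => C (cut g a)) e₂
        map_add' := fun g g' => by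
          simp only [shiftCoeff, ← Finset.sum_add_distrib]
          refine Finset.sum_congr rfl fun a _ => ?_
          rw [← add_mul, ← C_add]
          congr 2
          simp only [cut]
          split_ifs <;> simp
        map_smul' := fun x g => by
          simp only [shiftCoeff, RingHom.id_apply, Finset.smul_sum]
          refine Finset.sum_congr rfl fun a _ => ?_
          rw [smul_eq_C_mul, ← mul_assoc, ← C_mul]
          congr 2
          simp only [cut]
          split_ifs <;> simp }
    -- Slices of `S` depend linearly on the coefficients of the prefix product, so `ρ` of a slice
    -- becomes an F[t]-valued functional of that product. `PreservesRank` must allow values in F[t],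
    -- and not only in F, for this step.
    let Λ : Matrix (Fin ((d + 1) * w)) (Fin ((d + 1) * w)) F →ₗ[F] F[X] :=
      { toFun := fun A => ∑ q, (u ᵥ* A) q • ρ (h q)
        map_add' := fun A B => by
          simp only [Matrix.vecMul_add, Pi.add_apply, add_smul, Finset.sum_add_distrib]
        map_smul' := fun x A => by
          simp only [Matrix.vecMul_smul, Pi.smul_apply, RingHom.id_apply, Finset.smul_sum,
            smul_assoc] }
    have hΛ : ∀ a, ρ (slice l₁ a S) = Λ (coeffProd D l₁ a) := by
      intro a
      have h1 : slice l₁ a S = ∑ q, (u ᵥ* coeffProd D l₁ a) q • h q := by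
        funext z
        rw [slice, hprogT, Finset.sum_apply]
        refine Finset.sum_congr rfl fun q _ => ?_
        rw [apply_glue_of_mem_sliceSpan (hmem q), coeffProd_congr D (b := a)
          (fun i hi => glue_of_mem hi)]
        rfl
      rw [h1, map_sum]
      exact Finset.sum_congr rfl fun q _ => by rw [map_smul]
    have hexa : ∃ a, SupportedIn l₁ a ∧ Λ (coeffProd D l₁ a) ≠ 0 := by
      by_contra! hall0
      refine hne₂ ?_
      change ρ (∑ r, γ r • slice l₁ (y r) S) = 0
      rw [map_sum]
      refine Finset.sum_eq_zero fun r _ => ?_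
      rw [map_smul, hΛ, coeffProd_congr D (b := glue l₁ (y r) 0) fun i hi => (glue_of_mem hi).symm,
        hall0 _ (supportedIn_glue_zero _ _), smul_zero]
    obtain ⟨e₁, hsupp, he₁, hne₁⟩ := hf _ (by simpa using hdw hW) l₁ hl₁nd D Λ hexa
    refine ⟨glue l₁ e₁ e₂, ?_, ?_⟩
    · calc _ ≤ (expSupport e₁).card + (expSupport e₂).card := card_expSupport_glue_le _ _ _
        _ ≤ Nat.log 2 (W ^ 2) + (c + 1) * Nat.log 2 (W ^ 2) := Nat.add_le_add (hlog he₁) he₂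
        _ = (c + 1 + 1) * Nat.log 2 (W ^ 2) := by ring
    -- The two partial shifts compose to the full shift, so the glued exponent vector works for `S`.
    · rw [shiftCoeff_glue _ _ _ hsupp hvan]
      convert hne₁ using 4 with a
      rw [← hΛ]
      change _ = shiftCoeff f (fun b => C (cut (slice l₁ a S) b)) e₂
      congr 1
      funext b
      simp only [cut, slice]
      split_ifs <;> simp

end Tensor

end SumROABP

namespace SumROABP

open Polynomial Matrix

/-! ### The shift -/

section ShiftPoly

variable {F : Type*} [Field F]

/-- The `i`-th coordinate of the shift: it vanishes at `α Q` to the order given by the `Q`-th iterated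
weight function, for all `Q < N ^ k`. -/
noncomputable def shiftPoly (α : ℕ → F) (d N B k i : ℕ) : F[X] :=
  ∏ Q ∈ Finset.range (N ^ k), (X - C (α Q)) ^ iterWeight d N B k Q i

lemma natDegree_shiftPoly_le (α : ℕ → F) {d N B : ℕ} (hN : 0 < N) (hNB : N ≤ B) (k i : ℕ) :
    (shiftPoly α d N B k i).natDegree ≤ N ^ k * B ^ k := by
  refine (natDegree_prod_le _ _).trans ?_
  calc _ ≤ ∑ _Q ∈ Finset.range (N ^ k), B ^ k := by
        refine Finset.sum_le_sum fun Q _ => natDegree_pow_le.trans ?_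
        rw [natDegree_X_sub_C, mul_one]
        exact (iterWeight_lt hN hNB k Q i).le
    _ = N ^ k * B ^ k := by simp

lemma eval_shiftPoly (α : ℕ → F) (d N B k i : ℕ) (τ : F) :
    (shiftPoly α d N B k i).eval τ =
      ∏ Q ∈ Finset.range (N ^ k), (τ - α Q) ^ iterWeight d N B k Q i := by
  simp [shiftPoly, eval_prod]

/-- For the given product some Q < N^k gives isolating weights. At α_Q the factors of the other
places are nonzero, since the α's are distinct, and can be absorbed into the unit part of the shift.
The functional carries the spanning property over to F[X]. -/
theorem preservesRank_shiftPoly {n d W N B k : ℕ} (hdW : d + 1 ≤ W ^ 2)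
    (hN : 2 * (d * n * (n * W ^ 8) + 1) ≤ N) (hB : n * d * N + 1 ≤ B) (hk : n ≤ 2 ^ k)
    {α : ℕ → F} (hα : Set.InjOn α (Set.Iio (N ^ k))) :
    PreservesRank d W (fun i : Fin n => shiftPoly α d N B k i) := by
  classical
  intro ι _ _ hι l hl D Λ ⟨a₀, ha₀, hΛa₀⟩
  obtain ⟨Q, hQ, hiso⟩ := exists_isolating_weight hι hdW hN hB D hl k
  -- As n ≤ 2^k, after k rounds a single block contains all of `l`.
  have hblock : block l k 0 = l := by
    have : l.length ≤ n := by simpa using hl.length_le_card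
    simp [block, List.take_of_length_le (this.trans hk)]
  obtain ⟨M, hM, hMS, hspan⟩ := hblock ▸ hiso 0
  set Φ : (Fin n → Fin (d + 1)) → F[X] := fun a =>
    if SupportedIn l a then Λ (coeffProd D l a) else 0 with hΦ
  obtain ⟨e, he, hne⟩ := exists_small_support_of_span (α Q)
    (fun i : Fin n => iterWeight d N B k Q i)
    (fun i => ∏ Q' ∈ (Finset.range (N ^ k)).erase Q, (X - C (α Q')) ^ iterWeight d N B k Q' i)
    (fun i => by
      rw [eval_prod, Finset.prod_ne_zero_iff]
      intro Q' hQ'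
      rw [Finset.mem_erase, Finset.mem_range] at hQ'
      rw [eval_pow, eval_sub, eval_X, eval_C]
      exact pow_ne_zero _ (sub_ne_zero.2 fun h => hQ'.1 (hα hQ'.2 hQ h.symm)))
    Φ (Function.ne_iff.2 ⟨a₀, by simpa [hΦ, ha₀] using hΛa₀⟩) M (fun a => by
      by_cases ha : SupportedIn l a
      · have h1 := Submodule.apply_mem_span_image_of_mem_span Λ (hspan a ha)
        simp only [hΦ, ha, if_true]
        refine Submodule.span_mono ?_ h1
        rintro _ ⟨_, ⟨b, hb, rfl⟩, rfl⟩
        exact ⟨b, hb, by simp [hMS b hb.1]⟩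
      · simp [hΦ, ha])
  have hfac : ∀ i : Fin n, (X - C (α Q)) ^ iterWeight d N B k Q i *
      ∏ Q' ∈ (Finset.range (N ^ k)).erase Q, (X - C (α Q')) ^ iterWeight d N B k Q' i =
      shiftPoly α d N B k i := fun i =>
    Finset.mul_prod_erase _ (fun Q' => (X - C (α Q')) ^ iterWeight d N B k Q' i)
      (Finset.mem_range.2 hQ)
  simp only [hfac] at hne
  refine ⟨e, fun i hi => ?_, he.trans hM, hne⟩
  exact coeff_vanish hne fun a ha => by
    by_contra hai
    refine ha ?_
    have : ¬ SupportedIn l a := fun h => hai (h i hi)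
    simp [hΦ, this]

end ShiftPoly

/-! ### Coefficients of polynomials computed by ROABPs -/

section Bridge

variable {F : Type*} [Field F] {n : ℕ}

/-- Because `q` is free of the variable `i`, the exponent of that variable must come entirely from
`p`. This is the form in which read-once enters. -/
lemma coeff_aeval_X_mul {R σ : Type*} [CommRing R] (i : σ) (p : R[X]) (q : MvPolynomial σ R)
    (hq : ∀ m, m i ≠ 0 → q.coeff m = 0) (m : σ →₀ ℕ) :
    (aeval (MvPolynomial.X i : MvPolynomial σ R) p * q).coeff m =
      p.coeff (m i) * q.coeff (m.erase i) := by
  classical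
  induction p using Polynomial.induction_on' with
  | add p p' hp hp' => simp [add_mul, hp, hp']
  | monomial e c =>
    have h1 : aeval (MvPolynomial.X i : MvPolynomial σ R) (monomial e c) =
        MvPolynomial.monomial (Finsupp.single i e) c := by
      rw [aeval_monomial, ← MvPolynomial.C_mul_X_pow_eq_monomial]
      rfl
    rw [h1, MvPolynomial.coeff_monomial_mul', coeff_monomial]
    split_ifs with hle he he
    · congr 2
      ext j
      by_cases hj : j = i
      · subst hj; simp [he]
      · simp [Finsupp.single_eq_of_ne hj, hj]
    · rw [zero_mul, hq, mul_zero]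
      have := hle i
      simp only [Finsupp.single_eq_same, Finsupp.tsub_apply] at this ⊢
      omega
    · exact absurd (Finsupp.single_le_iff.2 he.le) hle
    · simp

open Classical in
lemma coeff_list_prod_aeval {ι : Type*} [Fintype ι] [DecidableEq ι] (E : Fin n → Matrix ι ι F[X])
    {l : List (Fin n)} (hl : l.Nodup) (m : Fin n →₀ ℕ) (u v : ι) :
    ((l.map fun i => (E i).map fun p =>
      aeval (MvPolynomial.X i : MvPolynomial (Fin n) F) p).prod u v).coeff m =
      if ∀ i ∉ l, m i = 0 then (l.map fun i => (E i).map fun p => p.coeff (m i)).prod u v else 0 := by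
  induction l generalizing m u with
  | nil =>
    have h1 : (∀ i, i ∉ ([] : List (Fin n)) → m i = 0) ↔ m = 0 := by
      simp [Finsupp.ext_iff]
    simp only [List.map_nil, List.prod_nil, h1, Matrix.one_apply]
    by_cases huv : u = v
    · simp [huv, MvPolynomial.coeff_one, eq_comm]
    · simp [huv]
  | cons i l ih =>
    rw [List.nodup_cons] at hl
    simp only [List.map_cons, List.prod_cons, Matrix.mul_apply, MvPolynomial.coeff_sum]
    have hvan : ∀ q m, m i ≠ 0 → ((l.map fun i => (E i).map fun p =>
        aeval (MvPolynomial.X i : MvPolynomial (Fin n) F) p).prod q v).coeff m = 0 := by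
      intro q m hm
      rw [ih hl.2, if_neg fun h => hm (h i hl.1)]
    have hcond : (∀ j, j ∉ l → m.erase i j = 0) ↔ (∀ j, j ∉ i :: l → m j = 0) := by
      refine forall_congr' fun j => ?_
      by_cases hj : j = i
      · subst hj; simp
      · simp [hj]
    have hmap : (l.map fun j => (E j).map fun p => p.coeff (m.erase i j)) =
        l.map fun j => (E j).map fun p => p.coeff (m j) := by
      refine List.map_congr_left fun j hj => ?_
      rw [Finsupp.erase_ne]
      rintro rfl
      exact hl.1 hj
    simp only [Matrix.map_apply]
    simp only [coeff_aeval_X_mul i _ _ (hvan _), ih hl.2, hcond, hmap]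
    split_ifs
    · rfl
    · simp

/-- An exponent vector with bounded entries, as a finitely supported function. -/
noncomputable def expFinsupp {d : ℕ} (a : Fin n → Fin (d + 1)) : Fin n →₀ ℕ :=
  Finsupp.equivFunOnFinite.symm fun i => (a i : ℕ)

@[simp] lemma expFinsupp_apply {d : ℕ} (a : Fin n → Fin (d + 1)) (i : Fin n) :
    expFinsupp a i = a i := rfl

lemma card_support_expFinsupp {d : ℕ} (a : Fin n → Fin (d + 1)) :
    (expFinsupp a).support.card = (expSupport a).card := by
  congr 1
  ext i
  simp [expSupport, ← Fin.val_eq_zero_iff]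

lemma ComputedByROABP.isProgTensor {w d : ℕ} {A : MvPolynomial (Fin n) F}
    (h : ComputedByROABP w A) :
    IsProgTensor w (fun a : Fin n → Fin (d + 1) => A.coeff (expFinsupp a)) := by
  classical
  obtain ⟨π, D, u, v, rfl⟩ := h
  have hall : ∀ i, i ∈ List.ofFn π := fun i => List.mem_ofFn.2 ⟨π.symm i, by simp⟩
  refine ⟨Fin w, inferInstance, inferInstance, List.ofFn π,
    fun i e => (D (π.symm i)).map fun p => p.coeff e, Pi.single u 1, Pi.single v 1, by simp,
    List.nodup_ofFn.2 π.injective, hall, fun a => ?_⟩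
  have h1 : (List.ofFn fun i : Fin n =>
      (D i).map fun p => aeval (MvPolynomial.X (π i) : MvPolynomial (Fin n) F) p) =
      (List.ofFn π).map fun j => (D (π.symm j)).map fun p =>
        aeval (MvPolynomial.X j : MvPolynomial (Fin n) F) p := by
    rw [List.map_ofFn]
    congr 1
    funext i
    simp
  dsimp only
  rw [h1, coeff_list_prod_aeval (fun j => D (π.symm j)) (List.nodup_ofFn.2 π.injective),
    if_pos fun i hi => absurd (hall i) hi]
  simp [coeffProd]

lemma eq_sum_of_individualDegree {d : ℕ} {A : MvPolynomial (Fin n) F}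
    (hA : HasIndividualDegree d A) :
    A = ∑ a : Fin n → Fin (d + 1), MvPolynomial.monomial (expFinsupp a) (A.coeff (expFinsupp a)) := by
  classical
  have hinj : Function.Injective (expFinsupp : (Fin n → Fin (d + 1)) → Fin n →₀ ℕ) := by
    intro a b hab
    funext i
    exact Fin.ext (DFunLike.congr_fun hab i)
  ext m
  rw [MvPolynomial.coeff_sum]
  simp only [MvPolynomial.coeff_monomial]
  by_cases hm : ∀ i, m i < d + 1
  · rw [Finset.sum_eq_single (fun i => ⟨m i, hm i⟩)]
    · have : expFinsupp (fun i => (⟨m i, hm i⟩ : Fin (d + 1))) = m := by ext i; simp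
      simp [this]
    · intro b _ hb
      rw [if_neg]
      rintro rfl
      exact hb (by funext i; simp)
    · simp
  · push Not at hm
    obtain ⟨i, hi⟩ := hm
    rw [Finset.sum_eq_zero]
    · by_contra h
      have := MvPolynomial.monomial_le_degreeOf i (MvPolynomial.mem_support_iff.2 h)
      have := hA i
      omega
    · intro b _
      rw [if_neg]
      rintro rfl
      have := (b i).2
      simp only [expFinsupp_apply] at hi
      omega

lemma coeff_prod_X_add_C {R : Type*} [CommRing R] (r : Fin n → R) (a m : Fin n →₀ ℕ) :
    (∏ i, (MvPolynomial.X i + MvPolynomial.C (r i)) ^ a i : MvPolynomial (Fin n) R).coeff m =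
      ∏ i, kern (r i) (a i) (m i) := by
  classical
  have h : ∀ (s : Finset (Fin n)) (m : Fin n →₀ ℕ),
      (∏ i ∈ s, (MvPolynomial.X i + MvPolynomial.C (r i)) ^ a i : MvPolynomial (Fin n) R).coeff m =
      if ∀ i ∉ s, m i = 0 then ∏ i ∈ s, kern (r i) (a i) (m i) else 0 := by
    intro s
    induction s using Finset.induction_on with
    | empty =>
      intro m
      have h1 : (∀ i, i ∉ (∅ : Finset (Fin n)) → m i = 0) ↔ m = 0 := by simp [Finsupp.ext_iff]
      simp [MvPolynomial.coeff_one, eq_comm, Finsupp.ext_iff]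
    | insert i s hi ih =>
      intro m
      have h1 : (MvPolynomial.X i + MvPolynomial.C (r i) : MvPolynomial (Fin n) R) ^ a i =
          aeval (MvPolynomial.X i : MvPolynomial (Fin n) R) ((X + C (r i)) ^ a i) := by
        simp [MvPolynomial.algebraMap_eq]
      have hcond : (∀ j, j ∉ s → m.erase i j = 0) ↔ (∀ j, j ∉ insert i s → m j = 0) := by
        refine forall_congr' fun j => ?_
        by_cases hj : j = i
        · subst hj; simp
        · simp [hj]
      rw [Finset.prod_insert hi, h1, coeff_aeval_X_mul i _ _ (fun m hm => by
        rw [ih, if_neg fun h => hm (h i hi)]), ih, coeff_X_add_C_pow]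
      simp only [hcond]
      split_ifs
      · rw [Finset.prod_insert hi, kern]
        congr 1
        refine Finset.prod_congr rfl fun j hj => ?_
        rw [Finsupp.erase_ne]
        rintro rfl
        exact hi hj
      · simp
  simpa using h Finset.univ m

lemma coeff_aeval_X_add_C {K : Type*} [CommRing K] [Algebra F K] {d : ℕ}
    {A : MvPolynomial (Fin n) F} (hA : HasIndividualDegree d A) (r : Fin n → K)
    (m : Fin n →₀ ℕ) :
    (MvPolynomial.aeval (fun i => MvPolynomial.X i + MvPolynomial.C (r i)) A :
      MvPolynomial (Fin n) K).coeff m = ∑ a : Fin n → Fin (d + 1),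
      algebraMap F K (A.coeff (expFinsupp a)) * ∏ i, kern (r i) (a i) (m i) := by
  conv_lhs => rw [eq_sum_of_individualDegree hA]
  rw [map_sum, MvPolynomial.coeff_sum]
  refine Finset.sum_congr rfl fun a _ => ?_
  rw [MvPolynomial.aeval_monomial, IsScalarTower.algebraMap_apply F K, MvPolynomial.algebraMap_eq,
    MvPolynomial.coeff_C_mul, Finsupp.prod_fintype _ _ (by simp), coeff_prod_X_add_C]
  rfl

lemma coeff_aeval_X_add_C_eq_shiftCoeff {K : Type*} [CommRing K] [Algebra F K] {d : ℕ}
    {A : MvPolynomial (Fin n) F} (hA : HasIndividualDegree d A) (r : Fin n → K)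
    (e : Fin n → Fin (d + 1)) :
    (MvPolynomial.aeval (fun i => MvPolynomial.X i + MvPolynomial.C (r i)) A :
      MvPolynomial (Fin n) K).coeff (expFinsupp e) =
      shiftCoeff r (fun a => algebraMap F K (A.coeff (expFinsupp a))) e :=
  coeff_aeval_X_add_C hA r _

lemma eval_aeval_eq (x : Fin n → F) (g : Fin n → MvPolynomial (Fin n) F)
    (A : MvPolynomial (Fin n) F) : MvPolynomial.eval x (MvPolynomial.aeval g A) =
      MvPolynomial.eval (fun i => MvPolynomial.eval x (g i)) A := by
  rw [MvPolynomial.map_aeval]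
  have : (MvPolynomial.eval x).comp (algebraMap F (MvPolynomial (Fin n) F)) = RingHom.id F := by
    ext a
    simp [MvPolynomial.algebraMap_eq]
  rw [this]
  rfl

/-- Some coefficient of small support of the shifted polynomial is nonzero. -/
theorem exists_shiftCoeff_ne_zero {d w c W : ℕ} (hw : 1 ≤ w) (hc : 1 ≤ c) {f : Fin n → F[X]}
    (hW : bigWidth d w c ≤ W) (hf : PreservesRank d W f) {A : MvPolynomial (Fin n) F}
    (hA : SumOfROABPs c w A) (h0 : A ≠ 0) (hd : HasIndividualDegree d A) :
    ∃ e : Fin n → Fin (d + 1), (expSupport e).card ≤ c * Nat.log 2 (W ^ 2) ∧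
      shiftCoeff f (fun a => C (A.coeff (expFinsupp a))) e ≠ 0 := by
  obtain ⟨c, rfl⟩ : ∃ c', c = c' + 1 := ⟨c - 1, by omega⟩
  obtain ⟨P, hP, rfl⟩ := hA
  have hsum : (∑ j, fun a : Fin n → Fin (d + 1) => (P j).coeff (expFinsupp a)) =
      fun a => (∑ j, P j).coeff (expFinsupp a) := by
    funext a
    simp [MvPolynomial.coeff_sum]
  obtain ⟨e, he, hne⟩ := exists_shiftCoeff_ne_zero_of_sum hf c w hw hW
    (fun j a => (P j).coeff (expFinsupp a)) (fun j => (hP j).isProgTensor) (by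
      rw [hsum]
      intro h
      refine h0 ?_
      rw [eq_sum_of_individualDegree hd]
      exact Finset.sum_eq_zero fun a _ => by rw [congrFun h a]; simp)
  rw [hsum] at hne
  exact ⟨e, he, hne⟩

/-! ### Concentration of the shift and the hitting set -/

lemma mul_log_lt_supportBound {d w c : ℕ} (hw : 1 ≤ w) (hc : 1 ≤ c) :
    c * Nat.log 2 (bigWidth d w c ^ 2) < supportBound d w c := by
  have hpos : bigWidth d w c ^ 2 ≠ 0 := by
    unfold bigWidth
    positivity
  unfold supportBound
  refine Nat.mul_lt_mul_of_pos_left ?_ hc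
  rw [Nat.lt_clog_iff_pow_lt (by norm_num)]
  exact Nat.lt_succ_of_le (Nat.pow_log_le_self 2 hpos)

/-- The coefficients lie in the one-dimensional space F(t), so a single nonzero coefficient of small
support spans all others. -/
theorem isConcentrated_shift {d w c : ℕ} (hw : 1 ≤ w) (hc : 1 ≤ c) {f : Fin n → F[X]}
    (hf : PreservesRank d (bigWidth d w c) f) {A : MvPolynomial (Fin n) F}
    (hA : SumOfROABPs c w A) (hd : HasIndividualDegree d A) :
    IsConcentrated (supportBound d w c) (shift A f) := by
  intro a
  by_cases h0 : A = 0
  · simp [shift, h0]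
  obtain ⟨e, he, hne⟩ := exists_shiftCoeff_ne_zero hw hc le_rfl hf hA h0 hd
  have hcoeff : (shift A f).coeff (expFinsupp e) ≠ 0 := by
    rw [shift, coeff_aeval_X_add_C_eq_shiftCoeff hd]
    have h1 := map_shiftCoeff (algebraMap F[X] (RatFunc F)) f
      (fun a => C (A.coeff (expFinsupp a))) e
    have h2 : ∀ x : F, algebraMap F[X] (RatFunc F) (C x) = algebraMap F (RatFunc F) x := fun x => by
      rw [← Polynomial.algebraMap_eq, ← IsScalarTower.algebraMap_apply]
    simp only [h2] at h1
    rw [← h1]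
    exact fun h => hne (RatFunc.algebraMap_injective F (h.trans (map_zero _).symm))
  have hmem : (shift A f).coeff (expFinsupp e) ∈ Submodule.span (RatFunc F)
      {y | ∃ b : Fin n →₀ ℕ, b.support.card < supportBound d w c ∧ y = (shift A f).coeff b} :=
    Submodule.subset_span ⟨_, by
      rw [card_support_expFinsupp]
      exact he.trans_lt (mul_log_lt_supportBound hw hc), rfl⟩
  have := Submodule.smul_mem _ ((shift A f).coeff a * ((shift A f).coeff (expFinsupp e))⁻¹) hmem
  rwa [smul_eq_mul, inv_mul_cancel_right₀ hcoeff] at this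

lemma natDegree_shiftCoeff_le {d D : ℕ} {f : Fin n → F[X]} (hf : ∀ i, (f i).natDegree ≤ D)
    (T : (Fin n → Fin (d + 1)) → F) (e : Fin n → Fin (d + 1)) :
    (shiftCoeff f (fun a => C (T a)) e).natDegree ≤ n * d * D := by
  refine natDegree_sum_le_of_forall_le _ _ fun a _ => (natDegree_C_mul_le _ _).trans ?_
  refine (natDegree_prod_le _ _).trans ?_
  calc _ ≤ ∑ _i : Fin n, d * D := by
        refine Finset.sum_le_sum fun i _ => ?_
        unfold kern
        refine natDegree_mul_le.trans ?_
        rw [natDegree_natCast, add_zero]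
        refine natDegree_pow_le.trans (Nat.mul_le_mul ?_ (hf i))
        have := (a i).2
        omega
    _ = n * d * D := by simp [mul_assoc]

/-- A polynomial of individual degree `d` with a nonzero coefficient is nonzero at a grid point
whose support is contained in that of the monomial. -/
lemma exists_eval_ne_zero_of_coeff_ne_zero {d : ℕ} {P : MvPolynomial (Fin n) F}
    (hP : HasIndividualDegree d P) {m : Fin n →₀ ℕ} (hm : P.coeff m ≠ 0) {β : Fin d → F}
    (hβ : Function.Injective β) (hβ0 : ∀ j, β j ≠ 0) :
    ∃ h : Fin n → F, (∀ i, h i = 0 ∨ ∃ j, h i = β j) ∧ (∀ i, h i ≠ 0 → i ∈ m.support) ∧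
      MvPolynomial.eval h P ≠ 0 := by
  classical
  let G : Finset F := insert 0 (Finset.univ.image β)
  have hG : G.card = d + 1 := by
    rw [Finset.card_insert_of_notMem, Finset.card_image_of_injective _ hβ, Finset.card_univ,
      Fintype.card_fin]
    simpa using hβ0
  -- Setting the variables outside the support of `m` to zero keeps the coefficient at `m`. A
  -- nonzero polynomial of individual degree d does not vanish on all of a grid with d + 1 values
  -- per coordinate.
  let g : Fin n → MvPolynomial (Fin n) F := fun i =>
    if i ∈ m.support then MvPolynomial.X i else 0
  let R : MvPolynomial (Fin n) F := MvPolynomial.aeval g P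
  have hmono : ∀ b : Fin n →₀ ℕ, MvPolynomial.aeval g (MvPolynomial.monomial b (P.coeff b)) =
      if b.support ⊆ m.support then MvPolynomial.monomial b (P.coeff b) else 0 := by
    intro b
    rw [MvPolynomial.aeval_monomial, MvPolynomial.algebraMap_eq]
    split_ifs with hb
    · rw [MvPolynomial.monomial_eq]
      congr 1
      refine Finset.prod_congr rfl fun i hi => ?_
      have : i ∈ m.support := hb hi
      simp only [g, if_pos this]
    · obtain ⟨i, hi, him⟩ := Finset.not_subset.1 hb
      rw [Finsupp.prod, Finset.prod_eq_zero hi, mul_zero]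
      simp only [g, if_neg him]
      exact zero_pow (Finsupp.mem_support_iff.1 hi)
  have hR : ∀ b, R.coeff b = if b.support ⊆ m.support then P.coeff b else 0 := by
    intro b
    have h1 : R = ∑ b ∈ P.support,
        if b.support ⊆ m.support then MvPolynomial.monomial b (P.coeff b) else 0 := by
      simp only [R]
      conv_lhs => rw [← MvPolynomial.support_sum_monomial_coeff P]
      rw [map_sum]
      exact Finset.sum_congr rfl fun b _ => hmono b
    rw [h1, MvPolynomial.coeff_sum]
    by_cases hb : b ∈ P.support
    · rw [Finset.sum_eq_single b]
      · split_ifs <;> simp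
      · intro b' _ hne
        split_ifs <;> simp [MvPolynomial.coeff_monomial, hne]
      · exact fun h => absurd hb h
    · rw [MvPolynomial.notMem_support_iff.1 hb, ite_self]
      refine Finset.sum_eq_zero fun b' hb' => ?_
      have : b' ≠ b := fun h => hb (h ▸ hb')
      split_ifs <;> simp [MvPolynomial.coeff_monomial, this]
  have hRne : R ≠ 0 := fun h => hm (by
    have := hR m
    rw [if_pos (Finset.Subset.refl _), h, MvPolynomial.coeff_zero] at this
    exact this.symm)
  have hRdeg : ∀ i, R.degreeOf i < G.card := by
    intro i
    rw [hG, Nat.lt_succ_iff, MvPolynomial.degreeOf_le_iff]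
    intro b hb
    rw [MvPolynomial.mem_support_iff, hR b] at hb
    have hb' : P.coeff b ≠ 0 := by
      split_ifs at hb with h
      · exact hb
      · exact absurd rfl hb
    exact (MvPolynomial.monomial_le_degreeOf i (MvPolynomial.mem_support_iff.2 hb')).trans (hP i)
  obtain ⟨x, hx, hxne⟩ : ∃ x : Fin n → F, (∀ i, x i ∈ G) ∧ MvPolynomial.eval x R ≠ 0 := by
    by_contra! hcon
    exact hRne (MvPolynomial.eq_zero_of_eval_zero_at_prod_finset R (fun _ => G) hRdeg hcon)
  refine ⟨fun i => if i ∈ m.support then x i else 0, fun i => ?_, fun i hi => ?_, ?_⟩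
  · dsimp only
    split_ifs
    · have := hx i
      simp only [G, Finset.mem_insert, Finset.mem_image, Finset.mem_univ, true_and] at this
      rcases this with h | ⟨j, hj⟩
      · exact Or.inl h
      · exact Or.inr ⟨j, hj.symm⟩
    · exact Or.inl rfl
  · by_contra h
    simp [h] at hi
  · convert hxne using 1
    simp only [R]
    rw [eval_aeval_eq]
    congr 2
    funext i
    simp only [g]
    split_ifs <;> simp

/-- The surviving coefficient is a nonzero polynomial in t of degree at most ndD, so some τ in T is
not a root. For this τ the coefficient remains nonzero in A(x + f(τ)), and a grid point on its few
variables detects it. -/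
theorem isHittingSet_shiftedLowSupport {d w c D : ℕ} (hw : 1 ≤ w) (hc : 1 ≤ c) {f : Fin n → F[X]}
    (hf : PreservesRank d (bigWidth d w c) f) (hD : ∀ i, (f i).natDegree ≤ D) {β : Fin d → F}
    (hβ : Function.Injective β) (hβ0 : ∀ j, β j ≠ 0) {T : Finset F} (hT : n * d * D < T.card) :
    IsHittingSet d w c (shiftedLowSupport (supportBound d w c) β f T) := by
  classical
  intro A hd hA h0
  obtain ⟨e, he, hne⟩ := exists_shiftCoeff_ne_zero hw hc le_rfl hf hA h0 hd
  obtain ⟨τ, hτ, hroot⟩ : ∃ τ ∈ T, (shiftCoeff f (fun a => C (A.coeff (expFinsupp a))) e).eval τ ≠ 0 := by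
    by_contra! hcon
    have h1 : T.card ≤ (shiftCoeff f (fun a => C (A.coeff (expFinsupp a))) e).natDegree :=
      card_le_degree_of_subset_roots fun τ hτ =>
        (mem_roots hne).2 (hcon τ (by simpa using hτ))
    have h2 := natDegree_shiftCoeff_le hD (fun a => A.coeff (expFinsupp a)) e
    omega
  let P : MvPolynomial (Fin n) F :=
    MvPolynomial.aeval (fun i => MvPolynomial.X i + MvPolynomial.C ((f i).eval τ)) A
  have hcoeff : P.coeff (expFinsupp e) ≠ 0 := by
    simp only [P]
    rw [coeff_aeval_X_add_C_eq_shiftCoeff hd]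
    have := map_shiftCoeff (evalRingHom τ) f (fun a => C (A.coeff (expFinsupp a))) e
    simp only [coe_evalRingHom, eval_C] at this
    simpa [← this] using hroot
  have hP : HasIndividualDegree d P := by
    intro i
    rw [MvPolynomial.degreeOf_le_iff]
    intro m hm
    by_contra hlt
    refine MvPolynomial.mem_support_iff.1 hm ?_
    simp only [P]
    rw [coeff_aeval_X_add_C hd]
    refine Finset.sum_eq_zero fun a _ => ?_
    rw [Finset.prod_eq_zero (Finset.mem_univ i), mul_zero]
    refine kern_of_lt _ ?_
    have := (a i).2
    omega
  obtain ⟨h, hh, hsupp, heval⟩ := exists_eval_ne_zero_of_coeff_ne_zero hP hcoeff hβ hβ0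
  refine ⟨fun i => h i + (f i).eval τ, ⟨τ, hτ, h, hh, ?_, fun i => rfl⟩, ?_⟩
  · refine lt_of_le_of_lt ?_ (he.trans_lt (mul_log_lt_supportBound hw hc))
    rw [← card_support_expFinsupp, ← Set.ncard_coe_finset]
    exact Set.ncard_le_ncard (fun i hi => hsupp i hi) (Finset.finite_toSet _)
  · convert heval using 1
    simp only [P]
    rw [eval_aeval_eq]
    simp

end Bridge

end SumROABP

namespace SumROABP

/-! ### Verified programs -/

universe u

/-- A condition on the input registers `N[0], …, N[3]`, and a quantity depending on them in powers of
which running times are measured. -/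
structure Budget where
  good : (ℕ → ℕ) → Prop
  bound : (ℕ → ℕ) → ℕ
  good_congr : ∀ {v v' : ℕ → ℕ}, (∀ i < 4, v' i = v i) → good v → good v'
  bound_congr : ∀ {v v' : ℕ → ℕ}, (∀ i < 4, v' i = v i) → bound v' = bound v
  two_le : ∀ {v : ℕ → ℕ}, good v → 2 ≤ bound v

section PolyBounds

variable {x m n a b : ℕ}

lemma pow_bound_mono (hx : 2 ≤ x) (h : m ≤ x ^ a) (hab : a ≤ b) : m ≤ x ^ b :=
  h.trans (Nat.pow_le_pow_right (by omega) hab)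

lemma pow_bound_add (hx : 2 ≤ x) (h : m ≤ x ^ a) (h' : n ≤ x ^ b) : m + n ≤ x ^ (a + b + 1) := by
  have h1 := pow_bound_mono hx h (Nat.le_add_right a b)
  have h2 := pow_bound_mono hx h' (Nat.le_add_left b a)
  calc m + n ≤ x ^ (a + b) * 2 := by omega
    _ ≤ x ^ (a + b) * x := Nat.mul_le_mul_left _ hx
    _ = x ^ (a + b + 1) := by ring

lemma pow_bound_add_one (hx : 2 ≤ x) (h : m ≤ x ^ a) (h' : n ≤ x ^ b) :
    m + (n + 1) ≤ x ^ (a + b + 2) := by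
  have h1 := pow_bound_add hx h h'
  have h2 : 1 ≤ x ^ (a + b + 1) := Nat.one_le_pow _ _ (by omega)
  calc m + (n + 1) ≤ x ^ (a + b + 1) * 2 := by omega
    _ ≤ x ^ (a + b + 1) * x := Nat.mul_le_mul_left _ hx
    _ = x ^ (a + b + 2) := by ring

lemma pow_bound_mul (h : m ≤ x ^ a) (h' : n ≤ x ^ b) : m * n ≤ x ^ (a + b) :=
  (Nat.mul_le_mul h h').trans_eq (pow_add x a b).symm

lemma pow_bound_const (hx : 2 ≤ x) (k : ℕ) : k ≤ x ^ k :=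
  Nat.lt_two_pow_self.le.trans (Nat.pow_le_pow_left hx k)

end PolyBounds

/-- The function `g` of the registers below `b` can be computed, into any register `B ≥ b` and without
changing the registers below `B`, in a number of steps that is polynomial in the budget. -/
structure Comp (β : Budget) (b : ℕ) (g : (ℕ → ℕ) → ℕ) : Prop where
  four_le : 4 ≤ b
  congr : ∀ v v' : ℕ → ℕ, (∀ i < b, v' i = v i) → g v' = g v
  bounded : ∀ e, ∃ a, ∀ v, β.good v → (∀ i < b, v i ≤ β.bound v ^ e) → g v ≤ β.bound v ^ a
  prog : ∀ B, b ≤ B → ∃ p : Prog, ∀ e, ∃ a, ∀ (F : Type u) [Field F] (α : ℕ → F) (s : State F),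
    β.good s.nat → (∀ i < B, s.nat i ≤ β.bound s.nat ^ e) →
    ∃ t s', Runs α p s t s' ∧ t ≤ β.bound s.nat ^ a ∧ s'.fld = s.fld ∧ s'.out = s.out ∧
      s'.nat B = g s.nat ∧ ∀ i < B, s'.nat i = s.nat i

namespace Comp

variable {β : Budget} {b : ℕ} {g h : (ℕ → ℕ) → ℕ}

lemma mono (hg : Comp.{u} β b g) {b' : ℕ} (hb : b ≤ b') : Comp.{u} β b' g where
  four_le := hg.four_le.trans hb
  congr v v' hv := hg.congr v v' fun i hi => hv i (hi.trans_le hb)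
  bounded e := by
    obtain ⟨a, ha⟩ := hg.bounded e
    exact ⟨a, fun v hv h => ha v hv fun i hi => h i (hi.trans_le hb)⟩
  prog B hB := hg.prog B (hb.trans hB)

lemma const (hb : 4 ≤ b) (k : ℕ) : Comp.{u} β b fun _ => k where
  four_le := hb
  congr _ _ _ := rfl
  bounded _ := ⟨k, fun _ hv _ => pow_bound_const (β.two_le hv) k⟩
  prog B _ := ⟨.instr (.natConst B k), fun _ => ⟨0, fun F _ α s _ _ =>
    ⟨1, _, .instr _ s, by simp, rfl, rfl, by simp [Instr.exec, State.setNat],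
      fun i hi => by simp [Instr.exec, State.setNat, hi.ne]⟩⟩⟩

lemma reg (hb : 4 ≤ b) {i : ℕ} (hi : i < b) : Comp.{u} β b fun v => v i where
  four_le := hb
  congr _ _ h := h i hi
  bounded e := ⟨e, fun _ _ h => h i hi⟩
  -- A register is copied by adding it to a zero.
  prog B hB := ⟨.seq (.instr (.natConst B 0)) (.instr (.natAdd B B i)), fun _ => ⟨2,
    fun F _ α s hs _ => ⟨2, _, .seq (.instr _ s) (.instr _ _),
      pow_bound_const (β.two_le hs) 2, rfl, rfl, by
        have : i ≠ B := by omega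
        simp [Instr.exec, State.setNat, this],
      fun j hj => by simp [Instr.exec, State.setNat, hj.ne]⟩⟩⟩

/-- Registers from `B` upward serve as a stack: the first operand is left in `B`, and the second is
computed into B + 1 without touching it. -/
lemma binop (op : ℕ → ℕ → ℕ) (hop : ∀ x y, op x y ≤ x + y) (ins : ℕ → Instr)
    (hins : ∀ (F : Type u) [Field F] (α : ℕ → F) (s : State F) (B : ℕ),
      (ins B).exec α s = s.setNat B (op (s.nat B) (s.nat (B + 1))))
    (hg : Comp.{u} β b g) (hh : Comp.{u} β b h) : Comp.{u} β b fun v => op (g v) (h v) where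
  four_le := hg.four_le
  congr v v' hv := by rw [hg.congr v v' hv, hh.congr v v' hv]
  bounded e := by
    obtain ⟨a, ha⟩ := hg.bounded e
    obtain ⟨a', ha'⟩ := hh.bounded e
    exact ⟨_, fun v hv h => (hop _ _).trans (pow_bound_add (β.two_le hv) (ha v hv h) (ha' v hv h))⟩
  prog B hB := by
    obtain ⟨p, hp⟩ := hg.prog B hB
    obtain ⟨q, hq⟩ := hh.prog (B + 1) (by omega)
    refine ⟨.seq p (.seq q (.instr (ins B))), fun e => ?_⟩
    obtain ⟨a, ha⟩ := hg.bounded e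
    obtain ⟨tp, htp⟩ := hp e
    obtain ⟨tq, htq⟩ := hq (e + a)
    refine ⟨tp + tq + 2, fun F _ α s hs hsb => ?_⟩
    have h2 := β.two_le hs
    have h4 := hg.four_le
    obtain ⟨t₁, s₁, hr₁, ht₁, hf₁, ho₁, hv₁, hn₁⟩ := htp F α s hs hsb
    have hn4 : ∀ i < 4, s₁.nat i = s.nat i := fun i hi => hn₁ i (by omega)
    have hb₁ := β.bound_congr hn4
    obtain ⟨t₂, s₂, hr₂, ht₂, hf₂, ho₂, hv₂, hn₂⟩ := htq F α s₁ (β.good_congr hn4 hs) (by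
      intro i hi
      rw [hb₁]
      rcases Nat.lt_or_ge i B with h | h
      · rw [hn₁ i h]
        exact pow_bound_mono h2 (hsb i h) (Nat.le_add_right _ _)
      · obtain rfl : i = B := by omega
        rw [hv₁]
        exact pow_bound_mono h2 (ha _ hs fun i hi => hsb i (by omega)) (Nat.le_add_left _ _))
    rw [hb₁] at ht₂
    refine ⟨t₁ + (t₂ + 1), _, .seq hr₁ (.seq hr₂ (.instr _ _)),
      pow_bound_add_one h2 ht₁ ht₂, ?_⟩
    rw [hins]
    refine ⟨hf₂.trans hf₁, ho₂.trans ho₁, ?_, fun i hi => ?_⟩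
    · simp only [State.setNat, Function.update_self]
      rw [hv₂, hn₂ B (by omega), hv₁, hh.congr s.nat s₁.nat fun i hi => hn₁ i (by omega)]
    · simp only [State.setNat, Function.update_of_ne hi.ne]
      rw [hn₂ i (by omega), hn₁ i hi]

lemma add (hg : Comp.{u} β b g) (hh : Comp.{u} β b h) : Comp.{u} β b fun v => g v + h v :=
  binop (· + ·) (fun _ _ => le_rfl) (fun B => .natAdd B B (B + 1)) (fun _ _ _ _ _ => rfl) hg hh

lemma sub (hg : Comp.{u} β b g) (hh : Comp.{u} β b h) : Comp.{u} β b fun v => g v - h v :=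
  binop (· - ·) (fun _ _ => by omega) (fun B => .natSub B B (B + 1)) (fun _ _ _ _ _ => rfl) hg hh

lemma ifZero {k : (ℕ → ℕ) → ℕ} (hk : Comp.{u} β b k) (hg : Comp.{u} β b g) (hh : Comp.{u} β b h) :
    Comp.{u} β b fun v => if k v = 0 then g v else h v where
  four_le := hg.four_le
  congr v v' hv := by rw [hg.congr v v' hv, hh.congr v v' hv, hk.congr v v' hv]
  bounded e := by
    obtain ⟨a, ha⟩ := hg.bounded e
    obtain ⟨a', ha'⟩ := hh.bounded e
    refine ⟨a + a', fun v hv h => ?_⟩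
    split_ifs
    · exact pow_bound_mono (β.two_le hv) (ha v hv h) (Nat.le_add_right _ _)
    · exact pow_bound_mono (β.two_le hv) (ha' v hv h) (Nat.le_add_left _ _)
  prog B hB := by
    obtain ⟨r, hr⟩ := hk.prog B hB
    obtain ⟨p, hp⟩ := hg.prog B hB
    obtain ⟨q, hq⟩ := hh.prog B hB
    refine ⟨.seq r (.ifNatZero B p q), fun e => ?_⟩
    obtain ⟨tr, htr⟩ := hr e
    obtain ⟨tp, htp⟩ := hp e
    obtain ⟨tq, htq⟩ := hq e
    refine ⟨tr + (tp + tq) + 2, fun F _ α s hs hsb => ?_⟩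
    have h2 := β.two_le hs
    have h4 := hg.four_le
    obtain ⟨t₁, s₁, hr₁, ht₁, hf₁, ho₁, hv₁, hn₁⟩ := htr F α s hs hsb
    have hn4 : ∀ i < 4, s₁.nat i = s.nat i := fun i hi => hn₁ i (by omega)
    have hb₁ := β.bound_congr hn4
    have hsb₁ : ∀ i < B, s₁.nat i ≤ β.bound s₁.nat ^ e := fun i hi => by
      rw [hb₁, hn₁ i hi]; exact hsb i hi
    split_ifs with hz
    · obtain ⟨t₂, s₂, hr₂, ht₂, hf₂, ho₂, hv₂, hn₂⟩ := htp F α s₁ (β.good_congr hn4 hs) hsb₁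
      rw [hb₁] at ht₂
      refine ⟨t₁ + (t₂ + 1), _, .seq hr₁ (.ifNatZero_true (hv₁.trans hz) hr₂),
        pow_bound_add_one h2 ht₁ (pow_bound_mono h2 ht₂ (Nat.le_add_right _ _)), hf₂.trans hf₁, ho₂.trans ho₁,
        ?_, fun i hi => (hn₂ i hi).trans (hn₁ i hi)⟩
      rw [hv₂, hg.congr s.nat s₁.nat fun i hi => hn₁ i (by omega)]
    · obtain ⟨t₂, s₂, hr₂, ht₂, hf₂, ho₂, hv₂, hn₂⟩ := htq F α s₁ (β.good_congr hn4 hs) hsb₁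
      rw [hb₁] at ht₂
      refine ⟨t₁ + (t₂ + 1), _, .seq hr₁ (.ifNatZero_false (hv₁.trans_ne hz) hr₂),
        pow_bound_add_one h2 ht₁ (pow_bound_mono h2 ht₂ (Nat.le_add_left _ _)), hf₂.trans hf₁, ho₂.trans ho₁,
        ?_, fun i hi => (hn₂ i hi).trans (hn₁ i hi)⟩
      rw [hv₂, hh.congr s.nat s₁.nat fun i hi => hn₁ i (by omega)]

/-- Bounded iteration. The predicate `I v j x` is an invariant of the accumulator `x` when `j` rounds
remain. -/
lemma fold {k init : (ℕ → ℕ) → ℕ} {step : (ℕ → ℕ) → ℕ → ℕ → ℕ} (hk : Comp.{u} β b k)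
    (hinit : Comp.{u} β b init)
    (hstep : ∀ B, b ≤ B → Comp.{u} β (B + 2) fun v => step v (v (B + 1)) (v B))
    (hcongr : ∀ v v' : ℕ → ℕ, (∀ i < b, v' i = v i) → step v' = step v)
    (I : (ℕ → ℕ) → ℕ → ℕ → Prop) (hI : ∀ v, β.good v → I v (k v) (init v))
    (hI' : ∀ v j x, β.good v → j < k v → I v (j + 1) x → I v j (step v j x))
    (hIb : ∀ e, ∃ a, ∀ v j x, β.good v → (∀ i < b, v i ≤ β.bound v ^ e) → j ≤ k v → I v j x →
      x ≤ β.bound v ^ a) :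
    Comp.{u} β b fun v => (List.range (k v)).foldr (step v) (init v) := by
  have h4 := hk.four_le
  have hfinal : ∀ v, β.good v → ∀ j ≤ k v, ∀ x, I v j x →
      I v 0 ((List.range j).foldr (step v) x) := by
    intro v hv j
    induction j with
    | zero => intro _ x hx; simpa using hx
    | succ j ih =>
      intro hj x hx
      rw [List.range_succ, List.foldr_append]
      exact ih (by omega) _ (hI' v j x hv hj hx)
  refine ⟨h4, fun v v' hv => ?_, fun e => ?_, fun B hB => ?_⟩
  · rw [hk.congr v v' hv, hinit.congr v v' hv, hcongr v v' hv]
  · obtain ⟨a, ha⟩ := hIb e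
    exact ⟨a, fun v hv h => ha v 0 _ hv h (Nat.zero_le _) (hfinal v hv _ le_rfl _ (hI v hv))⟩
  obtain ⟨p, hp⟩ := hinit.prog B hB
  obtain ⟨q, hq⟩ := hk.prog (B + 1) (by omega)
  obtain ⟨r, hr⟩ := (hstep B hB).prog (B + 2) le_rfl
  -- Register `B` holds the accumulator and B + 1 the counter. The counter is decreased before the
  -- step, so the rounds see k - 1, …, 0, in the order of a right fold over the range.
  let body : Prog := .seq (.instr (.natConst (B + 2) 1)) (.seq
    (.instr (.natSub (B + 1) (B + 1) (B + 2))) (.seq r (.seq (.instr (.natConst B 0))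
      (.instr (.natAdd B B (B + 2))))))
  refine ⟨.seq p (.seq q (.loop (B + 1) body)), fun e => ?_⟩
  obtain ⟨ai, hai⟩ := hinit.bounded e
  obtain ⟨ak, hak⟩ := hk.bounded e
  obtain ⟨ax, hax⟩ := hIb e
  obtain ⟨tp, htp⟩ := hp e
  obtain ⟨tq, htq⟩ := hq (e + ai)
  -- One exponent that covers the old registers, the counter and, through the invariant, every
  -- intermediate accumulator, so that all rounds share one time bound.
  obtain ⟨tr, htr⟩ := hr (e + ak + ax)
  refine ⟨tp + (tq + (ak + (tr + 5 + 1)) + 2) + 1, fun F _ α s hs hsb => ?_⟩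
  have h2 := β.two_le hs
  obtain ⟨t₁, s₁, hr₁, ht₁, hf₁, ho₁, hv₁, hn₁⟩ := htp F α s hs hsb
  have hn4 : ∀ i < 4, s₁.nat i = s.nat i := fun i hi => hn₁ i (by omega)
  have hb₁ := β.bound_congr hn4
  obtain ⟨t₂, s₂, hr₂, ht₂, hf₂, ho₂, hv₂, hn₂⟩ := htq F α s₁ (β.good_congr hn4 hs) (by
    intro i hi
    rw [hb₁]
    rcases Nat.lt_or_ge i B with h | h
    · rw [hn₁ i h]
      exact pow_bound_mono h2 (hsb i h) (Nat.le_add_right _ _)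
    · obtain rfl : i = B := by omega
      rw [hv₁]
      exact pow_bound_mono h2 (hai _ hs fun i hi => hsb i (by omega)) (Nat.le_add_left _ _))
  rw [hb₁] at ht₂
  rw [hk.congr s.nat s₁.nat fun i hi => hn₁ i (by omega)] at hv₂
  have hloop : ∀ j ≤ k s.nat, ∀ (x : ℕ) (s' : State F), I s.nat j x → s'.nat (B + 1) = j →
      s'.nat B = x → (∀ i < B, s'.nat i = s.nat i) →
      ∃ t s'', Runs α (.loop (B + 1) body) s' t s'' ∧
        t ≤ j * (β.bound s.nat ^ tr + 5) + 1 ∧ s''.fld = s'.fld ∧ s''.out = s'.out ∧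
        s''.nat B = (List.range j).foldr (step s.nat) x ∧ ∀ i < B, s''.nat i = s.nat i := by
    intro j
    induction j with
    | zero =>
      intro _ x s' _ hj hx hn
      exact ⟨1, s', .loop_done hj, by omega, rfl, rfl, by simpa using hx, hn⟩
    | succ j ih =>
      intro hjk x s' hIx hj hx hn
      let s₃ := (s'.setNat (B + 2) 1).setNat (B + 1) j
      have e₃ : (Instr.natSub (B + 1) (B + 1) (B + 2)).exec α
          ((Instr.natConst (B + 2) 1).exec α s') = s₃ := by
        simp [Instr.exec, State.setNat, s₃, hj]
      have n₃ : ∀ i < B, s₃.nat i = s.nat i := fun i hi => by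
        have h1 : i ≠ B + 1 := by omega
        have h2 : i ≠ B + 2 := by omega
        simp [s₃, State.setNat, h1, h2, hn i hi]
      have n₃B : s₃.nat B = x := by simp [s₃, State.setNat, hx]
      have n₃B1 : s₃.nat (B + 1) = j := by simp [s₃, State.setNat]
      have n₃4 : ∀ i < 4, s₃.nat i = s.nat i := fun i hi => n₃ i (by omega)
      have b₃ := β.bound_congr n₃4
      obtain ⟨t, s₄, hr₄, ht₄, hf₄, ho₄, hv₄, hn₄⟩ := htr F α s₃ (β.good_congr n₃4 hs) (by
        intro i hi
        rw [b₃]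
        rcases Nat.lt_or_ge i B with h | h
        · rw [n₃ i h]
          exact pow_bound_mono h2 (hsb i h) (by omega)
        · obtain rfl | rfl : i = B ∨ i = B + 1 := by omega
          · rw [n₃B]
            exact pow_bound_mono h2 (hax _ _ _ hs (fun i hi => hsb i (by omega)) hjk hIx) (by omega)
          · rw [n₃B1]
            exact pow_bound_mono h2 (le_trans (by omega) (hak _ hs fun i hi => hsb i (by omega)))
              (show ak ≤ _ by omega))
      rw [b₃] at ht₄
      rw [n₃B, n₃B1, hcongr s.nat s₃.nat fun i hi => n₃ i (by omega)] at hv₄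
      let s₅ := (s₄.setNat B 0).setNat B (step s.nat j x)
      have e₅ : (Instr.natAdd B B (B + 2)).exec α ((Instr.natConst B 0).exec α s₄) = s₅ := by
        simp [Instr.exec, State.setNat, s₅, hv₄]
      obtain ⟨t', s₆, hr₆, ht₆, hf₆, ho₆, hv₆, hn₆⟩ := ih (by omega) (step s.nat j x) s₅
        (hI' _ _ _ hs (by omega) hIx)
        (by simp [s₅, State.setNat, hn₄ (B + 1) (by omega), n₃B1])
        (by simp [s₅, State.setNat])
        (fun i hi => by simp [s₅, State.setNat, hi.ne, hn₄ i (by omega), n₃ i hi])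
      refine ⟨1 + (1 + (t + (1 + 1))) + t' + 1, s₆, .loop_step (by omega)
        (.seq (.instr _ _) (.seq (e₃ ▸ .instr _ _) (.seq hr₄ (.seq (.instr _ _)
          (e₅ ▸ .instr _ _))))) hr₆, ?_, hf₆.trans hf₄, ho₆.trans ho₄, ?_, hn₆⟩
      · rw [Nat.succ_mul]; omega
      · rw [hv₆, List.range_succ, List.foldr_append]
        rfl
  have hn₂' : ∀ i < B, s₂.nat i = s.nat i := fun i hi => (hn₂ i (by omega)).trans (hn₁ i hi)
  obtain ⟨t₃, s₃, hr₃, ht₃, hf₃, ho₃, hv₃, hn₃⟩ := hloop _ le_rfl (init s.nat) s₂ (hI _ hs) hv₂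
    ((hn₂ B (by omega)).trans hv₁) hn₂'
  refine ⟨t₁ + (t₂ + t₃), s₃, .seq hr₁ (.seq hr₂ hr₃), ?_, hf₃.trans (hf₂.trans hf₁),
    ho₃.trans (ho₂.trans ho₁), hv₃, hn₃⟩
  refine pow_bound_add h2 ht₁ (le_trans (Nat.add_le_add_left ht₃ _)
    (pow_bound_add_one h2 ht₂ (pow_bound_mul (hak _ hs fun i hi => hsb i (by omega)) ?_)))
  exact pow_bound_add h2 le_rfl (pow_bound_const h2 5)

end Comp

end SumROABP

namespace SumROABP

universe u

/-! ### Arithmetic -/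

lemma foldr_range_succ {γ : Type*} (f : ℕ → γ → γ) (x : γ) (k : ℕ) :
    (List.range (k + 1)).foldr f x = (List.range k).foldr f (f k x) := by
  rw [List.range_succ, List.foldr_append]
  rfl

lemma foldr_add (a x k : ℕ) : (List.range k).foldr (fun _ y => y + a) x = x + a * k := by
  induction k generalizing x with
  | zero => simp
  | succ k ih => rw [foldr_range_succ, ih]; ring

lemma foldr_mul (a x k : ℕ) : (List.range k).foldr (fun _ y => y * a) x = x * a ^ k := by
  induction k generalizing x with
  | zero => simp
  | succ k ih => rw [foldr_range_succ, ih]; ring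

lemma foldr_mul_mod (a m x k : ℕ) :
    (List.range k).foldr (fun _ y => y * a % m) (x % m) = x * a ^ k % m := by
  induction k generalizing x with
  | zero => simp
  | succ k ih => rw [foldr_range_succ, Nat.mod_mul_mod, ih]; ring_nf

lemma foldr_div (a x k : ℕ) : (List.range k).foldr (fun _ y => y / a) x = x / a ^ k := by
  induction k generalizing x with
  | zero => simp
  | succ k ih => rw [foldr_range_succ, ih, Nat.div_div_eq_div_mul, pow_succ']

/-- Counting up to a threshold. -/
lemma foldr_count {P : ℕ → Prop} [DecidablePred P] {c : ℕ} (hP : ∀ y, P y ↔ c ≤ y) (x k : ℕ)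
    (hx : x ≤ c) : (List.range k).foldr (fun _ y => if P y then y else y + 1) x = min (x + k) c := by
  induction k generalizing x with
  | zero => simp [hx]
  | succ k ih =>
    rw [foldr_range_succ]
    by_cases h : P x
    · have := (hP x).1 h
      rw [if_pos h, ih x hx]; omega
    · have : ¬ c ≤ x := fun h' => h ((hP x).2 h')
      rw [if_neg h, ih _ (by omega)]; omega

lemma foldr_iterWeight (d N B k Q i : ℕ) :
    (List.range k).foldr (fun j x => B * x + hash d (Q / N ^ j % N) i) 0 =
      iterWeight d N B k Q i := by
  induction k generalizing Q with
  | zero => rfl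
  | succ k ih =>
    rw [List.range_succ_eq_map, List.foldr_cons, List.foldr_map, iterWeight, ← ih]
    congr 2
    · congr 1
      funext j x
      rw [Nat.div_div_eq_div_mul, pow_succ']
    · simp

namespace Comp

variable {β : Budget} {b : ℕ} {g h k : (ℕ → ℕ) → ℕ}

lemma ext {g' : (ℕ → ℕ) → ℕ} (hg : Comp.{u} β b g) (hgg' : ∀ v, g v = g' v) : Comp.{u} β b g' :=
  (funext hgg') ▸ hg

/-- Multiplication is repeated addition; the invariant keeps the partial sums below the product. -/
lemma mul (hg : Comp.{u} β b g) (hh : Comp.{u} β b h) : Comp.{u} β b fun v => g v * h v :=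
  (fold (step := fun v _ x => x + g v) hh (const hg.four_le 0)
    (fun B hB => (reg (by have := hg.four_le; omega) (by omega)).add (hg.mono (by omega)))
    (fun v v' hv => by simp only [hg.congr v v' hv])
    (fun v j x => x + g v * j = g v * h v) (fun v _ => by simp)
    (fun v j x _ _ hx => by rw [← hx]; ring)
    (fun e => by
      obtain ⟨a, ha⟩ := hg.bounded e
      obtain ⟨a', ha'⟩ := hh.bounded e
      exact ⟨a + a', fun v j x hv hb _ hx => le_trans (by omega)
        (pow_bound_mul (ha v hv hb) (ha' v hv hb))⟩)).ext fun v => by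
    rw [foldr_add, zero_add]

/-- The quotient is found by counting upward as long as the next multiple of the divisor does not
exceed the dividend. The time is polynomial in the values themselves, which the budget permits. -/
lemma div (hg : Comp.{u} β b g) (hh : Comp.{u} β b h) : Comp.{u} β b fun v => g v / h v :=
  (ifZero hh (const hg.four_le 0)
    (fold (step := fun v _ x => if h v * (x + 1) - g v = 0 then x + 1 else x) hg
      (const hg.four_le 0)
      (fun B hB => by
        have h4 := hg.four_le
        exact ifZero (((hh.mono (by omega)).mul ((reg (by omega) (by omega)).add
          (const (by omega) 1))).sub (hg.mono (by omega)))
          ((reg (by omega) (by omega)).add (const (by omega) 1)) (reg (by omega) (by omega)))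
      (fun v v' hv => by simp only [hg.congr v v' hv, hh.congr v v' hv])
      (fun v j x => x + j ≤ g v) (fun v _ => by simp)
      (fun v j x _ _ hx => by split_ifs <;> omega)
      (fun e => by
        obtain ⟨a, ha⟩ := hg.bounded e
        exact ⟨a, fun v j x hv hb _ hx => le_trans (by omega) (ha v hv hb)⟩))).ext fun v => by
    split_ifs with h0
    · simp [h0]
    · have h1 : ∀ y, (h v * (y + 1) - g v ≠ 0) ↔ g v / h v ≤ y := by
        intro y
        rw [← not_lt, Nat.lt_iff_add_one_le, Nat.le_div_iff_mul_le (Nat.pos_of_ne_zero h0),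
          mul_comm]
        omega
      have h2 := foldr_count h1 0 (g v) (Nat.zero_le _)
      simp only [ite_not, zero_add] at h2
      rw [h2, min_eq_right (Nat.div_le_self _ _)]

lemma mod (hg : Comp.{u} β b g) (hh : Comp.{u} β b h) : Comp.{u} β b fun v => g v % h v :=
  (hg.sub (hh.mul (hg.div hh))).ext fun _ => Nat.mod_eq_sub_mul_div.symm

/-- As the base is positive, all partial products are bounded by the final power, so a bound for the
latter suffices. -/
lemma pow (hg : Comp.{u} β b g) (hh : Comp.{u} β b h) (hpos : ∀ v, β.good v → 1 ≤ g v)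
    (hb : ∃ a, ∀ v, β.good v → g v ^ h v ≤ β.bound v ^ a) : Comp.{u} β b fun v => g v ^ h v :=
  (fold (step := fun v _ x => x * g v) hh (const hg.four_le 1)
    (fun B hB => (reg (by have := hg.four_le; omega) (by omega)).mul (hg.mono (by omega)))
    (fun v v' hv => by simp only [hg.congr v v' hv])
    (fun v j x => x * g v ^ j = g v ^ h v) (fun v _ => by simp)
    (fun v j x _ _ hx => by rw [← hx]; ring)
    (fun e => by
      obtain ⟨a, ha⟩ := hb
      exact ⟨a, fun v j x hv _ _ hx => le_trans (hx ▸ Nat.le_mul_of_pos_right _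
        (Nat.pow_pos (hpos v hv))) (ha v hv)⟩)).ext fun v => by
    rw [foldr_mul, one_mul]

/-- Needed for the hash values: (d+1)^i itself may exceed every power of the budget, so each product
is reduced at once. -/
lemma powMod (hg : Comp.{u} β b g) (hh : Comp.{u} β b h) (hk : Comp.{u} β b k) :
    Comp.{u} β b fun v => g v ^ h v % (k v + 1) :=
  (fold (step := fun v _ x => x * g v % (k v + 1)) hh
    ((const hg.four_le 1).mod (hk.add (const hg.four_le 1)))
    (fun B hB => by
      have h4 := hg.four_le
      exact ((reg (by omega) (by omega)).mul (hg.mono (by omega))).mod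
        ((hk.mono (by omega)).add (const (by omega) 1)))
    (fun v v' hv => by simp only [hg.congr v v' hv, hk.congr v v' hv])
    (fun v _ x => x < k v + 1) (fun v _ => Nat.mod_lt _ (Nat.succ_pos _))
    (fun v _ x _ _ _ => Nat.mod_lt _ (Nat.succ_pos _))
    (fun e => by
      obtain ⟨a, ha⟩ := hk.bounded e
      exact ⟨a, fun v j x hv hb _ hx => (Nat.le_of_lt_succ hx).trans (ha v hv hb)⟩)).ext fun v => by
    rw [foldr_mul_mod, one_mul]

lemma divPow (hg : Comp.{u} β b g) (hh : Comp.{u} β b h) (hk : Comp.{u} β b k) :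
    Comp.{u} β b fun v => g v / h v ^ k v :=
  (fold (step := fun v _ x => x / h v) hk hg
    (fun B hB => (reg (by have := hg.four_le; omega) (by omega)).div (hh.mono (by omega)))
    (fun v v' hv => by simp only [hh.congr v v' hv])
    (fun v _ x => x ≤ g v) (fun v _ => le_rfl)
    (fun v _ x _ _ hx => (Nat.div_le_self _ _).trans hx)
    (fun e => by
      obtain ⟨a, ha⟩ := hg.bounded e
      exact ⟨a, fun v j x hv hb _ hx => hx.trans (ha v hv hb)⟩)).ext fun v => by
    rw [foldr_div]

lemma clog (hg : Comp.{u} β b g) : Comp.{u} β b fun v => Nat.clog 2 (g v) :=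
  (fold (step := fun v _ x => if (g v - 1) / 2 ^ x = 0 then x else x + 1) hg (const hg.four_le 0)
    (fun B hB => by
      have h4 := hg.four_le
      exact ifZero (((hg.mono (by omega)).sub (const (by omega) 1)).divPow (const (by omega) 2)
        (reg (by omega) (by omega))) (reg (by omega) (by omega))
          ((reg (by omega) (by omega)).add (const (by omega) 1)))
    (fun v v' hv => by simp only [hg.congr v v' hv])
    (fun v j x => x + j ≤ g v) (fun v _ => by simp)
    (fun v j x _ _ hx => by split_ifs <;> omega)
    (fun e => by
      obtain ⟨a, ha⟩ := hg.bounded e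
      exact ⟨a, fun v j x hv hb _ hx => le_trans (by omega) (ha v hv hb)⟩)).ext fun v => by
    have h1 : ∀ y, (g v - 1) / 2 ^ y = 0 ↔ Nat.clog 2 (g v) ≤ y := by
      intro y
      rw [Nat.div_eq_zero_iff, Nat.clog_le_iff_le_pow (by norm_num)]
      have : 0 < 2 ^ y := by positivity
      omega
    have h2 : Nat.clog 2 (g v) ≤ g v := by
      rw [Nat.clog_le_iff_le_pow (by norm_num)]
      exact Nat.lt_two_pow_self.le
    rw [foldr_count h1 0 (g v) (Nat.zero_le _), zero_add, min_eq_right h2]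

/-- Horner's scheme from the most significant digit of Q downward; while j rounds remain, the
accumulator is below B^(k-j). -/
lemma iterWeight {d N B k Q i : (ℕ → ℕ) → ℕ} (hd : Comp.{u} β b d) (hN : Comp.{u} β b N)
    (hB : Comp.{u} β b B) (hk : Comp.{u} β b k) (hQ : Comp.{u} β b Q) (hi : Comp.{u} β b i)
    (hpos : ∀ v, β.good v → 0 < N v ∧ N v ≤ B v)
    (hb : ∃ a, ∀ v, β.good v → B v ^ k v ≤ β.bound v ^ a) :
    Comp.{u} β b fun v => SumROABP.iterWeight (d v) (N v) (B v) (k v) (Q v) (i v) :=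
  (fold (step := fun v j x => B v * x + hash (d v) (Q v / N v ^ j % N v) (i v)) hk
    (const hd.four_le 0)
    (fun b' hb' => by
      have h4 := hd.four_le
      have m : ∀ {f}, Comp.{u} β b f → Comp.{u} β (b' + 2) f := fun hf => hf.mono (by omega)
      exact ((m hB).mul (reg (by omega) (by omega))).add
        (((m hd).add (const (by omega) 1)).powMod (m hi)
          (((m hQ).divPow (m hN) (reg (by omega) (by omega))).mod (m hN))))
    (fun v v' hv => by
      simp only [hB.congr v v' hv, hd.congr v v' hv, hQ.congr v v' hv, hN.congr v v' hv,
        hi.congr v v' hv])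
    (fun v j x => x < B v ^ (k v - j)) (fun v _ => by simp)
    (fun v j x hv hj hx => by
      obtain ⟨hN0, hNB⟩ := hpos v hv
      have h1 : hash (d v) (Q v / N v ^ j % N v) (i v) < B v :=
        (Nat.mod_lt _ (Nat.succ_pos _)).trans_le ((Nat.mod_lt _ hN0).trans_le hNB)
      calc B v * x + hash (d v) (Q v / N v ^ j % N v) (i v) < B v * (x + 1) := by
            rw [mul_add, mul_one]; omega
        _ ≤ B v * B v ^ (k v - (j + 1)) := Nat.mul_le_mul_left _ hx
        _ = B v ^ (k v - j) := by
            rw [← pow_succ']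
            congr 1
            omega)
    (fun e => by
      obtain ⟨a, ha⟩ := hb
      refine ⟨a, fun v j x hv _ _ hx => hx.le.trans (le_trans ?_ (ha v hv))⟩
      obtain ⟨hN0, hNB⟩ := hpos v hv
      exact Nat.pow_le_pow_right (by omega) (Nat.sub_le _ _))).ext fun v => by
    rw [foldr_iterWeight]

end Comp

/-! ### Programs acting on the field registers and the output -/

/-- The contents of the field registers and the output. -/
abbrev Mem (F : Type*) := (ℕ → F) × List F

/-- Transformations of the field registers and the output that depend on the supply of field
elements and on the registers for natural numbers. -/
abbrev Action := (F : Type u) → [Field F] → (ℕ → F) → (ℕ → ℕ) → Mem F → Mem F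

/-- The transformation `φ`, which depends only on the registers for natural numbers below `b`, can be
carried out, without changing the registers below any given `B ≥ b`, in a number of steps that is
polynomial in the budget. -/
structure Act (β : Budget) (b : ℕ) (φ : Action.{u}) : Prop where
  four_le : 4 ≤ b
  congr : ∀ (F : Type u) [Field F] (α : ℕ → F) (v v' : ℕ → ℕ), (∀ i < b, v' i = v i) →
    φ F α v' = φ F α v
  prog : ∀ B, b ≤ B → ∃ p : Prog, ∀ e, ∃ a, ∀ (F : Type u) [Field F] (α : ℕ → F) (s : State F),
    β.good s.nat → (∀ i < B, s.nat i ≤ β.bound s.nat ^ e) →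
    ∃ t s', Runs α p s t s' ∧ t ≤ β.bound s.nat ^ a ∧
      (s'.fld, s'.out) = φ F α s.nat (s.fld, s.out) ∧ ∀ i < B, s'.nat i = s.nat i

namespace Act

variable {β : Budget} {b : ℕ} {φ ψ : Action.{u}}

lemma ofInstr (hb : 4 ≤ b) (ins : Instr) (φ : (F : Type u) → [Field F] → Mem F → Mem F)
    (hins : ∀ (F : Type u) [Field F] (α : ℕ → F) (s : State F), (ins.exec α s).nat = s.nat ∧
      ((ins.exec α s).fld, (ins.exec α s).out) = φ F (s.fld, s.out)) :
    Act.{u} β b fun F _ _ _ m => φ F m where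
  four_le := hb
  congr _ _ _ _ _ _ := rfl
  prog _ _ := ⟨.instr ins, fun _ => ⟨0, fun F _ α s _ _ => ⟨1, _, .instr ins s, by simp,
    (hins F α s).2, fun i _ => congrFun (hins F α s).1 i⟩⟩⟩

lemma elem (i : ℕ) {g : (ℕ → ℕ) → ℕ} (hg : Comp.{u} β b g) :
    Act.{u} β b fun _ _ α v m => (Function.update m.1 i (α (g v)), m.2) where
  four_le := hg.four_le
  congr F _ α v v' hv := by rw [hg.congr v v' hv]
  prog B hB := by
    obtain ⟨p, hp⟩ := hg.prog B hB
    refine ⟨.seq p (.instr (.fldElem i B)), fun e => ?_⟩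
    obtain ⟨a, ha⟩ := hp e
    refine ⟨a + 1 + 1, fun F _ α s hs hsb => ?_⟩
    obtain ⟨t, s', hr, ht, hf, ho, hv, hn⟩ := ha F α s hs hsb
    refine ⟨t + 1, _, .seq hr (.instr _ _), pow_bound_add (β.two_le hs) ht
      (pow_bound_const (β.two_le hs) 1), ?_, hn⟩
    simp [Instr.exec, State.setFld, hf, ho, hv]

lemma seq (hφ : Act.{u} β b φ) (hψ : Act.{u} β b ψ) :
    Act.{u} β b fun F _ α v m => ψ F α v (φ F α v m) where
  four_le := hφ.four_le
  congr F _ α v v' hv := by rw [hφ.congr F α v v' hv, hψ.congr F α v v' hv]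
  prog B hB := by
    obtain ⟨p, hp⟩ := hφ.prog B hB
    obtain ⟨q, hq⟩ := hψ.prog B hB
    refine ⟨.seq p q, fun e => ?_⟩
    obtain ⟨tp, htp⟩ := hp e
    obtain ⟨tq, htq⟩ := hq e
    refine ⟨tp + tq + 1, fun F _ α s hs hsb => ?_⟩
    have h4 := hφ.four_le
    obtain ⟨t₁, s₁, hr₁, ht₁, hm₁, hn₁⟩ := htp F α s hs hsb
    have hn4 : ∀ i < 4, s₁.nat i = s.nat i := fun i hi => hn₁ i (by omega)
    have hb₁ := β.bound_congr hn4
    obtain ⟨t₂, s₂, hr₂, ht₂, hm₂, hn₂⟩ := htq F α s₁ (β.good_congr hn4 hs) (fun i hi => by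
      rw [hb₁, hn₁ i hi]; exact hsb i hi)
    rw [hb₁] at ht₂
    refine ⟨t₁ + t₂, s₂, .seq hr₁ hr₂, pow_bound_add (β.two_le hs) ht₁ ht₂, ?_,
      fun i hi => (hn₂ i hi).trans (hn₁ i hi)⟩
    rw [hm₂, hm₁, hψ.congr F α s.nat s₁.nat fun i hi => hn₁ i (by omega)]

lemma ifZero {k : (ℕ → ℕ) → ℕ} (hk : Comp.{u} β b k) (hφ : Act.{u} β b φ) :
    Act.{u} β b fun F _ α v m => if k v = 0 then φ F α v m else m where
  four_le := hφ.four_le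
  congr F _ α v v' hv := by rw [hφ.congr F α v v' hv, hk.congr v v' hv]
  prog B hB := by
    obtain ⟨r, hr⟩ := hk.prog B hB
    obtain ⟨p, hp⟩ := hφ.prog B hB
    refine ⟨.seq r (.ifNatZero B p (.instr (.natConst B 0))), fun e => ?_⟩
    obtain ⟨tr, htr⟩ := hr e
    obtain ⟨tp, htp⟩ := hp e
    refine ⟨tr + tp + 2, fun F _ α s hs hsb => ?_⟩
    have h2 := β.two_le hs
    have h4 := hφ.four_le
    obtain ⟨t₁, s₁, hr₁, ht₁, hf₁, ho₁, hv₁, hn₁⟩ := htr F α s hs hsb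
    have hn4 : ∀ i < 4, s₁.nat i = s.nat i := fun i hi => hn₁ i (by omega)
    have hb₁ := β.bound_congr hn4
    split_ifs with hz
    · obtain ⟨t₂, s₂, hr₂, ht₂, hm₂, hn₂⟩ := htp F α s₁ (β.good_congr hn4 hs) (fun i hi => by
        rw [hb₁, hn₁ i hi]; exact hsb i hi)
      rw [hb₁] at ht₂
      refine ⟨t₁ + (t₂ + 1), _, .seq hr₁ (.ifNatZero_true (hv₁.trans hz) hr₂),
        pow_bound_add_one h2 ht₁ ht₂, ?_, fun i hi => (hn₂ i hi).trans (hn₁ i hi)⟩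
      rw [hm₂, hf₁, ho₁, hφ.congr F α s.nat s₁.nat fun i hi => hn₁ i (by omega)]
    · refine ⟨t₁ + (1 + 1), _, .seq hr₁ (.ifNatZero_false (hv₁.trans_ne hz) (.instr _ _)),
        pow_bound_add_one h2 ht₁ (Nat.one_le_pow _ _ (by omega)), ?_, fun i hi => ?_⟩
      · simp [Instr.exec, State.setNat, hf₁, ho₁]
      · simp [Instr.exec, State.setNat, hi.ne, hn₁ i hi]

/-- Loops; the loop variable runs downwards. -/
lemma loop {k : (ℕ → ℕ) → ℕ}
    {body : (F : Type u) → [Field F] → (ℕ → F) → (ℕ → ℕ) → ℕ → Mem F → Mem F}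
    (hk : Comp.{u} β b k)
    (hbody : ∀ B, b ≤ B → Act.{u} β (B + 1) fun F _ α v m => body F α v (v B) m)
    (hcongr : ∀ (F : Type u) [Field F] (α : ℕ → F) (v v' : ℕ → ℕ), (∀ i < b, v' i = v i) →
      body F α v' = body F α v) :
    Act.{u} β b fun F _ α v m => (List.range (k v)).foldr (body F α v) m where
  four_le := hk.four_le
  congr F _ α v v' hv := by rw [hk.congr v v' hv, hcongr F α v v' hv]
  prog B hB := by
    have h4 := hk.four_le
    obtain ⟨q, hq⟩ := hk.prog B hB
    obtain ⟨r, hr⟩ := (hbody B hB).prog (B + 1) le_rfl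
    let code : Prog := .seq (.instr (.natConst (B + 1) 1)) (.seq
      (.instr (.natSub B B (B + 1))) r)
    refine ⟨.seq q (.loop B code), fun e => ?_⟩
    obtain ⟨ak, hak⟩ := hk.bounded e
    obtain ⟨tq, htq⟩ := hq e
    -- Only the counter needs a bound here: field registers and output do not enter the time
    -- estimate.
    obtain ⟨tr, htr⟩ := hr (e + ak)
    refine ⟨tq + (ak + (tr + 3 + 1)) + 2, fun F _ α s hs hsb => ?_⟩
    have h2 := β.two_le hs
    obtain ⟨t₂, s₂, hr₂, ht₂, hf₂, ho₂, hv₂, hn₂⟩ := htq F α s hs hsb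
    have hloop : ∀ j ≤ k s.nat, ∀ (s' : State F), s'.nat B = j → (∀ i < B, s'.nat i = s.nat i) →
        ∃ t s'', Runs α (.loop B code) s' t s'' ∧
          t ≤ j * (β.bound s.nat ^ tr + 3) + 1 ∧
          (s''.fld, s''.out) = (List.range j).foldr (body F α s.nat) (s'.fld, s'.out) ∧
          ∀ i < B, s''.nat i = s.nat i := by
      intro j
      induction j with
      | zero =>
        intro _ s' hj hn
        exact ⟨1, s', .loop_done hj, by omega, rfl, hn⟩
      | succ j ih =>
        intro hjk s' hj hn
        let s₃ := (s'.setNat (B + 1) 1).setNat B j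
        have e₃ : (Instr.natSub B B (B + 1)).exec α
            ((Instr.natConst (B + 1) 1).exec α s') = s₃ := by
          simp [Instr.exec, State.setNat, s₃, hj]
        have n₃ : ∀ i < B, s₃.nat i = s.nat i := fun i hi => by
          have h2 : i ≠ B + 1 := by omega
          simp [s₃, State.setNat, hi.ne, h2, hn i hi]
        have n₃B : s₃.nat B = j := by simp [s₃, State.setNat]
        have n₃4 : ∀ i < 4, s₃.nat i = s.nat i := fun i hi => n₃ i (by omega)
        have b₃ := β.bound_congr n₃4
        obtain ⟨t, s₄, hr₄, ht₄, hm₄, hn₄⟩ := htr F α s₃ (β.good_congr n₃4 hs) (by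
          intro i hi
          rw [b₃]
          rcases Nat.lt_or_ge i B with h | h
          · rw [n₃ i h]
            exact pow_bound_mono h2 (hsb i h) (by omega)
          · obtain rfl : i = B := by omega
            rw [n₃B]
            exact pow_bound_mono h2 (le_trans (by omega) (hak _ hs fun i hi => hsb i (by omega)))
              (show ak ≤ _ by omega))
        rw [b₃] at ht₄
        rw [n₃B, hcongr F α s.nat s₃.nat fun i hi => n₃ i (by omega)] at hm₄
        obtain ⟨t', s₆, hr₆, ht₆, hm₆, hn₆⟩ := ih (by omega) s₄
          (by rw [hn₄ B (by omega), n₃B]) (fun i hi => by rw [hn₄ i (by omega), n₃ i hi])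
        refine ⟨1 + (1 + t) + t' + 1, s₆, .loop_step (by omega)
          (.seq (.instr _ _) (.seq (e₃ ▸ .instr _ _) hr₄)) hr₆, ?_, ?_, hn₆⟩
        · rw [Nat.succ_mul]; omega
        · rw [hm₆, hm₄, foldr_range_succ]
          rfl
    obtain ⟨t₃, s₃, hr₃, ht₃, hm₃, hn₃⟩ := hloop _ le_rfl s₂ hv₂ hn₂
    refine ⟨t₂ + t₃, s₃, .seq hr₂ hr₃, le_trans (Nat.add_le_add_left ht₃ _)
      (pow_bound_add_one h2 ht₂ (pow_bound_mul (hak _ hs fun i hi => hsb i (by omega)) ?_)), ?_, hn₃⟩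
    · exact pow_bound_add h2 le_rfl (pow_bound_const h2 3)
    · rw [hm₃, hf₂, ho₂]

end Act

end SumROABP

namespace SumROABP

open Polynomial

universe u

/-! ### The parameters of the construction -/

/-- The number of hash functions. -/
def hashRange (n d w c : ℕ) : ℕ := 2 * (d * n * (n * bigWidth d w c ^ 8) + 1)

/-- The base in which the weights of the successive rounds are combined. -/
def weightBase (n d w c : ℕ) : ℕ := n * d * hashRange n d w c + 1

/-- The number of places at which the shift is adic to a weight function. -/
def numPlaces (n d w c : ℕ) : ℕ := hashRange n d w c ^ Nat.clog 2 n

/-- A bound for the weights. -/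
def maxWeight (n d w c : ℕ) : ℕ := weightBase n d w c ^ Nat.clog 2 n

/-- The number of values substituted for `t`. -/
def numValues (n d w c : ℕ) : ℕ := n * d * (numPlaces n d w c * maxWeight n d w c) + 1

/-- The number of codes for low-support points. -/
def numCodes (n d w c : ℕ) : ℕ := (n * (d + 1)) ^ (supportBound d w c - 1)

/-! ### Bounds for the parameters as powers of s -/

section Bounds

variable {n d w c : ℕ}

lemma two_le_paramSize (n d w : ℕ) : 2 ≤ paramSize n d w := le_max_left _ _

lemma one_le_log_paramSize (n d w : ℕ) : 1 ≤ Nat.log 2 (paramSize n d w) :=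
  Nat.le_log_of_pow_le (by norm_num) (by simpa using two_le_paramSize n d w)

lemma le_paramSize (hn : 1 ≤ n) (hd : 1 ≤ d) (hw : 1 ≤ w) :
    n ≤ paramSize n d w ∧ d ≤ paramSize n d w ∧ w ≤ paramSize n d w := by
  have h : n * d * w ≤ paramSize n d w := le_max_right _ _
  have h1 : 1 ≤ n * d := Nat.mul_pos hn hd
  refine ⟨le_trans ?_ h, le_trans ?_ h, le_trans (Nat.le_mul_of_pos_left _ h1) h⟩
  · exact (Nat.le_mul_of_pos_right _ hd).trans (Nat.le_mul_of_pos_right _ hw)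
  · exact (Nat.le_mul_of_pos_left _ hn).trans (Nat.le_mul_of_pos_right _ hw)

lemma two_le_two_pow (hc : 1 ≤ c) : 2 ≤ 2 ^ c := Nat.le_self_pow (by omega) 2

lemma paramSize_le_two_pow (n d w : ℕ) :
    paramSize n d w ≤ 2 ^ (2 * Nat.log 2 (paramSize n d w)) := by
  have h1 := one_le_log_paramSize n d w
  exact (Nat.lt_pow_succ_log_self (by norm_num) _).le.trans
    (Nat.pow_le_pow_right (by norm_num) (by omega))

lemma bigWidth_le (hn : 1 ≤ n) (hd : 1 ≤ d) (hw : 1 ≤ w) (hc : 1 ≤ c) :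
    bigWidth d w c ≤ paramSize n d w ^ (2 * 2 ^ c) := by
  obtain ⟨_, hds, hws⟩ := le_paramSize hn hd hw
  have h2 := two_le_paramSize n d w
  have hq := two_le_two_pow hc
  set s := paramSize n d w
  have e1 : 2 * 2 ^ (c - 1) = 2 ^ c := by rw [← pow_succ']; congr 1; omega
  calc bigWidth d w c ≤ s ^ 2 * (s ^ 2) ^ 2 ^ (c - 1) := by
        unfold bigWidth
        gcongr <;> nlinarith
    _ = s ^ (2 + 2 ^ c) := by rw [← pow_mul, e1, pow_add]
    _ ≤ s ^ (2 * 2 ^ c) := Nat.pow_le_pow_right (by omega) (by omega)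

/-- The factors d, n, n and W⁸ give the exponent 3 + 16·2^c, the constants at most two more, and 5 ≤
3·2^c. -/
lemma hashRange_le (hn : 1 ≤ n) (hd : 1 ≤ d) (hw : 1 ≤ w) (hc : 1 ≤ c) :
    hashRange n d w c ≤ paramSize n d w ^ (19 * 2 ^ c) := by
  obtain ⟨hns, hds, hws⟩ := le_paramSize hn hd hw
  have h2 := two_le_paramSize n d w
  have hq := two_le_two_pow hc
  have hW := bigWidth_le hn hd hw hc
  set s := paramSize n d w
  have h8 : bigWidth d w c ^ 8 ≤ s ^ (16 * 2 ^ c) :=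
    (Nat.pow_le_pow_left hW 8).trans_eq (by rw [← pow_mul]; congr 1; ring)
  have h3 : d * n * (n * bigWidth d w c ^ 8) ≤ s ^ (3 + 16 * 2 ^ c) := by
    calc _ ≤ s * s * (s * s ^ (16 * 2 ^ c)) := by gcongr
      _ = s ^ (3 + 16 * 2 ^ c) := by ring
  have h1 : 1 ≤ s ^ (3 + 16 * 2 ^ c) := Nat.one_le_pow _ _ (by omega)
  calc hashRange n d w c ≤ 2 * 2 * s ^ (3 + 16 * 2 ^ c) := by unfold hashRange; omega
    _ ≤ s * s * s ^ (3 + 16 * 2 ^ c) := by gcongr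
    _ = s ^ (5 + 16 * 2 ^ c) := by ring
    _ ≤ s ^ (19 * 2 ^ c) := Nat.pow_le_pow_right (by omega) (by omega)

lemma weightBase_le (hn : 1 ≤ n) (hd : 1 ≤ d) (hw : 1 ≤ w) (hc : 1 ≤ c) :
    weightBase n d w c ≤ paramSize n d w ^ (21 * 2 ^ c) := by
  obtain ⟨hns, hds, hws⟩ := le_paramSize hn hd hw
  have h2 := two_le_paramSize n d w
  have hq := two_le_two_pow hc
  have hN := hashRange_le hn hd hw hc
  set s := paramSize n d w
  have h3 : n * d * hashRange n d w c ≤ s ^ (2 + 19 * 2 ^ c) := by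
    calc _ ≤ s * s * s ^ (19 * 2 ^ c) := by gcongr
      _ = s ^ (2 + 19 * 2 ^ c) := by ring
  have h1 : 1 ≤ s ^ (2 + 19 * 2 ^ c) := Nat.one_le_pow _ _ (by omega)
  calc weightBase n d w c ≤ 2 * s ^ (2 + 19 * 2 ^ c) := by unfold weightBase; omega
    _ ≤ s * s ^ (2 + 19 * 2 ^ c) := by gcongr
    _ = s ^ (3 + 19 * 2 ^ c) := by ring
    _ ≤ s ^ (21 * 2 ^ c) := Nat.pow_le_pow_right (by omega) (by omega)

lemma clog_le (hn : 1 ≤ n) (hd : 1 ≤ d) (hw : 1 ≤ w) :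
    Nat.clog 2 n ≤ 2 * Nat.log 2 (paramSize n d w) := by
  rw [Nat.clog_le_iff_le_pow (by norm_num)]
  exact (le_paramSize hn hd hw).1.trans (paramSize_le_two_pow n d w)

lemma numPlaces_le (hn : 1 ≤ n) (hd : 1 ≤ d) (hw : 1 ≤ w) (hc : 1 ≤ c) :
    numPlaces n d w c ≤ paramSize n d w ^ (38 * (2 ^ c * Nat.log 2 (paramSize n d w))) := by
  have h2 := two_le_paramSize n d w
  calc numPlaces n d w c
      ≤ (paramSize n d w ^ (19 * 2 ^ c)) ^ Nat.clog 2 n :=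
        Nat.pow_le_pow_left (hashRange_le hn hd hw hc) _
    _ ≤ (paramSize n d w ^ (19 * 2 ^ c)) ^ (2 * Nat.log 2 (paramSize n d w)) :=
        Nat.pow_le_pow_right (Nat.pow_pos (by omega)) (clog_le hn hd hw)
    _ = _ := by rw [← pow_mul]; congr 1; ring

lemma maxWeight_le (hn : 1 ≤ n) (hd : 1 ≤ d) (hw : 1 ≤ w) (hc : 1 ≤ c) :
    maxWeight n d w c ≤ paramSize n d w ^ (42 * (2 ^ c * Nat.log 2 (paramSize n d w))) := by
  have h2 := two_le_paramSize n d w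
  calc maxWeight n d w c
      ≤ (paramSize n d w ^ (21 * 2 ^ c)) ^ Nat.clog 2 n :=
        Nat.pow_le_pow_left (weightBase_le hn hd hw hc) _
    _ ≤ (paramSize n d w ^ (21 * 2 ^ c)) ^ (2 * Nat.log 2 (paramSize n d w)) :=
        Nat.pow_le_pow_right (Nat.pow_pos (by omega)) (clog_le hn hd hw)
    _ = _ := by rw [← pow_mul]; congr 1; ring

lemma two_le_exponent (n d w : ℕ) (hc : 1 ≤ c) : 2 ≤ 2 ^ c * Nat.log 2 (paramSize n d w) :=
  (two_le_two_pow hc).trans (Nat.le_mul_of_pos_right _ (one_le_log_paramSize n d w))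

lemma numValues_le (hn : 1 ≤ n) (hd : 1 ≤ d) (hw : 1 ≤ w) (hc : 1 ≤ c) :
    numValues n d w c ≤ paramSize n d w ^ (82 * (2 ^ c * Nat.log 2 (paramSize n d w))) := by
  obtain ⟨hns, hds, hws⟩ := le_paramSize hn hd hw
  have h2 := two_le_paramSize n d w
  have hE := two_le_exponent n d w hc
  have hp := numPlaces_le hn hd hw hc
  have hm := maxWeight_le hn hd hw hc
  set s := paramSize n d w
  set E := 2 ^ c * Nat.log 2 s
  have h3 : n * d * (numPlaces n d w c * maxWeight n d w c) ≤ s ^ (2 + 80 * E) := by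
    calc _ ≤ s * s * (s ^ (38 * E) * s ^ (42 * E)) := by gcongr
      _ = s ^ (2 + 80 * E) := by ring
  have h1 : 1 ≤ s ^ (2 + 80 * E) := Nat.one_le_pow _ _ (by omega)
  calc numValues n d w c ≤ 2 * s ^ (2 + 80 * E) := by unfold numValues; omega
    _ ≤ s * s ^ (2 + 80 * E) := by gcongr
    _ = s ^ (3 + 80 * E) := by ring
    _ ≤ s ^ (82 * E) := Nat.pow_le_pow_right (by omega) (by omega)

/-- From s ≤ 2^(2⌊log₂ s⌋) one gets W² ≤ 2^(8E) with E = 2^c ⌊log₂ s⌋; adding 1 costs at most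
another factor of 2. -/
lemma supportBound_le (hn : 1 ≤ n) (hd : 1 ≤ d) (hw : 1 ≤ w) (hc : 1 ≤ c) :
    supportBound d w c ≤ c * (9 * (2 ^ c * Nat.log 2 (paramSize n d w))) := by
  have hE := two_le_exponent n d w hc
  have hW := bigWidth_le hn hd hw hc
  have hs := paramSize_le_two_pow n d w
  set s := paramSize n d w
  refine Nat.mul_le_mul_left _ ?_
  rw [Nat.clog_le_iff_le_pow (by norm_num)]
  have h1 : bigWidth d w c ^ 2 ≤ 2 ^ (8 * (2 ^ c * Nat.log 2 s)) := by
    calc _ ≤ ((2 ^ (2 * Nat.log 2 s)) ^ (2 * 2 ^ c)) ^ 2 := by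
          exact Nat.pow_le_pow_left (hW.trans (Nat.pow_le_pow_left hs _)) _
      _ = _ := by rw [← pow_mul, ← pow_mul]; congr 1; ring
  have h2 : 1 ≤ 2 ^ (8 * (2 ^ c * Nat.log 2 s)) := Nat.one_le_two_pow
  calc _ ≤ 2 * 2 ^ (8 * (2 ^ c * Nat.log 2 s)) := by omega
    _ = 2 ^ (8 * (2 ^ c * Nat.log 2 s) + 1) := by ring
    _ ≤ _ := Nat.pow_le_pow_right (by norm_num) (by omega)

/-- Here n(d+1) ≤ s³ is raised to a support bound of at most 9cE. The factor c of the support bound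
is the reason for the factor c in the exponent of the running time. -/
lemma numCodes_le (hn : 1 ≤ n) (hd : 1 ≤ d) (hw : 1 ≤ w) (hc : 1 ≤ c) :
    numCodes n d w c ≤
      paramSize n d w ^ (27 * (c * 2 ^ c * Nat.log 2 (paramSize n d w))) := by
  obtain ⟨hns, hds, hws⟩ := le_paramSize hn hd hw
  have h2 := two_le_paramSize n d w
  have hl := supportBound_le hn hd hw hc
  set s := paramSize n d w
  calc numCodes n d w c ≤ (s ^ 3) ^ (supportBound d w c - 1) := by
        refine Nat.pow_le_pow_left ?_ _
        calc n * (d + 1) ≤ s * (s * s) := by gcongr; nlinarith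
          _ = s ^ 3 := by ring
    _ ≤ (s ^ 3) ^ (c * (9 * (2 ^ c * Nat.log 2 s))) :=
        Nat.pow_le_pow_right (Nat.pow_pos (by omega)) (by omega)
    _ = _ := by rw [← pow_mul]; congr 1; ring

end Bounds

/-- Running times are measured in powers of `s ^ (c 2 ^ c ⌊log₂ s⌋)`. -/
def budget : Budget where
  good v := 1 ≤ v 0 ∧ 1 ≤ v 1 ∧ 1 ≤ v 2 ∧ 1 ≤ v 3
  bound v := paramSize (v 0) (v 1) (v 2) ^
    (v 3 * 2 ^ v 3 * Nat.log 2 (paramSize (v 0) (v 1) (v 2)))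
  good_congr h := by
    rw [h 0 (by norm_num), h 1 (by norm_num), h 2 (by norm_num), h 3 (by norm_num)]
    exact id
  bound_congr h := by
    rw [h 0 (by norm_num), h 1 (by norm_num), h 2 (by norm_num), h 3 (by norm_num)]
  two_le {v} h := by
    refine (two_le_paramSize (v 0) (v 1) (v 2)).trans (Nat.le_self_pow ?_ _)
    have := one_le_log_paramSize (v 0) (v 1) (v 2)
    have := h.2.2.2
    positivity

/-- The budget has the additional factor c ≥ 1 in its exponent, so it absorbs the bounds stated
without it. -/
lemma le_bound_pow {v : ℕ → ℕ} (hv : budget.good v) {m a : ℕ}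
    (h : m ≤ paramSize (v 0) (v 1) (v 2) ^
      (a * (2 ^ v 3 * Nat.log 2 (paramSize (v 0) (v 1) (v 2))))) : m ≤ budget.bound v ^ a := by
  have h2 := two_le_paramSize (v 0) (v 1) (v 2)
  refine h.trans ?_
  simp only [budget]
  rw [← pow_mul]
  refine Nat.pow_le_pow_right (by omega) ?_
  rw [mul_comm a, mul_assoc (v 3)]
  exact Nat.mul_le_mul_right _ (Nat.le_mul_of_pos_left _ hv.2.2.2)

/-! ### Computing the parameters within the budget -/

namespace Comp

variable {b : ℕ}

lemma bigWidth (hb : 4 ≤ b) : Comp.{u} budget b fun v => bigWidth (v 1) (v 2) (v 3) := by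
  refine ((reg hb (by omega)).add (const hb 1)).mul (pow ((const hb 2).mul (reg hb (by omega)))
    (pow (const hb 2) ((reg hb (by omega)).sub (const hb 1)) (fun _ _ => by norm_num) ?_)
    (fun v hv => by have := hv.2.2.1; omega) ?_)
  · refine ⟨1, fun v hv => le_bound_pow hv ?_⟩
    have h1 := one_le_log_paramSize (v 0) (v 1) (v 2)
    calc 2 ^ (v 3 - 1) ≤ 2 ^ (1 * (2 ^ v 3 * Nat.log 2 (paramSize (v 0) (v 1) (v 2)))) := by
          refine Nat.pow_le_pow_right (by norm_num) ?_
          have h2 : v 3 < 2 ^ v 3 := Nat.lt_two_pow_self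
          have h3 := Nat.le_mul_of_pos_right (2 ^ v 3) h1
          omega
      _ ≤ _ := Nat.pow_le_pow_left (two_le_paramSize _ _ _) _
  · refine ⟨2, fun v hv => le_bound_pow hv ?_⟩
    have h1 := one_le_log_paramSize (v 0) (v 1) (v 2)
    have h2 := two_le_paramSize (v 0) (v 1) (v 2)
    refine le_trans (Nat.le_mul_of_pos_left _ (Nat.succ_pos (v 1)))
      ((bigWidth_le hv.1 hv.2.1 hv.2.2.1 hv.2.2.2).trans (Nat.pow_le_pow_right (by omega) ?_))
    exact Nat.mul_le_mul_left _ (Nat.le_mul_of_pos_right _ h1)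

lemma hashRange (hb : 4 ≤ b) : Comp.{u} budget b fun v => hashRange (v 0) (v 1) (v 2) (v 3) := by
  have hW := bigWidth.{u} hb
  have hW2 := hW.mul hW
  have hW4 := hW2.mul hW2
  refine ((const hb 2).mul ((((reg hb (i := 1) (by omega)).mul (reg hb (i := 0) (by omega))).mul
    ((reg hb (i := 0) (by omega)).mul (hW4.mul hW4))).add (const hb 1))).ext fun v => ?_
  unfold SumROABP.hashRange
  ring

lemma weightBase (hb : 4 ≤ b) : Comp.{u} budget b fun v => weightBase (v 0) (v 1) (v 2) (v 3) :=
  (((reg hb (by omega)).mul (reg hb (by omega))).mul (hashRange hb)).add (const hb 1)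

lemma hashRange_pos (v : ℕ → ℕ) : 0 < SumROABP.hashRange (v 0) (v 1) (v 2) (v 3) := by
  unfold SumROABP.hashRange
  omega

lemma numPlaces (hb : 4 ≤ b) : Comp.{u} budget b fun v => numPlaces (v 0) (v 1) (v 2) (v 3) :=
  pow (hashRange hb) (clog (reg hb (by omega))) (fun v _ => hashRange_pos v)
    ⟨_, fun _ hv => le_bound_pow hv (numPlaces_le hv.1 hv.2.1 hv.2.2.1 hv.2.2.2)⟩

lemma maxWeight (hb : 4 ≤ b) : Comp.{u} budget b fun v => maxWeight (v 0) (v 1) (v 2) (v 3) :=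
  pow (weightBase hb) (clog (reg hb (by omega))) (fun _ _ => Nat.succ_pos _)
    ⟨_, fun _ hv => le_bound_pow hv (maxWeight_le hv.1 hv.2.1 hv.2.2.1 hv.2.2.2)⟩

lemma numValues (hb : 4 ≤ b) : Comp.{u} budget b fun v => numValues (v 0) (v 1) (v 2) (v 3) :=
  (((reg hb (by omega)).mul (reg hb (by omega))).mul ((numPlaces hb).mul (maxWeight hb))).add
    (const hb 1)

lemma supportBound (hb : 4 ≤ b) : Comp.{u} budget b fun v => supportBound (v 1) (v 2) (v 3) :=
  ((reg hb (i := 3) (by omega)).mul (clog (((bigWidth hb).mul (bigWidth hb)).add (const hb 1)))).ext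
    fun v => by rw [SumROABP.supportBound, sq]

lemma numCodes (hb : 4 ≤ b) : Comp.{u} budget b fun v => numCodes (v 0) (v 1) (v 2) (v 3) :=
  pow ((reg hb (by omega)).mul ((reg hb (by omega)).add (const hb 1)))
    ((supportBound hb).sub (const hb 1)) (fun v hv => Nat.mul_pos hv.1 (Nat.succ_pos _))
    ⟨27, fun v hv => (numCodes_le hv.1 hv.2.1 hv.2.2.1 hv.2.2.2).trans_eq (by
      simp only [budget]
      rw [← pow_mul]
      congr 1
      ring)⟩

end Comp

end SumROABP

namespace SumROABP

open Polynomial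

universe u

/-! ### Decoding low-support points -/

section Decode

/-- The coordinate addressed by the `r`-th digit of `E`. -/
def codeIndex (n d E r : ℕ) : ℕ := E / (n * (d + 1)) ^ r % n

/-- The value selected by the `r`-th digit of `E`. -/
def codeValue (n d E r : ℕ) : ℕ := E / (n * (d + 1)) ^ r / n % (d + 1)

lemma exists_digits {D : ℕ} (x : ℕ → ℕ) (hx : ∀ r, x r < D) (m : ℕ) :
    ∃ E < D ^ m, ∀ r < m, E / D ^ r % D = x r := by
  induction m generalizing x with
  | zero => exact ⟨0, by simp, by simp⟩
  | succ m ih =>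
    obtain ⟨E, hE, hdig⟩ := ih (fun r => x (r + 1)) fun r => hx _
    have hD : 0 < D := (Nat.zero_le _).trans_lt (hx 0)
    refine ⟨D * E + x 0, ?_, fun r hr => ?_⟩
    · calc D * E + x 0 < D * (E + 1) := by have := hx 0; rw [mul_add]; omega
        _ ≤ D * D ^ m := Nat.mul_le_mul_left _ hE
        _ = D ^ (m + 1) := by ring
    · rcases r with _ | r
      · rw [pow_zero, Nat.div_one, Nat.mul_add_mod, Nat.mod_eq_of_lt (hx 0)]
      · rw [pow_succ', ← Nat.div_div_eq_div_mul, Nat.mul_add_div hD, Nat.div_eq_of_lt (hx 0),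
          add_zero]
        exact hdig r (by omega)

variable {F : Type*} [Field F]

/-- The `i`-th coordinate of the low-support point with code `E`. -/
def codeCoord (α : ℕ → F) (n d m E i : ℕ) : F :=
  (List.range m).foldr
    (fun r x => if codeIndex n d E r = i then α (codeValue n d E r) - α 0 else x) 0

/-- Several digits may address one coordinate and overwrite each other; it only matters that the
result comes from one of them. -/
lemma foldr_ite_cases {γ : Type*} (P : ℕ → Prop) [DecidablePred P] (y : ℕ → γ) (x : γ) (m : ℕ) :
    ((∃ r < m, P r ∧ (List.range m).foldr (fun r z => if P r then y r else z) x = y r) ∨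
      ((∀ r < m, ¬ P r) ∧ (List.range m).foldr (fun r z => if P r then y r else z) x = x)) := by
  induction m generalizing x with
  | zero => right; simp
  | succ m ih =>
    rw [foldr_range_succ]
    rcases ih (if P m then y m else x) with ⟨r, hr, hP, he⟩ | ⟨hno, he⟩
    · exact Or.inl ⟨r, by omega, hP, he⟩
    · rw [he]
      by_cases hm : P m
      · exact Or.inl ⟨m, by omega, hm, by simp [hm]⟩
      · refine Or.inr ⟨fun r hr => ?_, by simp [hm]⟩
        obtain h | rfl : r < m ∨ r = m := by omega
        · exact hno r h
        · exact hm

/-- The points of low support with coordinates in `{α j - α 0 | j ≤ d}` are those with a code. -/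
lemma lowSupport_iff_exists_code (α : ℕ → F) {n d ℓ : ℕ} (hn : 1 ≤ n) (hℓ : 1 ≤ ℓ)
    (h : Fin n → F) :
    ((∀ i, h i = 0 ∨ ∃ j : Fin d, h i = α (j + 1) - α 0) ∧ {i | h i ≠ 0}.ncard < ℓ) ↔
      ∃ E < (n * (d + 1)) ^ (ℓ - 1), ∀ i : Fin n, h i = codeCoord α n d (ℓ - 1) E i := by
  classical
  constructor
  · rintro ⟨hval, hcard⟩
    have hJ : ∀ i, ∃ j < d + 1, h i = α j - α 0 := by
      intro i
      rcases hval i with h0 | ⟨j, hj⟩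
      · exact ⟨0, by omega, by simp [h0]⟩
      · exact ⟨j + 1, by omega, hj⟩
    choose J hJlt hJ using hJ
    let S : Finset (Fin n) := Finset.univ.filter fun i => h i ≠ 0
    have hS : S.card ≤ ℓ - 1 := by
      have : {i | h i ≠ 0} = (S : Set (Fin n)) := by ext i; simp [S]
      rw [this, Set.ncard_coe_finset] at hcard
      omega
    -- Digits beyond the support address coordinate 0. This is harmless, since they assign to it the
    -- value it has anyway.
    let g : ℕ → Fin n := fun r => S.toList.getD r ⟨0, hn⟩
    have hg : ∀ i, h i ≠ 0 → ∃ r < ℓ - 1, g r = i := by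
      intro i hi
      have : i ∈ S.toList := by simpa [S] using hi
      obtain ⟨r, hr, hri⟩ := List.getElem_of_mem this
      have hlen : S.toList.length = S.card := Finset.length_toList S
      exact ⟨r, by omega, by simp only [g]; rw [List.getD_eq_getElem _ _ hr, hri]⟩
    obtain ⟨E, hE, hdig⟩ := exists_digits (D := n * (d + 1))
      -- A digit in base n(d+1) packs a coordinate, modulo n, and the index of its value, as the
      -- quotient by n.
      (fun r => g r + n * J (g r)) (fun r => by
        calc (g r : ℕ) + n * J (g r) < n + n * J (g r) := by have := (g r).2; omega
          _ = n * (J (g r) + 1) := by ring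
          _ ≤ n * (d + 1) := Nat.mul_le_mul_left _ (hJlt _)) (ℓ - 1)
    have hidx : ∀ r < ℓ - 1, codeIndex n d E r = g r := by
      intro r hr
      rw [codeIndex, ← Nat.mod_mul_right_mod _ n (d + 1), hdig r hr, Nat.add_mul_mod_self_left,
        Nat.mod_eq_of_lt (g r).2]
    have hcv : ∀ r < ℓ - 1, codeValue n d E r = J (g r) := by
      intro r hr
      rw [codeValue, ← Nat.mod_mul_right_div_self, hdig r hr, Nat.add_mul_div_left _ _ hn,
        Nat.div_eq_of_lt (g r).2, zero_add]
    refine ⟨E, hE, fun i => ?_⟩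
    rcases foldr_ite_cases (fun r => codeIndex n d E r = i)
      (fun r => α (codeValue n d E r) - α 0) 0 (ℓ - 1) with ⟨r, hr, hP, he⟩ | ⟨hno, he⟩
    · rw [codeCoord, he, hcv r hr]
      have : g r = i := Fin.ext ((hidx r hr).symm.trans hP)
      rw [this, hJ i]
    · rw [codeCoord, he]
      by_contra hi
      obtain ⟨r, hr, hri⟩ := hg i hi
      exact hno r hr ((hidx r hr).trans (by rw [hri]))
  · rintro ⟨E, _, hE⟩
    have hcases := fun i : Fin n => foldr_ite_cases (fun r => codeIndex n d E r = i)
      (fun r => α (codeValue n d E r) - α 0) 0 (ℓ - 1)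
    refine ⟨fun i => ?_, ?_⟩
    · rw [hE i, codeCoord]
      rcases hcases i with ⟨r, hr, hP, he⟩ | ⟨hno, he⟩
      · rw [he]
        have hlt : codeValue n d E r < d + 1 := Nat.mod_lt _ (Nat.succ_pos d)
        -- The value index 0 encodes α 0 - α 0 = 0, so a code may also address a coordinate without
        -- adding to the support.
        rcases hj : codeValue n d E r with _ | j
        · left; simp
        · right
          exact ⟨⟨j, by omega⟩, rfl⟩
      · exact Or.inl he
    · let S : Finset (Fin n) := (Finset.range (ℓ - 1)).image fun r =>
        ⟨codeIndex n d E r, Nat.mod_lt _ hn⟩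
      have hsub : {i | h i ≠ 0} ⊆ (S : Set (Fin n)) := by
        intro i hi
        rcases hcases i with ⟨r, hr, hP, he⟩ | ⟨hno, he⟩
        · exact Finset.mem_coe.2 (Finset.mem_image.2 ⟨r, Finset.mem_range.2 hr, Fin.ext hP⟩)
        · exact absurd ((hE i).trans he) hi
      have h1 := Set.ncard_le_ncard hsub (Finset.finite_toSet _)
      rw [Set.ncard_coe_finset] at h1
      have h2 : S.card ≤ ℓ - 1 := Finset.card_image_le.trans (by simp)
      omega

end Decode

/-! ### The program -/

section Program

variable {b : ℕ}

/-- Multiply `R[0]` by the `e`-th power of `x - y`. -/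
def factorStep (e : ℕ) {F : Type*} [Field F] (x y : F) (m : Mem F) : Mem F :=
  (List.range e).foldr (fun _ m => (Function.update m.1 0 (m.1 0 * m.1 1), m.2))
    (Function.update (Function.update (Function.update m.1 1 x) 2 y) 1 (x - y), m.2)

lemma factorStep_apply (e : ℕ) {F : Type*} [Field F] (x y : F) (m : Mem F) :
    (factorStep e x y m).1 0 = m.1 0 * (x - y) ^ e ∧ (factorStep e x y m).2 = m.2 := by
  have : ∀ (e : ℕ) (m : Mem F),
      ((List.range e).foldr (fun _ m => (Function.update m.1 0 (m.1 0 * m.1 1), m.2)) m).1 0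
        = m.1 0 * m.1 1 ^ e ∧
      ((List.range e).foldr (fun _ m => (Function.update m.1 0 (m.1 0 * m.1 1), m.2)) m).2
        = m.2 := by
    intro e
    induction e with
    | zero => intro m; simp
    | succ e ih =>
      intro m
      rw [foldr_range_succ]
      refine ⟨?_, (ih _).2⟩
      rw [(ih _).1]
      simp only [Function.update_self, ne_eq, one_ne_zero, not_false_eq_true,
        Function.update_of_ne]
      ring
  refine ⟨?_, (this _ _).2⟩
  rw [factorStep, (this _ _).1]
  simp

lemma Act.factorStep {e x y : (ℕ → ℕ) → ℕ} (he : Comp.{u} budget b e) (hx : Comp.{u} budget b x)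
    (hy : Comp.{u} budget b y) : Act.{u} budget b fun _ _ α v m =>
      SumROABP.factorStep (e v) (α (x v)) (α (y v)) m := by
  have h4 := he.four_le
  have h1 := ((Act.elem 1 hx).seq (Act.elem 2 hy)).seq
    (Act.ofInstr.{u} h4 (.fldSub 1 1 2) (fun _ _ m => (Function.update m.1 1 (m.1 1 - m.1 2), m.2))
      fun _ _ _ _ => ⟨rfl, rfl⟩)
  have h2 := h1.seq (Act.loop.{u} (body := fun _ _ _ _ _ m =>
    (Function.update m.1 0 (m.1 0 * m.1 1), m.2)) he (fun B hB => Act.ofInstr (by omega)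
      (.fldMul 0 0 1) (fun _ _ m => (Function.update m.1 0 (m.1 0 * m.1 1), m.2))
      fun _ _ _ _ => ⟨rfl, rfl⟩) (fun _ _ _ _ _ _ => rfl))
  simpa [SumROABP.factorStep] using h2

/-- Store the value at `α τ` of the `i`-th coordinate of the shift in `R[0]`. -/
def shiftStep (n d w c τ i : ℕ) {F : Type*} [Field F] (α : ℕ → F) (m : Mem F) : Mem F :=
  (List.range (numPlaces n d w c)).foldr (fun Q m => factorStep
    (iterWeight d (hashRange n d w c) (weightBase n d w c) (Nat.clog 2 n) Q i) (α τ) (α Q) m)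
    (Function.update m.1 0 1, m.2)

lemma shiftStep_apply (n d w c τ i : ℕ) {F : Type*} [Field F] (α : ℕ → F) (m : Mem F) :
    (shiftStep n d w c τ i α m).1 0 = (shiftPoly α d (hashRange n d w c) (weightBase n d w c)
      (Nat.clog 2 n) i).eval (α τ) ∧ (shiftStep n d w c τ i α m).2 = m.2 := by
  have : ∀ (k : ℕ) (g : ℕ → ℕ) (m : Mem F),
      ((List.range k).foldr (fun Q m => factorStep (g Q) (α τ) (α Q) m) m).1 0 =
        m.1 0 * ∏ Q ∈ Finset.range k, (α τ - α Q) ^ g Q ∧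
      ((List.range k).foldr (fun Q m => factorStep (g Q) (α τ) (α Q) m) m).2 = m.2 := by
    intro k g
    induction k with
    | zero => intro m; simp
    | succ k ih =>
      intro m
      rw [foldr_range_succ]
      refine ⟨?_, (ih _).2.trans (factorStep_apply _ _ _ _).2⟩
      rw [(ih _).1, (factorStep_apply _ _ _ _).1, Finset.prod_range_succ]
      ring
  refine ⟨?_, (this _ _ _).2⟩
  rw [shiftStep, (this _ _ _).1, eval_shiftPoly]
  simp [numPlaces]

lemma Act.shiftStep {τ i : (ℕ → ℕ) → ℕ} (hτ : Comp.{u} budget b τ) (hi : Comp.{u} budget b i) :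
    Act.{u} budget b fun _ _ α v m =>
      SumROABP.shiftStep (v 0) (v 1) (v 2) (v 3) (τ v) (i v) α m := by
  have h4 := hτ.four_le
  have h0 := Act.ofInstr.{u} (β := budget) h4 (.fldOne 0)
    (fun _ _ m => (Function.update m.1 0 1, m.2)) fun _ _ _ _ => ⟨rfl, rfl⟩
  refine h0.seq (Act.loop.{u} (body := fun _ _ α v Q m => SumROABP.factorStep
    (iterWeight (v 1) (hashRange (v 0) (v 1) (v 2) (v 3)) (weightBase (v 0) (v 1) (v 2) (v 3))
      (Nat.clog 2 (v 0)) Q (i v)) (α (τ v)) (α Q) m) (Comp.numPlaces h4) (fun B hB => ?_)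
      (fun F _ α v v' hv => ?_))
  · have hB4 : 4 ≤ B + 1 := by omega
    have hreg : ∀ {j}, j < B + 1 → Comp.{u} budget (B + 1) fun v => v j := fun hj =>
      Comp.reg hB4 hj
    refine Act.factorStep (Comp.iterWeight (hreg (by omega)) (Comp.hashRange hB4)
      (Comp.weightBase hB4) (Comp.clog (hreg (by omega))) (hreg (by omega)) (hi.mono (by omega))
      (fun v hv => ⟨Comp.hashRange_pos v, ?_⟩)
      ⟨_, fun v hv => le_bound_pow hv (maxWeight_le hv.1 hv.2.1 hv.2.2.1 hv.2.2.2)⟩)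
      (hτ.mono (by omega)) (hreg (by omega))
    exact (Nat.le_mul_of_pos_left _ (Nat.mul_pos hv.1 hv.2.1)).trans (Nat.le_succ _)
  · simp only [hv 0 (by omega), hv 1 (by omega), hv 2 (by omega), hv 3 (by omega),
      hi.congr v v' hv, hτ.congr v v' hv]

/-- Store the `i`-th coordinate of the low-support point with code `E` in `R[3]`. -/
def codeStep (n d ℓ E i : ℕ) {F : Type*} [Field F] (α : ℕ → F) (m : Mem F) : Mem F :=
  (List.range (ℓ - 1)).foldr (fun r m =>
    if (codeIndex n d E r - i) + (i - codeIndex n d E r) = 0 then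
      (Function.update (Function.update (Function.update m.1 3 (α (codeValue n d E r))) 4 (α 0)) 3
        (α (codeValue n d E r) - α 0), m.2)
    else m) (Function.update m.1 3 0, m.2)

lemma codeStep_apply (n d ℓ E i : ℕ) {F : Type*} [Field F] (α : ℕ → F) (m : Mem F) :
    (codeStep n d ℓ E i α m).1 3 = codeCoord α n d (ℓ - 1) E i ∧
    (codeStep n d ℓ E i α m).1 0 = m.1 0 ∧ (codeStep n d ℓ E i α m).2 = m.2 := by
  unfold codeStep codeCoord
  have : ∀ (k : ℕ) (m : Mem F) (x : F), m.1 3 = x →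
      ∀ m', (List.range k).foldr (fun r m =>
        if (codeIndex n d E r - i) + (i - codeIndex n d E r) = 0 then
          (Function.update (Function.update (Function.update m.1 3 (α (codeValue n d E r))) 4 (α 0))
            3 (α (codeValue n d E r) - α 0), m.2)
        else m) m = m' →
      m'.1 3 = (List.range k).foldr (fun r x => if codeIndex n d E r = i then
        α (codeValue n d E r) - α 0 else x) x ∧ m'.1 0 = m.1 0 ∧ m'.2 = m.2 := by
    intro k
    induction k with
    | zero => rintro m x hx m' rfl; exact ⟨hx, rfl, rfl⟩
    | succ k ih =>
      rintro m x hx m' hm'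
      rw [foldr_range_succ] at hm' ⊢
      -- The machine only tests for zero; two numbers are equal when both truncated differences
      -- vanish.
      have hiff : (codeIndex n d E k - i) + (i - codeIndex n d E k) = 0 ↔ codeIndex n d E k = i := by
        omega
      by_cases hk : codeIndex n d E k = i
      · rw [if_pos (hiff.2 hk)] at hm'
        rw [if_pos hk]
        have := ih _ (α (codeValue n d E k) - α 0) (by simp) m' hm'
        simpa using this
      · rw [if_neg (hiff.not.2 hk)] at hm'
        rw [if_neg hk]
        exact ih m x hx m' hm'
  have h := this (ℓ - 1) (Function.update m.1 3 0, m.2) 0 (by simp) _ rfl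
  simpa using h

lemma Comp.codeIndex {E r : (ℕ → ℕ) → ℕ} (hE : Comp.{u} budget b E) (hr : Comp.{u} budget b r) :
    Comp.{u} budget b fun v => codeIndex (v 0) (v 1) (E v) (r v) := by
  have h4 := hE.four_le
  exact (hE.divPow ((reg h4 (by omega)).mul ((reg h4 (by omega)).add (const h4 1))) hr).mod
    (reg h4 (by omega))

lemma Comp.codeValue {E r : (ℕ → ℕ) → ℕ} (hE : Comp.{u} budget b E) (hr : Comp.{u} budget b r) :
    Comp.{u} budget b fun v => codeValue (v 0) (v 1) (E v) (r v) := by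
  have h4 := hE.four_le
  exact ((hE.divPow ((reg h4 (by omega)).mul ((reg h4 (by omega)).add (const h4 1))) hr).div
    (reg h4 (by omega))).mod ((reg h4 (by omega)).add (const h4 1))

lemma Act.codeStep {E i : (ℕ → ℕ) → ℕ} (hE : Comp.{u} budget b E) (hi : Comp.{u} budget b i) :
    Act.{u} budget b fun _ _ α v m =>
      SumROABP.codeStep (v 0) (v 1) (supportBound (v 1) (v 2) (v 3)) (E v) (i v) α m := by
  have h4 := hE.four_le
  have h0 := Act.ofInstr.{u} (β := budget) h4 (.fldZero 3)
    (fun _ _ m => (Function.update m.1 3 0, m.2)) fun _ _ _ _ => ⟨rfl, rfl⟩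
  refine h0.seq (Act.loop.{u} (body := fun _ _ α v r m =>
    if (SumROABP.codeIndex (v 0) (v 1) (E v) r - i v) +
      (i v - SumROABP.codeIndex (v 0) (v 1) (E v) r) = 0 then
      (Function.update (Function.update (Function.update m.1 3
        (α (SumROABP.codeValue (v 0) (v 1) (E v) r))) 4 (α 0)) 3
        (α (SumROABP.codeValue (v 0) (v 1) (E v) r) - α 0), m.2)
    else m) ((Comp.supportBound h4).sub (Comp.const h4 1)) (fun B hB => ?_)
      (fun F _ α v v' hv => ?_))
  · have hE' := hE.mono (show b ≤ B + 1 by omega)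
    have hi' := hi.mono (show b ≤ B + 1 by omega)
    have hB4 : 4 ≤ B + 1 := by omega
    have hr : Comp.{u} budget (B + 1) fun v => v B := Comp.reg hB4 (by omega)
    have hidx := Comp.codeIndex hE' hr
    have h1 := ((Act.elem 3 (Comp.codeValue hE' hr)).seq (Act.elem 4 (Comp.const hB4 0))).seq
      (Act.ofInstr.{u} hB4 (.fldSub 3 3 4)
        (fun _ _ m => (Function.update m.1 3 (m.1 3 - m.1 4), m.2)) fun _ _ _ _ => ⟨rfl, rfl⟩)
    have h2 := Act.ifZero ((hidx.sub hi').add (hi'.sub hidx)) h1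
    simpa using h2
  · simp only [hv 0 (by omega), hv 1 (by omega), hi.congr v v' hv, hE.congr v v' hv]

/-- Output the `i`-th coordinate of the point with the indices `τ` and `E`. -/
def coordStep (n d w c τ E i : ℕ) {F : Type*} [Field F] (α : ℕ → F) (m : Mem F) : Mem F :=
  let m' := codeStep n d (supportBound d w c) E i α (shiftStep n d w c τ i α m)
  (Function.update m'.1 0 (m'.1 3 + m'.1 0), m'.2 ++ [m'.1 3 + m'.1 0])

/-- The `i`-th coordinate of the point with the indices `τ` and `E`. -/
noncomputable def pointCoord {F : Type*} [Field F] (α : ℕ → F) (n d w c τ E i : ℕ) : F :=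
  codeCoord α n d (supportBound d w c - 1) E i +
    (shiftPoly α d (hashRange n d w c) (weightBase n d w c) (Nat.clog 2 n) i).eval (α τ)

lemma coordStep_apply (n d w c τ E i : ℕ) {F : Type*} [Field F] (α : ℕ → F) (m : Mem F) :
    (coordStep n d w c τ E i α m).2 = m.2 ++ [pointCoord α n d w c τ E i] := by
  obtain ⟨h1, h2⟩ := shiftStep_apply n d w c τ i α m
  obtain ⟨h3, h4, h5⟩ := codeStep_apply n d (supportBound d w c) E i α
    (shiftStep n d w c τ i α m)
  simp only [coordStep, pointCoord, h3, h4, h5, h1, h2]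

lemma Act.coordStep {τ E i : (ℕ → ℕ) → ℕ} (hτ : Comp.{u} budget b τ) (hE : Comp.{u} budget b E)
    (hi : Comp.{u} budget b i) : Act.{u} budget b fun _ _ α v m =>
      SumROABP.coordStep (v 0) (v 1) (v 2) (v 3) (τ v) (E v) (i v) α m := by
  have h4 := hE.four_le
  have h := (((Act.shiftStep hτ hi).seq (Act.codeStep hE hi)).seq
    (Act.ofInstr.{u} h4 (.fldAdd 0 3 0)
      (fun _ _ m => (Function.update m.1 0 (m.1 3 + m.1 0), m.2)) fun _ _ _ _ => ⟨rfl, rfl⟩)).seq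
    (Act.ofInstr.{u} h4 (.emit 0) (fun _ _ m => (m.1, m.2 ++ [m.1 0])) fun _ _ _ _ => ⟨rfl, rfl⟩)
  simpa [SumROABP.coordStep] using h

/-- Output all points. -/
def mainStep (n d w c : ℕ) {F : Type*} [Field F] (α : ℕ → F) (m : Mem F) : Mem F :=
  (List.range (numValues n d w c)).foldr (fun τ m =>
    (List.range (numCodes n d w c)).foldr (fun E m =>
      (List.range n).foldr (fun j m => coordStep n d w c τ E (n - 1 - j) α m) m) m) m

lemma foldr_output {F : Type*} (f : ℕ → Mem F → Mem F) (o : ℕ → List F)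
    (hf : ∀ j m, (f j m).2 = m.2 ++ o j) (k : ℕ) (m : Mem F) :
    ((List.range k).foldr f m).2 = m.2 ++ (List.range k).reverse.flatMap o := by
  induction k generalizing m with
  | zero => simp
  | succ k ih => rw [foldr_range_succ, ih, hf, List.range_succ, List.reverse_append]; simp

/-- The list of all points that are output. -/
noncomputable def points {F : Type*} [Field F] (α : ℕ → F) (n d w c : ℕ) : List (Fin n → F) :=
  (List.range (numValues n d w c)).reverse.flatMap fun τ =>
    (List.range (numCodes n d w c)).reverse.map fun E i => pointCoord α n d w c τ E i

lemma mainStep_apply (n d w c : ℕ) {F : Type*} [Field F] (α : ℕ → F) (m : Mem F) :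
    (mainStep n d w c α m).2 = m.2 ++ (points α n d w c).flatMap fun a => List.ofFn a := by
  have h1 : ∀ (τ E : ℕ) (m : Mem F), ((List.range n).foldr (fun j m =>
      coordStep n d w c τ E (n - 1 - j) α m) m).2 =
      m.2 ++ List.ofFn fun i : Fin n => pointCoord α n d w c τ E i := by
    intro τ E m
    rw [foldr_output _ _ fun j m => coordStep_apply n d w c τ E (n - 1 - j) α m]
    congr 1
    rw [← List.map_eq_flatMap]
    -- Loops run downward, so addressing the coordinate n - 1 - j writes the coordinates in
    -- increasing order.
    refine List.ext_getElem (by simp) fun i h _ => ?_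
    simp only [List.length_map, List.length_reverse, List.length_range] at h
    simp only [List.getElem_map, List.getElem_reverse, List.length_range, List.getElem_range,
      List.getElem_ofFn]
    congr 1
    omega
  rw [mainStep, foldr_output _ _ fun τ m => foldr_output _ _ (fun E m => h1 τ E m) _ m, points,
    List.flatMap_assoc]
  simp only [List.flatMap_map]

lemma Act.mainStep : Act.{u} budget 4 fun _ _ α v m =>
    SumROABP.mainStep (v 0) (v 1) (v 2) (v 3) α m := by
  have h4 : 4 ≤ 4 := le_rfl
  refine Act.loop.{u} (body := fun _ _ α v τ m =>
    (List.range (numCodes (v 0) (v 1) (v 2) (v 3))).foldr (fun E m =>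
      (List.range (v 0)).foldr (fun j m =>
        SumROABP.coordStep (v 0) (v 1) (v 2) (v 3) τ E (v 0 - 1 - j) α m) m) m)
    (Comp.numValues h4) (fun B hB => ?_) (fun F _ α v v' hv => ?_)
  · refine Act.loop.{u} (body := fun _ _ α v E m =>
      (List.range (v 0)).foldr (fun j m =>
        SumROABP.coordStep (v 0) (v 1) (v 2) (v 3) (v B) E (v 0 - 1 - j) α m) m)
      (Comp.numCodes (by omega)) (fun B' hB' => ?_) (fun F _ α v v' hv => ?_)
    · refine Act.loop.{u} (body := fun _ _ α v j m =>
        SumROABP.coordStep (v 0) (v 1) (v 2) (v 3) (v B) (v B') (v 0 - 1 - j) α m)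
        (Comp.reg (by omega) (by omega)) (fun B'' hB'' => ?_) (fun F _ α v v' hv => ?_)
      · have hB4 : 4 ≤ B'' + 1 := by omega
        exact Act.coordStep (Comp.reg hB4 (by omega)) (Comp.reg hB4 (by omega))
          (((Comp.reg hB4 (by omega)).sub (Comp.const hB4 1)).sub (Comp.reg hB4 (by omega)))
      · simp only [hv 0 (by omega), hv 1 (by omega), hv 2 (by omega), hv 3 (by omega),
          hv B (by omega), hv B' (by omega)]
    · simp only [hv 0 (by omega), hv 1 (by omega), hv 2 (by omega), hv 3 (by omega),
        hv B (by omega)]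
  · simp only [hv 0 (by omega), hv 1 (by omega), hv 2 (by omega), hv 3 (by omega)]

/-- The program that outputs all points, with its running time. -/
theorem exists_program : ∃ (P : Prog) (κ : ℕ), ∀ (F : Type u) [Field F] (α : ℕ → F)
    (n d w c : ℕ), 1 ≤ n → 1 ≤ d → 1 ≤ w → 1 ≤ c → ∃ t,
      Constructs P α n d w c t (points α n d w c) ∧
      t ≤ (paramSize n d w ^ (c * 2 ^ c * Nat.log 2 (paramSize n d w))) ^ κ := by
  obtain ⟨p, hp⟩ := Act.mainStep.{u}.prog 4 le_rfl
  -- Exponent 1 suffices, because each of the four inputs is at most the budget.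
  obtain ⟨κ, hκ⟩ := hp 1
  refine ⟨p, κ, fun F _ α n d w c hn hd hw hc => ?_⟩
  have hgood : budget.good (initState F n d w c).nat := ⟨hn, hd, hw, hc⟩
  have hbound : budget.bound (initState F n d w c).nat =
      paramSize n d w ^ (c * 2 ^ c * Nat.log 2 (paramSize n d w)) := rfl
  obtain ⟨t, s, hr, ht, hm, _⟩ := hκ F α (initState F n d w c) hgood (by
    have hs := le_paramSize hn hd hw
    have h2 := two_le_paramSize n d w
    have hL := one_le_log_paramSize n d w
    have hE : 1 ≤ c * 2 ^ c * Nat.log 2 (paramSize n d w) := by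
      have : 0 < Nat.log 2 (paramSize n d w) := hL
      exact Nat.mul_pos (Nat.mul_pos hc (by positivity)) this
    have hle : paramSize n d w ≤ paramSize n d w ^ (c * 2 ^ c * Nat.log 2 (paramSize n d w)) :=
      Nat.le_self_pow (by omega) _
    intro i hi
    rw [hbound, pow_one]
    interval_cases i
    · exact hs.1.trans hle
    · exact hs.2.1.trans hle
    · exact hs.2.2.trans hle
    · calc c ≤ c * 2 ^ c * Nat.log 2 (paramSize n d w) := by
            rw [mul_assoc]
            exact Nat.le_mul_of_pos_right _ (Nat.mul_pos (by positivity) hL)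
        _ ≤ 2 ^ (c * 2 ^ c * Nat.log 2 (paramSize n d w)) := Nat.lt_two_pow_self.le
        _ ≤ _ := Nat.pow_le_pow_left h2 _)
  refine ⟨t, ⟨s, hr, ?_⟩, hbound ▸ ht⟩
  have h1 := congrArg Prod.snd hm
  rw [mainStep_apply] at h1
  simpa [initState] using h1

end Program

/-! ### The main theorem -/

/-- The codes run through exactly the low-support grid points, so the emitted list has the required
form for every supply α; distinctness plays no role here. -/
lemma setOf_mem_points {F : Type*} [Field F] [DecidableEq F] (α : ℕ → F) {n d w c : ℕ} (hn : 1 ≤ n)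
    (hw : 1 ≤ w) (hc : 1 ≤ c) :
    {a | a ∈ points α n d w c} = shiftedLowSupport (supportBound d w c)
      (fun j : Fin d => α (j + 1) - α 0)
      (fun i : Fin n => shiftPoly α d (hashRange n d w c) (weightBase n d w c) (Nat.clog 2 n) i)
      ((Finset.range (numValues n d w c)).image α) := by
  have hℓ : 1 ≤ supportBound d w c := (Nat.zero_le _).trans_lt (mul_log_lt_supportBound hw hc)
  ext a
  simp only [points, List.mem_flatMap, List.mem_reverse, List.mem_range, List.mem_map,
    Set.mem_ofPred_eq, shiftedLowSupport, Finset.mem_image, Finset.mem_range]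
  constructor
  · rintro ⟨τ, hτ, E, hE, rfl⟩
    obtain ⟨h1, h2⟩ := (lowSupport_iff_exists_code α hn hℓ
      (fun i : Fin n => codeCoord α n d (supportBound d w c - 1) E i)).2 ⟨E, hE, fun _ => rfl⟩
    exact ⟨α τ, ⟨τ, hτ, rfl⟩, _, h1, h2, fun i => rfl⟩
  · rintro ⟨_, ⟨τ, hτ, rfl⟩, h, h1, h2, h3⟩
    obtain ⟨E, hE, hcode⟩ := (lowSupport_iff_exists_code α hn hℓ h).1 ⟨h1, h2⟩
    refine ⟨τ, hτ, E, hE, funext fun i => ?_⟩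
    rw [h3 i, hcode i]
    rfl

end SumROABP

theorem theorem4p9 :
    ∃ (P : SumROABP.Prog) (K : ℕ),
      ∀ (F : Type*) [Field F] (n d w c : ℕ), 1 ≤ n → 1 ≤ d → 1 ≤ w → 1 ≤ c →
      ∀ s L M : ℕ, s = SumROABP.paramSize n d w → L = Nat.log 2 s → M = s ^ (K * 2 ^ c * L) →
      ∀ α : ℕ → F, Set.InjOn α (Set.Iio M) →
        ∃ (t : ℕ) (H : List (Fin n → F)),
          SumROABP.Constructs P α n d w c t H ∧
          t ≤ s ^ (K * (c * 2 ^ c * L)) ∧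
          SumROABP.IsHittingSet d w c {a | a ∈ H} ∧
          ∃ (f : Fin n → Polynomial F) (T : Finset F) (β : Fin d → F),
            (∀ i, (f i).natDegree ≤ M) ∧ T.card ≤ M ∧
            Function.Injective β ∧ (∀ j, β j ≠ 0) ∧
            (∀ A : MvPolynomial (Fin n) F,
              SumROABP.HasIndividualDegree d A → SumROABP.SumOfROABPs c w A →
              SumROABP.IsConcentrated (SumROABP.supportBound d w c) (SumROABP.shift A f)) ∧
            {a | a ∈ H} =
              SumROABP.shiftedLowSupport (SumROABP.supportBound d w c) β f T := by
  classical
  obtain ⟨P, κ, hP⟩ := SumROABP.exists_program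
  -- The exponent κ comes from the running time and 82 from the number of values of t, the largest
  -- number of supply elements that must be distinct.
  refine ⟨P, κ + 82, ?_⟩
  rintro F _ n d w c hn hd hw hc s L M rfl rfl rfl α hα
  obtain ⟨t, hcons, ht⟩ := hP F α n d w c hn hd hw hc
  have h2 := SumROABP.two_le_paramSize n d w
  have hs := SumROABP.le_paramSize hn hd hw
  set s := SumROABP.paramSize n d w with hsdef
  have hE := SumROABP.two_le_exponent n d w hc
  rw [← hsdef] at hE
  have hM : ∀ {m a : ℕ}, a ≤ κ + 82 → m ≤ s ^ (a * (2 ^ c * Nat.log 2 s)) →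
      m ≤ s ^ ((κ + 82) * 2 ^ c * Nat.log 2 s) := fun ha hm => hm.trans (by
    rw [mul_assoc]
    exact Nat.pow_le_pow_right (by omega) (Nat.mul_le_mul_right _ ha))
  have hplaces := hM (by omega) (SumROABP.numPlaces_le hn hd hw hc)
  have hvalues := hM (by omega) (SumROABP.numValues_le hn hd hw hc)
  have hNpos : 0 < SumROABP.hashRange n d w c := by unfold SumROABP.hashRange; omega
  have hNB : SumROABP.hashRange n d w c ≤ SumROABP.weightBase n d w c :=
    (Nat.le_mul_of_pos_left _ (Nat.mul_pos hn hd)).trans (Nat.le_succ _)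
  have hrank : SumROABP.PreservesRank d (SumROABP.bigWidth d w c)
      (fun i : Fin n => SumROABP.shiftPoly α d (SumROABP.hashRange n d w c)
        (SumROABP.weightBase n d w c) (Nat.clog 2 n) i) := by
    refine SumROABP.preservesRank_shiftPoly ?_ le_rfl le_rfl (Nat.le_pow_clog (by norm_num) n)
      (hα.mono fun x hx => ?_)
    · have h1 : d + 1 ≤ SumROABP.bigWidth d w c :=
        Nat.le_mul_of_pos_right _ (Nat.pow_pos (by omega))
      exact h1.trans (Nat.le_self_pow (by norm_num) _)
    · exact lt_of_lt_of_le hx hplaces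
  have hdeg : ∀ i : Fin n, (SumROABP.shiftPoly α d (SumROABP.hashRange n d w c)
      (SumROABP.weightBase n d w c) (Nat.clog 2 n) i).natDegree ≤
      SumROABP.numPlaces n d w c * SumROABP.maxWeight n d w c := fun i =>
    SumROABP.natDegree_shiftPoly_le α hNpos hNB _ _
  have hdM : d + 1 ≤ s ^ ((κ + 82) * 2 ^ c * Nat.log 2 s) := hM (a := 1) (by omega) (by
    calc d + 1 ≤ s ^ 2 := by nlinarith [hs.2.1]
      _ ≤ _ := Nat.pow_le_pow_right (by omega) (by omega))
  have hinj : Set.InjOn α (Set.Iio (d + 1)) := hα.mono fun x hx => lt_of_lt_of_le hx hdM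
  have hcardT : ((Finset.range (SumROABP.numValues n d w c)).image α).card =
      SumROABP.numValues n d w c := by
    rw [Finset.card_image_of_injOn, Finset.card_range]
    intro x hx y hy hxy
    exact hα (lt_of_lt_of_le (Finset.mem_range.1 hx) hvalues)
      (lt_of_lt_of_le (Finset.mem_range.1 hy) hvalues) hxy
  -- Differences with α 0 are used because some α j may be zero, whereas the β's must be nonzero.
  have hβ : Function.Injective fun j : Fin d => α (j + 1) - α 0 := by
    intro i j hij
    have := hinj (Set.mem_Iio.2 (by omega)) (Set.mem_Iio.2 (by omega)) (sub_left_injective hij)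
    exact Fin.ext (by omega)
  have hβ0 : ∀ j : Fin d, α (j + 1) - α 0 ≠ 0 := by
    intro j hj
    have := hinj (Set.mem_Iio.2 (by omega)) (Set.mem_Iio.2 (by omega)) (sub_eq_zero.1 hj)
    omega
  refine ⟨t, SumROABP.points α n d w c, hcons, ht.trans ?_, ?_, _,
    (Finset.range (SumROABP.numValues n d w c)).image α, fun j => α (j + 1) - α 0, fun i => ?_,
    hcardT.trans_le hvalues, hβ, hβ0,
    fun A hA hsum => SumROABP.isConcentrated_shift hw hc hrank hsum hA,
    SumROABP.setOf_mem_points α hn hw hc⟩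
  · rw [← pow_mul, mul_comm]
    exact Nat.pow_le_pow_right (by omega) (Nat.mul_le_mul_right _ (by omega))
  · rw [SumROABP.setOf_mem_points α hn hw hc]
    -- The number of values for t exceeds n d times the degree bound of the shift by exactly 1.
    refine SumROABP.isHittingSet_shiftedLowSupport hw hc hrank hdeg hβ hβ0 ?_
    rw [hcardT]
    exact Nat.lt_succ_self _
  · refine (hdeg i).trans (le_trans ?_ hvalues)
    exact (Nat.le_mul_of_pos_left _ (Nat.mul_pos hn hd)).trans (Nat.le_succ _)
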